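/- Let $V$ be a real random variable with probability density $f$, where $f\in L^p(\mathbb R)$ for some $p>1$. Let $\nu_f(x)=\int_{-\sqrt x}^{\sqrt x}y^4f(y)\,dy$, assume $\int_{\mathbb R}x^2f(x)\,dx=E<\infty$, and assume that $\nu_f(x)\sim C_S\,x^{2-\alpha}$ as $x\to\infty$ for some $C_S>0$ and $1<\alpha<2$. Let $h$ be a probability density of $V^2$, let $h^{*N}$ be its $N$-fold iterated convolution, put $$\sigma=C_S\,\frac{\Gamma(3-\alpha)}{\alpha(\alpha-1)}\left|\cos\tfrac{\pi\alpha}{2}\right|>0,\qquad \widehat\gamma_{\sigma,\alpha,1}(\xi)=e^{-\sigma|\xi|^\alpha\left(1+i\,\mathrm{sgn}(\xi)\tan\frac{\pi\alpha}{2}\right)},\qquad \gamma_{\sigma,\alpha,1}(x)=\frac1{2\pi}\int_{\mathbb R}\widehat\gamma_{\sigma,\alpha,1}(\xi)e^{i\xi x}\,d\xi ,$$ and define $\eta$ by $\int_{\mathbb R}e^{-i\xi(x-E)}h(x)\,dx=1-\sigma|\xi|^\alpha\left(1+i\,\mathrm{sgn}(\xi)\tan\frac{\pi\alpha}2\right)+\eta(\xi)$,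 and $\omega_\eta(b)=\sup_{|\xi|\le b}|\eta(\xi)|/|\xi|^\alpha$. Then: 1. There is a sequence $\epsilon(N)\to0$ such that for all sufficiently large $N$ $$\sup_{x\in\mathbb R}\left|h^{*N}(x)-\frac{1}{N^{1/\alpha}}\,\gamma_{\sigma,\alpha,1}\!\left(\frac{x-NE}{N^{1/\alpha}}\right)\right|\le\frac{\epsilon(N)}{N^{1/\alpha}} .$$ 2. The error can be bounded explicitly. The function $\eta(\xi)/|\xi|^\alpha$ is bounded and tends to $0$ as $\xi\to0$; $h\in L^{p'}(\mathbb R)$ for some $p'>1$; and for every real $p'>1$ with $h\in L^{p'}(\mathbb R)$ there is a constant $C>0$ such that for every $\tau>0$ there is a function $\varphi_\tau$ with $\varphi_\tau(b)/|b|^{2+\tau}\to0$ as $b\to0$ such that, for every positive sequence $b_N\to0$, the left-hand side in 1 is at most $\epsilon_\tau(N)/N^{1/\alpha}$ for all sufficiently large $N$, where $$\epsilon_\tau(N)=C\left(N^{1/\alpha}\left(1-b_N^{2+\tau}+\varphi_\tau(b_N)\right)^{N-q'}+e^{-\sigma Nb_N^\alpha/2}+\omega_\eta(b_N)+2\sigma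 b_N^\alpha\left(1+\tan^2\tfrac{\pi\alpha}2\right)\right)$$ and $q'$ is the Hölder conjugate of $\min(2,p')$. Moreover $\epsilon_\tau(N)\to0$ whenever $N b_N^{2+\tau}/\log N\to\infty$. 3. Let $\mathcal Z_N(f,\rho)=\int_{\mathbb S^{N-1}(\rho)}f(v_1)\cdots f(v_N)\,d\sigma^N_\rho$, where $\sigma^N_\rho$ is the uniform probability measure on the sphere $\mathbb S^{N-1}(\rho)\subset\mathbb R^N$ of radius $\rho$ centred at the origin, and let $|\mathbb S^{N-1}|$ be the surface area of the unit sphere. Then there are functions $\lambda_N:\mathbb R\to\mathbb R$ with $\sup_u|\lambda_N(u)|\to0$ as $N\to\infty$ such that for all $N\ge1$ and $r>0$ $$\mathcal Z_N(f,\sqrt r)=\frac{2}{|\mathbb S^{N-1}|\,r^{\frac{N-2}2}}\,\frac1{N^{1/\alpha}}\left(\gamma_{\sigma,\alpha,1}\!\left(\frac{r-NE}{N^{1/\alpha}}\right)+\lambda_N(r)\right).$$ -/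

import Mathlib

open MeasureTheory ProbabilityTheory Filter Topology Asymptotics

noncomputable section

/-- `g` is a probability density function (with respect to Lebesgue measure) of the real
random variable `X` on `(Ω, P)`. -/
def IsDensityOf {Ω : Type*} [MeasurableSpace Ω] (g : ℝ → ℝ) (X : Ω → ℝ) (P : Measure Ω) : Prop :=
  Measurable g ∧ (∀ x, 0 ≤ g x) ∧
    HasLaw X ((volume : Measure ℝ).withDensity fun x => ENNReal.ofReal (g x)) P

/-- The `N`-fold iterated convolution `g * ⋯ * g` (`N ≥ 1`; the value at `N = 0` is irrelevant). -/
def convPow (g : ℝ → ℝ) : ℕ → ℝ → ℝ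
  | 0 => 0
  | 1 => g
  | n + 2 => convolution g (convPow g (n + 1)) (ContinuousLinearMap.mul ℝ ℝ) volume

/-- `ν_f(x) = ∫_{-√x}^{√x} y⁴ f(y) dy`. -/
def truncFourth (f : ℝ → ℝ) (x : ℝ) : ℝ :=
  ∫ y in (-√x)..(√x), y ^ 4 * f y

/-- The exponent `σ |ξ|^α (1 + i β sgn(ξ) tan(πα/2))`. -/
def stableExponent (σ α β ξ : ℝ) : ℂ :=
  ((σ * |ξ| ^ α : ℝ) : ℂ) *
    (1 + Complex.I * ((β * Real.sign ξ * Real.tan (Real.pi * α / 2) : ℝ) : ℂ))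

/-- The Fourier transform `exp(-σ |ξ|^α (1 + i β sgn(ξ) tan(πα/2)))` of the stable law. -/
def stableHat (σ α β ξ : ℝ) : ℂ :=
  Complex.exp (-stableExponent σ α β ξ)

/-- The stable density `γ_{σ,α,β}(x) = (2π)⁻¹ ∫ γ̂_{σ,α,β}(ξ) e^{iξx} dξ`. The integral is a real
number, see `stableDensity_eq`. -/
def stableDensity (σ α β x : ℝ) : ℝ :=
  ((1 / (2 * Real.pi) : ℂ) *
    ∫ ξ : ℝ, stableHat σ α β ξ * Complex.exp (Complex.I * ξ * x)).re

theorem stableHat_neg (σ α β ξ : ℝ) :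
    stableHat σ α β (-ξ) = (starRingEnd ℂ) (stableHat σ α β ξ) := by
  unfold stableHat stableExponent
  rw [← Complex.exp_conj]
  congr 1
  simp only [abs_neg, Real.sign_neg, map_neg, map_mul, map_add, map_one, Complex.conj_I,
    Complex.conj_ofReal]
  push_cast
  ring

theorem stableDensity_eq (σ α β x : ℝ) :
    (stableDensity σ α β x : ℂ) = (1 / (2 * Real.pi) : ℂ) *
      ∫ ξ : ℝ, stableHat σ α β ξ * Complex.exp (Complex.I * ξ * x) := by
  unfold stableDensity
  refine Complex.conj_eq_iff_re.mp ?_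
  rw [map_mul, ← integral_conj]
  congr 1
  · simp only [map_div₀, map_one, map_mul, Complex.conj_ofReal, Complex.conj_ofNat]
  · rw [← integral_neg_eq_self]
    congr 1
    funext ξ
    rw [map_mul, stableHat_neg, Complex.conj_conj, ← Complex.exp_conj]
    congr 2
    simp [Complex.conj_ofReal]

/-- The scale parameter `σ = C_S Γ(3-α) / (α(α-1)) |cos(πα/2)|`, which is positive for
`C_S > 0` and `1 < α < 2`. -/
def stableScale (C_S α : ℝ) : ℝ :=
  C_S * (Real.Gamma (3 - α) / (α * (α - 1))) * |Real.cos (Real.pi * α / 2)|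

/-- The remainder `η` in
`∫ e^{-iξ(x-E)} g(x) dx = 1 - σ |ξ|^α (1 + i sgn(ξ) tan(πα/2)) + η(ξ)`. -/
def remainderFn (g : ℝ → ℝ) (E σ α ξ : ℝ) : ℂ :=
  (∫ x : ℝ, Complex.exp (-(Complex.I * ξ * (x - E))) * (g x : ℂ)) - 1 + stableExponent σ α 1 ξ

/-- `ω_η(b) = sup_{|ξ| ≤ b} |η(ξ)| / |ξ|^α`. -/
def omegaFn (η : ℝ → ℂ) (α b : ℝ) : ℝ :=
  sSup ((fun ξ : ℝ => ‖η ξ‖ / |ξ| ^ α) '' Set.Icc (-b) b)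

/-- The error bound
`C (N^{1/α} (1 - b^{2+τ} + φ(b))^{N-q} + e^{-σ N b^α / 2} + ω_η(b) + 2 σ b^α (1 + tan²(πα/2)))`. -/
def errorBound (C σ α τ q : ℝ) (φ : ℝ → ℝ) (η : ℝ → ℂ) (N : ℕ) (b : ℝ) : ℝ :=
  C * ((N : ℝ) ^ (1 / α) * (1 - b ^ (2 + τ) + φ b) ^ ((N : ℝ) - q)
    + Real.exp (-(σ * N * b ^ α / 2))
    + omegaFn η α b
    + 2 * σ * b ^ α * (1 + Real.tan (Real.pi * α / 2) ^ 2))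

/-- The surface area `|S^{N-1}|` of the unit sphere of `ℝ^N`. -/
def sphereArea (N : ℕ) : ℝ :=
  ((volume : Measure (EuclideanSpace ℝ (Fin N))).toSphere Set.univ).toReal

/-- The uniform probability measure on the sphere `S^{N-1}(r)` of radius `r` in `ℝ^N`: the
normalised surface measure of the unit sphere, dilated by `r`. -/
def uniformSphere (N : ℕ) (r : ℝ) : Measure (EuclideanSpace ℝ (Fin N)) :=
  (((volume : Measure (EuclideanSpace ℝ (Fin N))).toSphere Set.univ)⁻¹ •
      (volume : Measure (EuclideanSpace ℝ (Fin N))).toSphere).map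
    fun x : Metric.sphere (0 : EuclideanSpace ℝ (Fin N)) 1 => r • (x : EuclideanSpace ℝ (Fin N))

/-- The normalisation function `Z_N(f, r) = ∫_{S^{N-1}(r)} f(v₁) ⋯ f(v_N) dσ_r^N`. -/
def normalisation (N : ℕ) (f : ℝ → ℝ) (r : ℝ) : ℝ :=
  ∫ v, ∏ i, f (v i) ∂(uniformSphere N r)

end

noncomputable section

namespace StableLocalLimit

open Set

section

/-! ### The exponential in the right half-plane -/

/-! Write `ψ` for the centred Fourier transform of `h` (`centredCf`) and `S` for the stable
exponent. Fourier inversion bounds the deviation of `h^{*N}` from the rescaled stable density,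
uniformly in `x`, by `∫ ‖ψ^N - e^{-NS}‖` (`abs_convPow_sub_le`), and the problem becomes an `L¹`
estimate resting on three facts about `ψ`.

Expansion at the origin: `ψ = 1 - S + o(|ξ|^α)`. With `k(t) = (e^{-it} - 1 + it)/t²` one has
`e^{-iξy²} - 1 + iξy² = -ξ² y⁴ ∫_{ξy²}^∞ k'(t) dt` for `ξ > 0`. Integrating against `f` and
exchanging integrals produces `-ξ² ∫₀^∞ k'(t) ν_f(t/ξ) dt` (`cfRem_eq`), where the asymptotics of
`ν_f` enter by dominated convergence (`tendsto_cfRem`). The constant is a Gamma integral continued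
to the imaginary axis (`integral_kernelDeriv_mul`).

Decay away from the origin: a law with a density has `‖ψ(ξ)‖ < 1` for `ξ ≠ 0`, uniformly off
neighbourhoods of `0` by Riemann–Lebesgue and compactness (`exists_norm_cf_le`).

Integrability: `f ∈ L^p` puts `h` in some `L^{p'}` with `p' > 1`, because the singularity `1/√u` of
the Jacobian, raised to a small power, is absorbed by Young's inequality. A truncation argument with
an `L²` bound then shows that some power `‖ψ‖^k` is integrable (`exists_integrable_norm_cf_pow`).

The integral is split at `|ξ| = b`. Inside, telescoping `ψ^N - (e^{-S})^N` and substituting `y =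
N^{1/α} ξ` gives a multiple of `ω_η(b)` plus a multiple of `b^α`, over `N^{1/α}`. Outside, `‖ψ‖^N ≤
(1 - b^{2+τ})^{N-k} ‖ψ‖^k`, and the stable tail is exponentially small. As `b^{2+τ}` is negligible
against `b^α`, the correction `φ_τ` can be taken to vanish.

For the sphere, polar coordinates in the variable `|x|²` and slicing along one coordinate identify
the integral of `∏ f(v_i)` over the sphere of radius `√r`, up to the explicit factor, with
`h^{*N}(r)` (`lconvPow_eq_sphereProd`). The identity is needed at every `r`, not almost every `r`;
both the inversion and the slicing argument are arranged to give this. -/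

theorem norm_exp_neg_le_one {z : ℂ} (hz : 0 ≤ z.re) : ‖Complex.exp (-z)‖ ≤ 1 := by
  rw [Complex.norm_exp]
  simpa using hz

theorem convex_re_nonneg : Convex ℝ {z : ℂ | 0 ≤ z.re} :=
  convex_halfSpace_ge (f := Complex.re) ⟨fun _ _ => by simp, fun _ _ => by simp⟩ 0

theorem norm_one_sub_exp_neg_le {z : ℂ} (hz : 0 ≤ z.re) : ‖1 - Complex.exp (-z)‖ ≤ ‖z‖ := by
  have h := Convex.norm_image_sub_le_of_norm_hasDerivWithin_le (𝕜 := ℂ)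
    (f := fun w : ℂ => 1 - Complex.exp (-w)) (f' := fun w : ℂ => Complex.exp (-w))
    (s := {z : ℂ | 0 ≤ z.re}) (x := 0) (y := z) (C := 1)
    (fun w _ => by
      have := ((hasDerivAt_neg w).cexp.const_sub 1).hasDerivWithinAt (s := {z : ℂ | 0 ≤ z.re})
      simpa using this)
    (fun w hw => norm_exp_neg_le_one hw) convex_re_nonneg (by simp) hz
  simpa using h

/-- The second-order Taylor remainder of `exp (-z)` at the origin. -/
def expRem (z : ℂ) : ℂ := Complex.exp (-z) - 1 + z

theorem hasDerivAt_expRem (z : ℂ) : HasDerivAt expRem (1 - Complex.exp (-z)) z := by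
  have := ((hasDerivAt_neg z).cexp.sub_const 1).add (hasDerivAt_id z)
  refine this.congr_deriv ?_
  ring

theorem continuous_expRem : Continuous expRem := by
  unfold expRem; fun_prop

/-- The derivative `1 - e^{-w}` is at most `‖w‖ ≤ ‖z‖` on the intersection of the half-plane with
the ball of radius `‖z‖`, which is convex, so the mean value inequality applies. -/
theorem norm_expRem_le_sq {z : ℂ} (hz : 0 ≤ z.re) : ‖expRem z‖ ≤ ‖z‖ ^ 2 := by
  have h := Convex.norm_image_sub_le_of_norm_hasDerivWithin_le (𝕜 := ℂ)
    (f := expRem) (f' := fun w : ℂ => 1 - Complex.exp (-w))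
    (s := {z : ℂ | 0 ≤ z.re} ∩ Metric.closedBall 0 ‖z‖) (x := 0) (y := z) (C := ‖z‖)
    (fun w _ => (hasDerivAt_expRem w).hasDerivWithinAt)
    (fun w hw => (norm_one_sub_exp_neg_le hw.1).trans (by simpa using hw.2))
    (convex_re_nonneg.inter (convex_closedBall _ _)) (by simp) ⟨hz, by simp⟩
  simpa [expRem, sq] using h

theorem norm_expRem_le {z : ℂ} (hz : 0 ≤ z.re) : ‖expRem z‖ ≤ 2 * ‖z‖ := by
  have : expRem z = z - (1 - Complex.exp (-z)) := by unfold expRem; ring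
  rw [this, two_mul]
  exact (norm_sub_le _ _).trans (add_le_add le_rfl (norm_one_sub_exp_neg_le hz))

theorem norm_one_sub_exp_neg_le_two {z : ℂ} (hz : 0 ≤ z.re) : ‖1 - Complex.exp (-z)‖ ≤ 2 := by
  refine (norm_sub_le _ _).trans ?_
  have := norm_exp_neg_le_one hz
  simp only [norm_one]
  linarith

/-! ### Integrability of power-type functions on the half-line -/

/-- A two-sided power function. -/
def twoPow (a b t : ℝ) : ℝ := if t ≤ 1 then t ^ a else t ^ b

theorem integrableOn_twoPow {a b : ℝ} (ha : -1 < a) (hb : b < -1) :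
    IntegrableOn (twoPow a b) (Ioi 0) := by
  have hU : Ioi (0 : ℝ) = Ioc 0 1 ∪ Ioi 1 := by
    rw [Ioc_union_Ioi_eq_Ioi zero_le_one]
  rw [hU]
  refine IntegrableOn.union ?_ ?_
  · have h : IntegrableOn (fun t : ℝ => t ^ a) (Ioc 0 1) := by
      rw [← intervalIntegrable_iff_integrableOn_Ioc_of_le zero_le_one]
      exact intervalIntegral.intervalIntegrable_rpow' ha
    exact h.congr_fun (fun t ht => by simp [twoPow, ht.2]) measurableSet_Ioc
  · exact (integrableOn_Ioi_rpow_of_lt hb one_pos).congr_fun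
      (fun t ht => by simp [twoPow, not_le.mpr ht.out]) measurableSet_Ioi

theorem integrableOn_of_le_twoPow {F : ℝ → ℂ} {a b A : ℝ} (ha : -1 < a) (hb : b < -1)
    (hF : ContinuousOn F (Ioi 0)) (hle : ∀ t, 0 < t → ‖F t‖ ≤ A * twoPow a b t) :
    IntegrableOn F (Ioi 0) := by
  refine Integrable.mono' ((integrableOn_twoPow ha hb).const_mul A)
    (hF.aestronglyMeasurable measurableSet_Ioi) ?_
  filter_upwards [ae_restrict_mem measurableSet_Ioi] with t ht using hle t ht

theorem le_mul_twoPow {x A a b t : ℝ} (h1 : t ≤ 1 → x ≤ A * t ^ a) (h2 : 1 < t → x ≤ A * t ^ b) :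
    x ≤ A * twoPow a b t := by
  unfold twoPow
  split_ifs with h
  · exact h1 h
  · exact h2 (not_le.mp h)

/-! ### The Mellin-type integral of the remainder -/

/-- Identity theorem: the left side is the complex moment generating function at `-z` of the measure
`t^{s-1} dt`, hence analytic on the right half-plane, and the two sides agree at the real points `1
+ 1/(n+1)`, which accumulate at `1`. -/
theorem integral_rpow_mul_exp_neg_complex {s : ℝ} (hs : 0 < s) {z : ℂ} (hz : 0 < z.re) :
    ∫ t in Ioi (0 : ℝ), ((t ^ (s - 1) : ℝ) : ℂ) * Complex.exp (-(z * t))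
      = (1 / z) ^ (s : ℂ) * (Real.Gamma s : ℂ) := by
  set μ : Measure ℝ := (volume.restrict (Ioi 0)).withDensity
    fun t => ENNReal.ofReal (t ^ (s - 1)) with hμ
  have hmeas : Measurable fun t : ℝ => ENNReal.ofReal (t ^ (s - 1)) := by fun_prop
  have hset : Iio (0 : ℝ) ⊆ integrableExpSet id μ := by
    intro r hr
    simp only [integrableExpSet, mem_ofPred_eq, id]
    rw [hμ, integrable_withDensity_iff_integrable_smul₀' hmeas.aemeasurable (by simp)]
    have h := integrableOn_rpow_mul_exp_neg_mul_rpow (p := 1) (s := s - 1) (b := -r)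
      (by linarith) one_pos (by simpa using hr)
    refine (h.congr_fun (fun t ht => ?_) measurableSet_Ioi)
    have ht' : 0 ≤ t ^ (s - 1) := Real.rpow_nonneg (le_of_lt ht) _
    simp [ENNReal.toReal_ofReal ht']
  have hint : Iio (0 : ℝ) ⊆ interior (integrableExpSet id μ) :=
    interior_maximal hset isOpen_Iio
  have hval : ∀ w : ℂ, complexMGF id μ (-w) =
      ∫ t in Ioi (0 : ℝ), ((t ^ (s - 1) : ℝ) : ℂ) * Complex.exp (-(w * t)) := by
    intro w
    rw [complexMGF, hμ, integral_withDensity_eq_integral_toReal_smul hmeas (by simp)]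
    refine setIntegral_congr_fun measurableSet_Ioi (fun t ht => ?_)
    have ht' : 0 ≤ t ^ (s - 1) := Real.rpow_nonneg (le_of_lt ht) _
    simp [ENNReal.toReal_ofReal ht']
  have hf : AnalyticOnNhd ℂ (fun w => complexMGF id μ (-w)) {w | 0 < w.re} := by
    intro w hw
    have h1 : AnalyticAt ℂ (complexMGF id μ) (-w) :=
      analyticAt_complexMGF (hint (by simpa using hw))
    exact h1.fun_comp (f := fun w : ℂ => -w) (analyticAt_id.neg)
  have hg : AnalyticOnNhd ℂ (fun w : ℂ => (1 / w) ^ (s : ℂ) * (Real.Gamma s : ℂ))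
      {w | 0 < w.re} := by
    refine DifferentiableOn.analyticOnNhd (fun w hw => ?_)
      (isOpen_lt continuous_const Complex.continuous_re)
    have hw' : w ≠ 0 := by rintro rfl; simp at hw
    refine DifferentiableAt.differentiableWithinAt ?_
    refine DifferentiableAt.mul_const ?_ _
    refine DifferentiableAt.cpow_const ?_ ?_
    · exact (differentiableAt_const _).div differentiableAt_id hw'
    · left
      simp only [one_div, Complex.inv_re]
      exact div_pos hw (Complex.normSq_pos.mpr hw')
  have key := hf.eqOn_of_preconnected_of_frequently_eq hg
    ((convex_halfSpace_gt (f := Complex.re)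
      ⟨fun _ _ => by simp, fun _ _ => by simp⟩ 0).isPreconnected) (z₀ := 1) (by simp) ?_ hz
  · rw [← hval]; exact key
  · have hT : Tendsto (fun n : ℕ => ((1 + 1 / ((n : ℝ) + 1) : ℝ) : ℂ)) atTop (𝓝[≠] 1) := by
      refine tendsto_nhdsWithin_iff.mpr ⟨?_, Eventually.of_forall fun n => ?_⟩
      · have := (tendsto_one_div_add_atTop_nhds_zero_nat (𝕜 := ℝ)).const_add 1
        simp only [add_zero] at this
        exact (Complex.continuous_ofReal.tendsto 1).comp this
      · simp only [mem_compl_iff, mem_singleton_iff]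
        intro h
        have h2 : (1 + 1 / ((n : ℝ) + 1) : ℝ) = 1 := by exact_mod_cast h
        have : (0 : ℝ) < 1 / ((n : ℝ) + 1) := by positivity
        linarith
    refine hT.frequently (Frequently.of_forall fun n => ?_)
    have hr : (0 : ℝ) < 1 + 1 / ((n : ℝ) + 1) := by positivity
    set r := 1 + 1 / ((n : ℝ) + 1)
    simp only [hval]
    have h := Real.integral_rpow_mul_exp_neg_mul_Ioi hs hr
    have h' := congrArg (fun x : ℝ => (x : ℂ)) h
    beta_reduce at h'
    rw [← integral_complex_ofReal] at h'
    simp only [Complex.ofReal_mul, Complex.ofReal_exp, Complex.ofReal_neg] at h'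
    rw [h', Complex.ofReal_cpow (by positivity)]
    push_cast
    rfl

variable {α : ℝ}

/-- The quadratic bound on `expRem` serves near `0` and the linear one at infinity. The majorant
depends on `z` only through `‖z‖`, so it also dominates uniformly when `z` approaches the imaginary
axis. -/
theorem integrableOn_expRem_mul (hα₁ : 1 < α) (hα₂ : α < 2) {z : ℂ} (hz : 0 ≤ z.re) :
    IntegrableOn (fun t : ℝ => expRem (z * t) * ((t ^ (-1 - α) : ℝ) : ℂ)) (Ioi 0) ∧
    ∀ t : ℝ, 0 < t → ‖expRem (z * t) * ((t ^ (-1 - α) : ℝ) : ℂ)‖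
      ≤ (‖z‖ ^ 2 + 2 * ‖z‖) * twoPow (1 - α) (-α) t := by
  have hb : ∀ t : ℝ, 0 < t → ‖expRem (z * t) * ((t ^ (-1 - α) : ℝ) : ℂ)‖
      ≤ (‖z‖ ^ 2 + 2 * ‖z‖) * twoPow (1 - α) (-α) t := by
    intro t ht
    have hre : 0 ≤ (z * t).re := by simpa using mul_nonneg hz ht.le
    have hn : ‖z * (t : ℂ)‖ = ‖z‖ * t := by simp [abs_of_pos ht]
    have h0 := norm_nonneg z
    rw [norm_mul, Complex.norm_real, Real.norm_of_nonneg (Real.rpow_nonneg ht.le _)]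
    refine le_mul_twoPow (fun _ => ?_) (fun _ => ?_)
    · have : t ^ (1 - α) = t ^ 2 * t ^ (-1 - α) := by
        rw [← Real.rpow_natCast, ← Real.rpow_add ht]; congr 1; push_cast; ring
      rw [this, ← mul_assoc]
      refine mul_le_mul_of_nonneg_right ?_ (Real.rpow_nonneg ht.le _)
      refine (norm_expRem_le_sq hre).trans ?_
      rw [hn, mul_pow]
      nlinarith [sq_nonneg t]
    · have : t ^ (-α) = t * t ^ (-1 - α) := by
        nth_rewrite 2 [← Real.rpow_one t]
        rw [← Real.rpow_add ht]; congr 1; ring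
      rw [this, ← mul_assoc]
      refine mul_le_mul_of_nonneg_right ?_ (Real.rpow_nonneg ht.le _)
      refine (norm_expRem_le hre).trans ?_
      rw [hn]
      nlinarith [sq_nonneg ‖z‖]
  refine ⟨integrableOn_of_le_twoPow (by linarith) (by linarith) ?_ hb, hb⟩
  refine ContinuousOn.mul ((continuous_expRem.comp (by fun_prop)).continuousOn) ?_
  refine Complex.continuous_ofReal.comp_continuousOn ?_
  exact fun t ht => (Real.continuousAt_rpow_const _ _ (Or.inl ht.out.ne')).continuousWithinAt

theorem tendsto_rpow_nhdsGT_zero {a : ℝ} (ha : 0 < a) (A : ℝ) :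
    Tendsto (fun t : ℝ => A * t ^ a) (𝓝[>] 0) (𝓝 0) := by
  have h : ContinuousAt (fun t : ℝ => A * t ^ a) 0 :=
    continuousAt_const.mul (Real.continuousAt_rpow_const _ _ (Or.inr ha.le))
  have h' := h.tendsto
  simp only [Real.zero_rpow ha.ne', mul_zero] at h'
  exact h'.mono_left nhdsWithin_le_nhds

theorem tendsto_rpow_atTop_zero {a : ℝ} (ha : a < 0) (A : ℝ) :
    Tendsto (fun t : ℝ => A * t ^ a) atTop (𝓝 0) := by
  have h := (tendsto_rpow_neg_atTop (y := -a) (by linarith)).const_mul A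
  simpa using h

theorem hasDerivAt_ofReal_rpow {t : ℝ} (ht : 0 < t) (a : ℝ) :
    HasDerivAt (fun t : ℝ => ((t ^ a : ℝ) : ℂ)) ((a * t ^ (a - 1) : ℝ) : ℂ) t :=
  (Real.hasDerivAt_rpow_const (Or.inl ht.ne')).ofReal_comp

theorem norm_ofReal_rpow {t : ℝ} (ht : 0 < t) (a : ℝ) : ‖((t ^ a : ℝ) : ℂ)‖ = t ^ a := by
  rw [Complex.norm_real, Real.norm_of_nonneg (Real.rpow_nonneg ht.le _)]

theorem continuousOn_ofReal_rpow (a : ℝ) :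
    ContinuousOn (fun t : ℝ => ((t ^ a : ℝ) : ℂ)) (Ioi 0) :=
  fun _ ht => (hasDerivAt_ofReal_rpow ht a).continuousAt.continuousWithinAt

theorem rpow_eq_mul_rpow {t : ℝ} (ht : 0 < t) {a b : ℝ} (h : a = 1 + b) :
    t ^ a = t * t ^ b := by
  rw [h, Real.rpow_add ht, Real.rpow_one]

theorem hasDerivAt_mul_ofReal (z : ℂ) (t : ℝ) : HasDerivAt (fun t : ℝ => z * (t : ℂ)) z t := by
  simpa using (Complex.ofRealCLM.hasDerivAt (x := t)).const_mul z

theorem integrableOn_one_sub_exp_mul (hα₁ : 1 < α) (hα₂ : α < 2) {z : ℂ} (hz : 0 ≤ z.re) :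
    IntegrableOn (fun t : ℝ => (1 - Complex.exp (-(z * t))) * ((t ^ (-α) : ℝ) : ℂ)) (Ioi 0) := by
  refine integrableOn_of_le_twoPow (a := 1 - α) (b := -α) (A := ‖z‖ + 2)
    (by linarith) (by linarith) (ContinuousOn.mul (by fun_prop) (continuousOn_ofReal_rpow _)) ?_
  intro t ht
  have hre : 0 ≤ (z * t).re := by simpa using mul_nonneg hz ht.le
  have hn : ‖z * (t : ℂ)‖ = ‖z‖ * t := by simp [abs_of_pos ht]
  have h0 := norm_nonneg z
  rw [norm_mul, norm_ofReal_rpow ht]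
  refine le_mul_twoPow (fun _ => ?_) (fun _ => ?_)
  · rw [rpow_eq_mul_rpow ht (show 1 - α = 1 + -α by ring), ← mul_assoc]
    refine mul_le_mul_of_nonneg_right ?_ (Real.rpow_nonneg ht.le _)
    refine (norm_one_sub_exp_neg_le hre).trans ?_
    rw [hn]; nlinarith
  · refine mul_le_mul_of_nonneg_right ?_ (Real.rpow_nonneg ht.le _)
    exact (norm_one_sub_exp_neg_le_two hre).trans (by linarith)

/-- Two integrations by parts lower `t^{-1-α}` to `t^{1-α}` and leave the Gamma integral with `s = 2
- α`. The boundary terms vanish because `1 < α < 2`. The factor `z² (1/z)^{2-α}` is kept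
unsimplified to avoid a discussion of branches. -/
theorem integral_expRem_mul_of_re_pos (hα₁ : 1 < α) (hα₂ : α < 2) {z : ℂ} (hz : 0 < z.re) :
    ∫ t in Ioi (0 : ℝ), expRem (z * t) * ((t ^ (-1 - α) : ℝ) : ℂ)
      = z ^ 2 * (1 / z) ^ ((2 - α : ℝ) : ℂ) * ((Real.Gamma (2 - α) / (α * (α - 1)) : ℝ) : ℂ) := by
  have hα0 : (α : ℂ) ≠ 0 := by exact_mod_cast (by linarith : α ≠ 0)
  have hα1 : (α : ℂ) - 1 ≠ 0 := by
    have : α - 1 ≠ 0 := by linarith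
    exact_mod_cast this
  have hre : ∀ t : ℝ, 0 < t → 0 ≤ (z * t).re := fun t ht => by
    simpa using mul_nonneg hz.le ht.le
  have hn : ∀ t : ℝ, 0 < t → ‖z * (t : ℂ)‖ = ‖z‖ * t := fun t ht => by simp [abs_of_pos ht]
  have hu1 : ∀ t ∈ Ioi (0 : ℝ), HasDerivAt (fun t : ℝ => expRem (z * t))
      ((1 - Complex.exp (-(z * t))) * z) t := fun t _ =>
    HasDerivAt.comp (h₂ := expRem) (h := fun t : ℝ => z * (t : ℂ)) t
      (hasDerivAt_expRem (z * t)) (hasDerivAt_mul_ofReal z t)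
  have hv1 : ∀ t ∈ Ioi (0 : ℝ), HasDerivAt (fun t : ℝ => (-1 / α : ℂ) * ((t ^ (-α) : ℝ) : ℂ))
      ((t ^ (-1 - α) : ℝ) : ℂ) t := fun t ht => by
    refine ((hasDerivAt_ofReal_rpow ht (-α)).const_mul _).congr_deriv ?_
    rw [show -α - 1 = -1 - α by ring]
    push_cast
    field_simp
  have hu2 : ∀ t ∈ Ioi (0 : ℝ), HasDerivAt (fun t : ℝ => 1 - Complex.exp (-(z * t)))
      (Complex.exp (-(z * t)) * z) t := fun t _ => by
    refine ((hasDerivAt_mul_ofReal z t).neg.cexp.const_sub 1).congr_deriv ?_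
    simp
  have hv2 : ∀ t ∈ Ioi (0 : ℝ), HasDerivAt
      (fun t : ℝ => (-1 / (α - 1) : ℂ) * ((t ^ (1 - α) : ℝ) : ℂ)) ((t ^ (-α) : ℝ) : ℂ) t :=
    fun t ht => by
      refine ((hasDerivAt_ofReal_rpow ht (1 - α)).const_mul _).congr_deriv ?_
      rw [show 1 - α - 1 = -α by ring]
      push_cast
      field_simp
      ring
  have hI1 := integrableOn_one_sub_exp_mul hα₁ hα₂ hz.le
  have hI2 : IntegrableOn (fun t : ℝ => ((t ^ (1 - α) : ℝ) : ℂ) * Complex.exp (-(z * t)))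
      (Ioi 0) := by
    have h := integrableOn_rpow_mul_exp_neg_mul_rpow (p := 1) (s := 1 - α) (b := z.re)
      (by linarith) one_pos hz
    refine Integrable.mono' h (ContinuousOn.aestronglyMeasurable
      ((continuousOn_ofReal_rpow _).mul (by fun_prop)) measurableSet_Ioi) ?_
    filter_upwards [ae_restrict_mem measurableSet_Ioi] with t ht
    rw [norm_mul, norm_ofReal_rpow ht, Complex.norm_exp]
    simp
  have p1 := integral_Ioi_mul_deriv_eq_deriv_mul (a' := 0) (b' := 0) hu1 hv1
    (integrableOn_expRem_mul hα₁ hα₂ hz.le).1 ?_ ?_ ?_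
  · have p2 := integral_Ioi_mul_deriv_eq_deriv_mul (a' := 0) (b' := 0) hu2 hv2 hI1 ?_ ?_ ?_
    · rw [p1]
      have e1 : ∀ t : ℝ, (1 - Complex.exp (-(z * t))) * z * ((-1 / α : ℂ) * ((t ^ (-α) : ℝ) : ℂ))
          = (-z / α) * ((1 - Complex.exp (-(z * t))) * ((t ^ (-α) : ℝ) : ℂ)) := fun t => by ring
      have e2 : ∀ t : ℝ, Complex.exp (-(z * t)) * z *
          ((-1 / (α - 1) : ℂ) * ((t ^ (1 - α) : ℝ) : ℂ))
          = (-z / (α - 1)) * (((t ^ ((2 - α) - 1) : ℝ) : ℂ) * Complex.exp (-(z * t))) :=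
        fun t => by rw [show 2 - α - 1 = 1 - α by ring]; ring
      simp_rw [e1, integral_const_mul, p2, e2, integral_const_mul]
      rw [integral_rpow_mul_exp_neg_complex (by linarith) hz]
      push_cast
      field_simp
      ring
    · have : ((fun t : ℝ => Complex.exp (-(z * t)) * z) *
          fun t : ℝ => (-1 / (α - 1) : ℂ) * ((t ^ (1 - α) : ℝ) : ℂ)) =
          fun t : ℝ => (-z / (α - 1)) * (((t ^ (1 - α) : ℝ) : ℂ) * Complex.exp (-(z * t))) := by
        funext t; simp only [Pi.mul_apply]; ring
      rw [this]
      exact hI2.const_mul _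
    · refine squeeze_zero_norm' ?_ (tendsto_rpow_nhdsGT_zero (a := 2 - α) (by linarith)
        (‖z‖ * ‖(-1 / (α - 1) : ℂ)‖))
      filter_upwards [self_mem_nhdsWithin] with t ht
      rw [Pi.mul_apply, norm_mul, norm_mul, norm_ofReal_rpow ht,
        rpow_eq_mul_rpow ht (show 2 - α = 1 + (1 - α) by ring)]
      have := norm_one_sub_exp_neg_le (hre t ht)
      rw [hn t ht] at this
      calc _ ≤ (‖z‖ * t) * (‖(-1 / (α - 1) : ℂ)‖ * t ^ (1 - α)) := by
            gcongr
            exact mul_nonneg (norm_nonneg _) (Real.rpow_nonneg (le_of_lt ht) _)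
        _ = _ := by ring
    · refine squeeze_zero_norm' ?_ (tendsto_rpow_atTop_zero (a := 1 - α) (by linarith)
        (2 * ‖(-1 / (α - 1) : ℂ)‖))
      filter_upwards [eventually_gt_atTop 0] with t ht
      rw [Pi.mul_apply, norm_mul, norm_mul, norm_ofReal_rpow ht, mul_assoc]
      gcongr
      exact norm_one_sub_exp_neg_le_two (hre t ht)
  · have : ((fun t : ℝ => (1 - Complex.exp (-(z * t))) * z) *
        fun t : ℝ => (-1 / α : ℂ) * ((t ^ (-α) : ℝ) : ℂ)) =
        fun t : ℝ => (-z / α) * ((1 - Complex.exp (-(z * t))) * ((t ^ (-α) : ℝ) : ℂ)) := by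
      funext t; simp only [Pi.mul_apply]; ring
    rw [this]
    exact hI1.const_mul _
  · refine squeeze_zero_norm' ?_ (tendsto_rpow_nhdsGT_zero (a := 2 - α) (by linarith)
      (‖z‖ ^ 2 * ‖(-1 / α : ℂ)‖))
    filter_upwards [self_mem_nhdsWithin] with t ht
    rw [Pi.mul_apply, norm_mul, norm_mul, norm_ofReal_rpow ht,
      rpow_eq_mul_rpow ht (show 2 - α = 1 + (1 - α) by ring),
      rpow_eq_mul_rpow ht (show 1 - α = 1 + (-α) by ring)]
    have := norm_expRem_le_sq (hre t ht)
    rw [hn t ht] at this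
    calc _ ≤ (‖z‖ * t) ^ 2 * (‖(-1 / α : ℂ)‖ * t ^ (-α)) := by
          gcongr
          exact mul_nonneg (norm_nonneg _) (Real.rpow_nonneg (le_of_lt ht) _)
      _ = _ := by ring
  · refine squeeze_zero_norm' ?_ (tendsto_rpow_atTop_zero (a := 1 - α) (by linarith)
      (2 * ‖z‖ * ‖(-1 / α : ℂ)‖))
    filter_upwards [eventually_gt_atTop 0] with t ht
    rw [Pi.mul_apply, norm_mul, norm_mul, norm_ofReal_rpow ht,
      rpow_eq_mul_rpow ht (show 1 - α = 1 + (-α) by ring)]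
    have := norm_expRem_le (hre t ht)
    rw [hn t ht] at this
    calc _ ≤ (2 * (‖z‖ * t)) * (‖(-1 / α : ℂ)‖ * t ^ (-α)) := by gcongr
      _ = _ := by ring

/-- Let `z = ε + i` with `ε ↓ 0`. On the imaginary axis the Gamma integral has no exponential decay,
but the integral with `expRem` still converges absolutely, so dominated convergence carries the
formula over. -/
theorem integral_expRem_I_mul (hα₁ : 1 < α) (hα₂ : α < 2) :
    ∫ t in Ioi (0 : ℝ), expRem (Complex.I * t) * ((t ^ (-1 - α) : ℝ) : ℂ)
      = Complex.exp (Complex.I * (Real.pi * α / 2 : ℝ)) *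
        ((Real.Gamma (2 - α) / (α * (α - 1)) : ℝ) : ℂ) := by
  have hz : Tendsto (fun ε : ℝ => (ε : ℂ) + Complex.I) (𝓝[>] 0) (𝓝 Complex.I) := by
    have : ContinuousAt (fun ε : ℝ => (ε : ℂ) + Complex.I) 0 := by fun_prop
    have h := this.tendsto
    simp only [Complex.ofReal_zero, zero_add] at h
    exact h.mono_left nhdsWithin_le_nhds
  have h1 : Tendsto (fun ε : ℝ => ∫ t in Ioi (0 : ℝ),
      expRem (((ε : ℂ) + Complex.I) * t) * ((t ^ (-1 - α) : ℝ) : ℂ)) (𝓝[>] 0)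
      (𝓝 (∫ t in Ioi (0 : ℝ), expRem (Complex.I * t) * ((t ^ (-1 - α) : ℝ) : ℂ))) := by
    refine tendsto_integral_filter_of_dominated_convergence
      (fun t => (2 ^ 2 + 2 * 2) * twoPow (1 - α) (-α) t) ?_ ?_
      ((integrableOn_twoPow (by linarith) (by linarith)).const_mul _) ?_
    · filter_upwards [self_mem_nhdsWithin] with ε hε
      exact (integrableOn_expRem_mul hα₁ hα₂ (by simpa using le_of_lt hε)).1.aestronglyMeasurable
    · have hε1 : ∀ᶠ ε : ℝ in 𝓝[>] 0, ε < 1 :=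
        nhdsWithin_le_nhds (Iio_mem_nhds one_pos)
      filter_upwards [self_mem_nhdsWithin, hε1] with ε hε hε1
      filter_upwards [ae_restrict_mem measurableSet_Ioi] with t ht
      refine ((integrableOn_expRem_mul hα₁ hα₂ (by simpa using le_of_lt hε)).2 t ht).trans ?_
      have hle : ‖(ε : ℂ) + Complex.I‖ ≤ 2 := by
        refine (norm_add_le _ _).trans ?_
        simp only [Complex.norm_real, Complex.norm_I, Real.norm_eq_abs]
        rw [abs_of_pos hε]; linarith
      have : 0 ≤ twoPow (1 - α) (-α) t := by
        unfold twoPow; split_ifs <;> exact Real.rpow_nonneg (le_of_lt ht) _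
      gcongr
    · filter_upwards with t
      exact ((continuous_expRem.tendsto _).comp (hz.mul_const _)).mul_const _
  have h2 : Tendsto (fun ε : ℝ => ((ε : ℂ) + Complex.I) ^ 2 *
      (1 / ((ε : ℂ) + Complex.I)) ^ ((2 - α : ℝ) : ℂ) *
        ((Real.Gamma (2 - α) / (α * (α - 1)) : ℝ) : ℂ)) (𝓝[>] 0)
      (𝓝 (Complex.I ^ 2 * (1 / Complex.I) ^ ((2 - α : ℝ) : ℂ) *
        ((Real.Gamma (2 - α) / (α * (α - 1)) : ℝ) : ℂ))) := by
    have hcont : ContinuousAt (fun w : ℂ => w ^ 2 * (1 / w) ^ ((2 - α : ℝ) : ℂ) *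
        ((Real.Gamma (2 - α) / (α * (α - 1)) : ℝ) : ℂ)) Complex.I := by
      refine ((continuousAt_id.pow 2).mul ?_).mul continuousAt_const
      refine ContinuousAt.cpow ?_ continuousAt_const ?_
      · exact continuousAt_const.div continuousAt_id Complex.I_ne_zero
      · right; simp
    exact hcont.tendsto.comp hz
  have h3 := tendsto_nhds_unique h1 (h2.congr' ?_)
  · rw [h3]
    congr 1
    rw [one_div, Complex.inv_I, Complex.cpow_def_of_ne_zero (by simp), Complex.log_neg_I,
      Complex.I_sq, neg_one_mul]
    -- The sign `i² = -1` is absorbed as `e^{iπ}`; with `(1/i)^{2-α} = e^{-iπ(2-α)/2}` the total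
    -- phase is `e^{iπα/2}`.
    have hneg : ∀ w : ℂ, -Complex.exp w = Complex.exp (Real.pi * Complex.I + w) := fun w => by
      rw [Complex.exp_add, Complex.exp_pi_mul_I]; ring
    rw [hneg]
    congr 1
    push_cast
    ring
  · filter_upwards [self_mem_nhdsWithin] with ε hε
    exact (integral_expRem_mul_of_re_pos hα₁ hα₂ (by simpa using hε)).symm

end

section

/-! ### The kernel `(exp (-it) - 1 + it) / t²` -/

/-- The kernel `(exp (-it) - 1 + it) / t²`. -/
def kernel (t : ℝ) : ℂ := expRem (Complex.I * t) * ((t ^ (-2 : ℝ) : ℝ) : ℂ)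

/-- The derivative of `kernel`. -/
def kernelDeriv (t : ℝ) : ℂ :=
  (1 - Complex.exp (-(Complex.I * t))) * Complex.I * ((t ^ (-2 : ℝ) : ℝ) : ℂ) +
    expRem (Complex.I * t) * (((-2) * t ^ (-3 : ℝ) : ℝ) : ℂ)

theorem hasDerivAt_kernel {t : ℝ} (ht : 0 < t) : HasDerivAt kernel (kernelDeriv t) t := by
  have h1 : HasDerivAt (fun t : ℝ => expRem (Complex.I * t))
      ((1 - Complex.exp (-(Complex.I * t))) * Complex.I) t :=
    HasDerivAt.comp (h₂ := expRem) (h := fun t : ℝ => Complex.I * (t : ℂ)) t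
      (hasDerivAt_expRem (Complex.I * t)) (hasDerivAt_mul_ofReal Complex.I t)
  have h2 := hasDerivAt_ofReal_rpow ht (-2)
  rw [show (-2 : ℝ) - 1 = -3 by norm_num] at h2
  exact h1.mul h2

theorem continuousOn_kernelDeriv : ContinuousOn kernelDeriv (Ioi 0) := by
  unfold kernelDeriv
  refine ContinuousOn.add (ContinuousOn.mul (by fun_prop) (continuousOn_ofReal_rpow _))
    (ContinuousOn.mul ((continuous_expRem.comp (by fun_prop)).continuousOn) ?_)
  push_cast
  exact continuousOn_const.mul (continuousOn_ofReal_rpow _)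

theorem measurable_kernelDeriv : Measurable kernelDeriv := by
  unfold kernelDeriv
  have := continuous_expRem.measurable
  fun_prop

theorem norm_I_mul {t : ℝ} (ht : 0 < t) : ‖Complex.I * (t : ℂ)‖ = t := by simp [abs_of_pos ht]

/-- The rate `1/t` at the origin is not sharp, but it suffices: after multiplication by `t^{2-α}` it
becomes `t^{1-α}`, integrable at `0` because `α < 2`. -/
theorem norm_kernelDeriv_le {t : ℝ} (ht : 0 < t) :
    ‖kernelDeriv t‖ ≤ 6 * twoPow (-1) (-2) t := by
  have hre : 0 ≤ (Complex.I * (t : ℂ)).re := by simp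
  have a1 := norm_one_sub_exp_neg_le hre
  have a2 := norm_one_sub_exp_neg_le_two hre
  have b1 := norm_expRem_le_sq hre
  have b2 := norm_expRem_le hre
  rw [norm_I_mul ht] at a1 b1 b2
  have p2 : t ^ (-2 : ℝ) = t * t ^ (-3 : ℝ) := rpow_eq_mul_rpow ht (by norm_num)
  have p1 : t ^ (-1 : ℝ) = t * t ^ (-2 : ℝ) := rpow_eq_mul_rpow ht (by norm_num)
  have h3 : 0 < t ^ (-3 : ℝ) := Real.rpow_pos_of_pos ht _
  have hmain : ‖kernelDeriv t‖ ≤ ‖1 - Complex.exp (-(Complex.I * t))‖ * t ^ (-2 : ℝ)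
      + ‖expRem (Complex.I * t)‖ * (2 * t ^ (-3 : ℝ)) := by
    unfold kernelDeriv
    refine (norm_add_le _ _).trans (le_of_eq ?_)
    rw [norm_mul, norm_mul, norm_mul, norm_ofReal_rpow ht, Complex.norm_I, Complex.norm_real,
      norm_mul, Real.norm_of_nonneg h3.le]
    norm_num
  refine hmain.trans (le_mul_twoPow (fun _ => ?_) (fun _ => ?_))
  · calc _ ≤ t * t ^ (-2 : ℝ) + t ^ 2 * (2 * t ^ (-3 : ℝ)) := by rw [p2]; gcongr
      _ ≤ _ := by
        rw [p1, p2]; nlinarith [mul_pos (mul_pos ht ht) h3]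
  · calc _ ≤ 2 * t ^ (-2 : ℝ) + (2 * t) * (2 * t ^ (-3 : ℝ)) := by rw [p2]; gcongr
      _ ≤ _ := by rw [p2]; nlinarith [mul_pos ht h3]

theorem norm_kernel_le {t : ℝ} (ht : 0 < t) : ‖kernel t‖ ≤ 2 * t ^ (-1 : ℝ) ∧ ‖kernel t‖ ≤ 1 := by
  have hre : 0 ≤ (Complex.I * (t : ℂ)).re := by simp
  have b1 := norm_expRem_le_sq hre
  have b2 := norm_expRem_le hre
  rw [norm_I_mul ht] at b1 b2
  have p1 : t ^ (-1 : ℝ) = t * t ^ (-2 : ℝ) := rpow_eq_mul_rpow ht (by norm_num)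
  have h2 : 0 < t ^ (-2 : ℝ) := Real.rpow_pos_of_pos ht _
  have hk : ‖kernel t‖ = ‖expRem (Complex.I * t)‖ * t ^ (-2 : ℝ) := by
    rw [kernel, norm_mul, norm_ofReal_rpow ht]
  rw [hk]
  constructor
  · calc _ ≤ (2 * t) * t ^ (-2 : ℝ) := by gcongr
      _ = _ := by rw [p1]; ring
  · calc _ ≤ t ^ 2 * t ^ (-2 : ℝ) := by gcongr
      _ = 1 := by
        rw [← Real.rpow_natCast, ← Real.rpow_add ht]; norm_num

theorem integral_kernelDeriv {s : ℝ} (hs : 0 < s) :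
    IntegrableOn kernelDeriv (Ioi s) ∧ ∫ t in Ioi s, kernelDeriv t = -kernel s := by
  have hI : IntegrableOn kernelDeriv (Ioi s) := by
    have h1 : IntegrableOn (fun t : ℝ => (6 + 6 * s) * s⁻¹ * t ^ (-1 : ℝ) * t ^ (-1 : ℝ)) (Ioi s) := by
      have := (integrableOn_Ioi_rpow_of_lt (a := -2) (by norm_num) hs).const_mul ((6 + 6 * s) * s⁻¹)
      refine IntegrableOn.congr_fun this (fun t ht => ?_) measurableSet_Ioi
      have ht0 : 0 < t := hs.trans ht
      rw [mul_assoc _ (t ^ (-1 : ℝ)), ← Real.rpow_add ht0]; norm_num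
    refine Integrable.mono' h1 (measurable_kernelDeriv.aestronglyMeasurable) ?_
    filter_upwards [ae_restrict_mem measurableSet_Ioi] with t ht
    have ht0 : 0 < t := hs.trans ht
    refine (norm_kernelDeriv_le ht0).trans ?_
    have e1 : t ^ (-1 : ℝ) = t⁻¹ := Real.rpow_neg_one t
    have e2 : t ^ (-2 : ℝ) = t⁻¹ * t⁻¹ := by
      rw [← Real.rpow_neg_one t, ← Real.rpow_add ht0]; norm_num
    have hst : s < t := ht
    unfold twoPow
    rw [e1, e2]
    have hti : 0 < t⁻¹ := inv_pos.mpr ht0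
    have hsi : 0 < s⁻¹ := inv_pos.mpr hs
    have hss : s⁻¹ * s = 1 := inv_mul_cancel₀ hs.ne'
    have e3 : (6 + 6 * s) * s⁻¹ * t⁻¹ * t⁻¹ = 6 * (s⁻¹ * t⁻¹ * t⁻¹) + 6 * (t⁻¹ * t⁻¹) := by
      linear_combination (6 * t⁻¹ * t⁻¹) * hss
    rw [e3]
    split_ifs with h
    · have : 1 ≤ s⁻¹ := (one_le_inv₀ hs).mpr (hst.le.trans h)
      have h1t : 1 ≤ t⁻¹ := (one_le_inv₀ ht0).mpr h
      have : t⁻¹ ≤ t⁻¹ * t⁻¹ := by nlinarith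
      have : 0 ≤ s⁻¹ * t⁻¹ * t⁻¹ := by positivity
      linarith
    · have : 0 ≤ s⁻¹ * t⁻¹ * t⁻¹ := by positivity
      linarith
  refine ⟨hI, ?_⟩
  rw [integral_Ioi_of_hasDerivAt_of_tendsto (f := kernel) (m := 0)
    (hasDerivAt_kernel hs).continuousAt.continuousWithinAt
    (fun t ht => hasDerivAt_kernel (hs.trans ht)) hI, zero_sub]
  refine squeeze_zero_norm' ?_ (tendsto_rpow_atTop_zero (a := -1) (by norm_num) 2)
  filter_upwards [eventually_gt_atTop 0] with t ht using (norm_kernel_le ht).1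

variable {α : ℝ}

theorem twoPow_mul_rpow {t : ℝ} (ht : 0 < t) (a b c : ℝ) :
    twoPow a b t * t ^ c = twoPow (a + c) (b + c) t := by
  unfold twoPow
  split_ifs <;> rw [Real.rpow_add ht]

theorem integrableOn_kernelDeriv_mul (hα₁ : 1 < α) (hα₂ : α < 2) :
    IntegrableOn (fun t : ℝ => kernelDeriv t * ((t ^ (2 - α) : ℝ) : ℂ)) (Ioi 0) := by
  refine integrableOn_of_le_twoPow (a := 1 - α) (b := -α) (A := 6) (by linarith) (by linarith)
    (continuousOn_kernelDeriv.mul (continuousOn_ofReal_rpow _)) fun t ht => ?_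
  rw [norm_mul, norm_ofReal_rpow ht]
  calc _ ≤ 6 * twoPow (-1) (-2) t * t ^ (2 - α) := by
        gcongr; exact norm_kernelDeriv_le ht
    _ = _ := by rw [mul_assoc, twoPow_mul_rpow ht]; ring_nf

/-- Integration by parts moves the derivative onto `t^{2-α}` and returns to the integral of `expRem
(it) t^{-1-α}`; the factor `2 - α` turns `Γ(2-α)` into `Γ(3-α)`. -/
theorem integral_kernelDeriv_mul (hα₁ : 1 < α) (hα₂ : α < 2) :
    ∫ t in Ioi (0 : ℝ), kernelDeriv t * ((t ^ (2 - α) : ℝ) : ℂ)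
      = -(Complex.exp (Complex.I * (Real.pi * α / 2 : ℝ)) *
        ((Real.Gamma (3 - α) / (α * (α - 1)) : ℝ) : ℂ)) := by
  have hv : ∀ t ∈ Ioi (0 : ℝ), HasDerivAt (fun t : ℝ => ((t ^ (2 - α) : ℝ) : ℂ))
      (((2 - α) * t ^ (1 - α) : ℝ) : ℂ) t := fun t ht => by
    have := hasDerivAt_ofReal_rpow ht (2 - α)
    rwa [show 2 - α - 1 = 1 - α by ring] at this
  have hprod : ∀ t ∈ Ioi (0 : ℝ), ((2 - α : ℝ) : ℂ) *
      (expRem (Complex.I * t) * ((t ^ (-1 - α) : ℝ) : ℂ)) =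
      kernel t * (((2 - α) * t ^ (1 - α) : ℝ) : ℂ) := fun t ht => by
    rw [kernel, show -1 - α = -2 + (1 - α) by ring, Real.rpow_add ht]
    push_cast; ring
  have hI := (integrableOn_expRem_mul hα₁ hα₂ (z := Complex.I) (by simp)).1
  have p := integral_Ioi_mul_deriv_eq_deriv_mul (a' := 0) (b' := 0)
    (fun t ht => hasDerivAt_kernel ht) hv
    (IntegrableOn.congr_fun (hI.const_mul ((2 - α : ℝ) : ℂ)) hprod measurableSet_Ioi)
    (integrableOn_kernelDeriv_mul hα₁ hα₂) ?_ ?_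
  · rw [← setIntegral_congr_fun measurableSet_Ioi hprod, integral_const_mul,
      integral_expRem_I_mul hα₁ hα₂] at p
    have hG : Real.Gamma (3 - α) = (2 - α) * Real.Gamma (2 - α) := by
      rw [← Real.Gamma_add_one (by linarith)]; congr 1; ring
    rw [hG]
    rw [sub_zero, zero_sub] at p
    rw [← neg_eq_iff_eq_neg.mpr p]
    push_cast
    ring
  · refine squeeze_zero_norm' ?_ (tendsto_rpow_nhdsGT_zero (a := 2 - α) (by linarith) 1)
    filter_upwards [self_mem_nhdsWithin] with t ht
    rw [Pi.mul_apply, norm_mul, norm_ofReal_rpow ht]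
    gcongr
    · exact Real.rpow_nonneg (le_of_lt ht) _
    · exact (norm_kernel_le ht).2
  · refine squeeze_zero_norm' ?_ (tendsto_rpow_atTop_zero (a := 1 - α) (by linarith) 2)
    filter_upwards [eventually_gt_atTop 0] with t ht
    rw [Pi.mul_apply, norm_mul, norm_ofReal_rpow ht, show 1 - α = -1 + (2 - α) by ring,
      Real.rpow_add ht, ← mul_assoc]
    gcongr
    exact (norm_kernel_le ht).1

end

section

variable {α : ℝ} {f : ℝ → ℝ}

/-! ### The truncated fourth moment -/

theorem truncFourth_eq {x : ℝ} (hx : 0 ≤ x) :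
    truncFourth f x = ∫ y in {y : ℝ | y ^ 2 ≤ x}, y ^ 4 * f y := by
  have hs : {y : ℝ | y ^ 2 ≤ x} = Icc (-√x) (√x) := by
    ext y
    simp only [mem_ofPred_eq, mem_Icc]
    rw [← abs_le, Real.le_sqrt (abs_nonneg y) hx, sq_abs]
  rw [truncFourth, intervalIntegral.integral_of_le (by linarith [Real.sqrt_nonneg x]), hs,
    integral_Icc_eq_integral_Ioc]

theorem measurableSet_sq_le (x : ℝ) : MeasurableSet {y : ℝ | y ^ 2 ≤ x} :=
  measurableSet_le (by fun_prop) measurable_const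

theorem integrableOn_fourth (hfm : Measurable f) (hf0 : ∀ x, 0 ≤ f x)
    (hint : Integrable fun y : ℝ => y ^ 2 * f y) (x : ℝ) :
    IntegrableOn (fun y : ℝ => y ^ 4 * f y) {y : ℝ | y ^ 2 ≤ x} := by
  refine Integrable.mono' (hint.const_mul x).restrict (by fun_prop) ?_
  filter_upwards [ae_restrict_mem (measurableSet_sq_le x)] with y hy
  have hy' : y ^ 2 ≤ x := hy
  rw [Real.norm_of_nonneg (mul_nonneg (by positivity) (hf0 y))]
  have : y ^ 4 * f y = y ^ 2 * (y ^ 2 * f y) := by ring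
  rw [this]
  exact mul_le_mul_of_nonneg_right hy' (mul_nonneg (sq_nonneg y) (hf0 y))

theorem truncFourth_nonneg (hf0 : ∀ x, 0 ≤ f x) {x : ℝ} (hx : 0 ≤ x) : 0 ≤ truncFourth f x := by
  rw [truncFourth_eq hx]
  exact integral_nonneg fun y => mul_nonneg (by positivity) (hf0 y)

theorem truncFourth_le (hfm : Measurable f) (hf0 : ∀ x, 0 ≤ f x)
    (hint : Integrable fun y : ℝ => y ^ 2 * f y) {x : ℝ} (hx : 0 ≤ x) :
    truncFourth f x ≤ x * ∫ y, y ^ 2 * f y := by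
  rw [truncFourth_eq hx, ← integral_const_mul]
  calc _ ≤ ∫ y in {y : ℝ | y ^ 2 ≤ x}, x * (y ^ 2 * f y) := by
        refine setIntegral_mono_on (integrableOn_fourth hfm hf0 hint x)
          (hint.const_mul x).integrableOn (measurableSet_sq_le x) fun y hy => ?_
        have hy' : y ^ 2 ≤ x := hy
        have : y ^ 4 * f y = y ^ 2 * (y ^ 2 * f y) := by ring
        rw [this]
        exact mul_le_mul_of_nonneg_right hy' (mul_nonneg (sq_nonneg y) (hf0 y))
    _ ≤ _ := setIntegral_le_integral (hint.const_mul x)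
        (Eventually.of_forall fun y => mul_nonneg hx (mul_nonneg (sq_nonneg y) (hf0 y)))

/-- A majorant valid on all of `(0, ∞)`, needed for Fubini and for dominated convergence. For large
`x` it comes from the asymptotics; for `x ≤ x₁` from `ν_f(x) ≤ x ∫ y² f` and `x = x^{α-1} x^{2-α} ≤
x₁^{α-1} x^{2-α}`. -/
theorem exists_truncFourth_le_rpow (hfm : Measurable f) (hf0 : ∀ x, 0 ≤ f x)
    (hint : Integrable fun y : ℝ => y ^ 2 * f y) {C : ℝ} (hα₁ : 1 < α)
    (hν : truncFourth f ~[atTop] fun x : ℝ => C * x ^ (2 - α)) :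
    ∃ A, 0 ≤ A ∧ ∀ x, 0 < x → truncFourth f x ≤ A * x ^ (2 - α) := by
  obtain ⟨c, hc⟩ := hν.isBigO.bound
  obtain ⟨x₀, hx₀⟩ := eventually_atTop.mp hc
  set x₁ := max x₀ 1
  have hx₁ : 0 < x₁ := lt_of_lt_of_le one_pos (le_max_right _ _)
  have hE : 0 ≤ ∫ y, y ^ 2 * f y := integral_nonneg fun y => mul_nonneg (sq_nonneg y) (hf0 y)
  refine ⟨|c| * |C| + x₁ ^ (α - 1) * ∫ y, y ^ 2 * f y,
    add_nonneg (by positivity) (mul_nonneg (Real.rpow_nonneg hx₁.le _) hE), fun x hx => ?_⟩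
  have hxp : 0 < x ^ (2 - α) := Real.rpow_pos_of_pos hx _
  rw [add_mul]
  rcases le_total x₁ x with h | h
  · have h1 := hx₀ x ((le_max_left _ _).trans h)
    rw [norm_mul, Real.norm_of_nonneg hxp.le] at h1
    have h2 := (le_abs_self _).trans h1
    have h3 : c * (‖C‖ * x ^ (2 - α)) ≤ |c| * |C| * x ^ (2 - α) := by
      rw [Real.norm_eq_abs, ← mul_assoc]
      gcongr
      exact le_abs_self c
    have : 0 ≤ x₁ ^ (α - 1) * (∫ y, y ^ 2 * f y) * x ^ (2 - α) :=
      mul_nonneg (mul_nonneg (Real.rpow_nonneg hx₁.le _) hE) hxp.le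
    linarith
  · have h1 := truncFourth_le hfm hf0 hint hx.le
    have h2 : x = x ^ (α - 1) * x ^ (2 - α) := by
      rw [← Real.rpow_add hx]; norm_num
    have h3 : x ≤ x₁ ^ (α - 1) * x ^ (2 - α) := by
      calc x = x ^ (α - 1) * x ^ (2 - α) := h2
        _ ≤ _ := by gcongr
    have h4 : x * ∫ y, y ^ 2 * f y ≤ (x₁ ^ (α - 1) * x ^ (2 - α)) * ∫ y, y ^ 2 * f y := by
      gcongr
    have : 0 ≤ |c| * |C| * x ^ (2 - α) := by positivity
    linarith

theorem measurable_truncFourth_div (hfm : Measurable f) (ξ : ℝ) (hξ : 0 < ξ) :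
    AEStronglyMeasurable (fun t => truncFourth f (t / ξ)) (volume.restrict (Ioi 0)) := by
  have h : AEStronglyMeasurable (fun t : ℝ => ∫ y : ℝ, {p : ℝ × ℝ | p.2 ^ 2 ≤ p.1 / ξ}.indicator
      (fun p => p.2 ^ 4 * f p.2) (t, y)) (volume.restrict (Ioi 0)) := by
    have hm : Measurable ({p : ℝ × ℝ | p.2 ^ 2 ≤ p.1 / ξ}.indicator
      (fun p => p.2 ^ 4 * f p.2)) :=
      Measurable.indicator (by fun_prop) (measurableSet_le (by fun_prop) (by fun_prop))
    exact (hm.stronglyMeasurable.integral_prod_right' (ν := volume)).aestronglyMeasurable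
  refine h.congr ?_
  filter_upwards [ae_restrict_mem measurableSet_Ioi] with t ht
  rw [truncFourth_eq (div_nonneg (le_of_lt ht) hξ.le), ← integral_indicator (measurableSet_sq_le _)]
  rfl

/-! ### The characteristic function at the origin -/

/-- `∫ (exp (-iξy²) - 1 + iξy²) f(y) dy`. -/
def cfRem (f : ℝ → ℝ) (ξ : ℝ) : ℂ := ∫ y : ℝ, expRem (Complex.I * ξ * (y : ℂ) ^ 2) * (f y : ℂ)

/-- The integrand is `ξ² y⁴ k(ξy²)` times `f(y)`, and `k(s) = -∫_s^∞ k'`. Exchanging the integrals,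
the region `ξy² ≤ t` becomes `y² ≤ t/ξ`, over which `y⁴ f(y)` integrates to `ν_f(t/ξ)`. -/
theorem cfRem_eq (hfm : Measurable f) (hf0 : ∀ x, 0 ≤ f x)
    (hint : Integrable fun y : ℝ => y ^ 2 * f y) {C : ℝ} (hα₁ : 1 < α) (hα₂ : α < 2)
    (hν : truncFourth f ~[atTop] fun x : ℝ => C * x ^ (2 - α)) {ξ : ℝ} (hξ : 0 < ξ) :
    cfRem f ξ = -((ξ ^ 2 : ℝ) : ℂ) *
      ∫ t in Ioi (0 : ℝ), kernelDeriv t * (truncFourth f (t / ξ) : ℂ) := by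
  obtain ⟨A, hA0, hA⟩ := exists_truncFourth_le_rpow hfm hf0 hint hα₁ hν
  -- The joint integrand, cut off to `y² ≤ t/ξ`: in `y` it integrates to a truncated moment, in `t`
  -- to a tail of the kernel.
  set G : ℝ → ℝ → ℂ := fun y t => {p : ℝ × ℝ | p.1 ^ 2 ≤ p.2 / ξ}.indicator
    (fun p => ((p.1 ^ 4 * f p.1 : ℝ) : ℂ) * kernelDeriv p.2) (y, t) with hG
  have hGm : Measurable (Function.uncurry G) := by
    have : Function.uncurry G = {p : ℝ × ℝ | p.1 ^ 2 ≤ p.2 / ξ}.indicator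
        (fun p => ((p.1 ^ 4 * f p.1 : ℝ) : ℂ) * kernelDeriv p.2) := by ext ⟨y, t⟩; rfl
    rw [this]
    have hk := measurable_kernelDeriv
    exact Measurable.indicator (by fun_prop) (measurableSet_le (by fun_prop) (by fun_prop))
  have hGt : ∀ t : ℝ, (fun y => G y t) = {y : ℝ | y ^ 2 ≤ t / ξ}.indicator
      fun y => ((y ^ 4 * f y : ℝ) : ℂ) * kernelDeriv t := fun t => by
    funext y; rfl
  have hnorm : ∀ t : ℝ, 0 < t → ∫ y, ‖G y t‖ = ‖kernelDeriv t‖ * truncFourth f (t / ξ) := by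
    intro t ht
    rw [truncFourth_eq (div_nonneg ht.le hξ.le), ← integral_const_mul,
      ← integral_indicator (measurableSet_sq_le _)]
    refine integral_congr_ae (Eventually.of_forall fun y => ?_)
    have : G y t = _ := congrFun (hGt t) y
    simp only
    rw [this, norm_indicator_eq_indicator_norm]
    by_cases hy : y ∈ {y : ℝ | y ^ 2 ≤ t / ξ}
    · rw [indicator_of_mem hy, indicator_of_mem hy, norm_mul, Complex.norm_real,
        Real.norm_of_nonneg (mul_nonneg (by positivity) (hf0 y)), mul_comm]
    · rw [indicator_of_notMem hy, indicator_of_notMem hy]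
  have hprod : Integrable (Function.uncurry G) (volume.prod (volume.restrict (Ioi 0))) := by
    rw [integrable_prod_iff' hGm.aestronglyMeasurable]
    constructor
    · filter_upwards with t
      simp only [Function.uncurry_apply_pair]
      rw [hGt t, integrable_indicator_iff (measurableSet_sq_le _)]
      exact ((integrableOn_fourth hfm hf0 hint _).ofReal).mul_const _
    · have hdom : IntegrableOn (fun t => A * (ξ⁻¹) ^ (2 - α) * (6 * twoPow (1 - α) (-α) t))
          (Ioi 0) :=
        ((integrableOn_twoPow (by linarith) (by linarith)).const_mul 6).const_mul _
      refine Integrable.mono' hdom ?_ ?_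
      · exact (hGm.norm.stronglyMeasurable.integral_prod_left' (μ := volume)).aestronglyMeasurable
      · filter_upwards [ae_restrict_mem measurableSet_Ioi] with t ht
        have ht' : 0 < t := ht
        simp only [Function.uncurry_apply_pair]
        rw [hnorm t ht, Real.norm_of_nonneg (mul_nonneg (norm_nonneg _)
          (truncFourth_nonneg hf0 (div_nonneg ht'.le hξ.le)))]
        have h1 := hA (t / ξ) (div_pos ht' hξ)
        rw [div_eq_mul_inv, Real.mul_rpow ht'.le (inv_nonneg.mpr hξ.le)] at h1
        have htw : 0 ≤ twoPow (-1) (-2) t := by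
          unfold twoPow; split_ifs <;> exact Real.rpow_nonneg ht'.le _
        calc _ ≤ (6 * twoPow (-1) (-2) t) * (A * (t ^ (2 - α) * ξ⁻¹ ^ (2 - α))) :=
              mul_le_mul (norm_kernelDeriv_le ht') h1
                (truncFourth_nonneg hf0 (div_nonneg ht'.le hξ.le)) (by positivity)
          _ = A * (ξ⁻¹) ^ (2 - α) * (6 * (twoPow (-1) (-2) t * t ^ (2 - α))) := by ring
          _ = _ := by rw [twoPow_mul_rpow ht']; ring_nf
  have hswap := integral_integral_swap hprod
  have hL : ∀ y : ℝ, y ≠ 0 → ∫ t in Ioi (0 : ℝ), G y t =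
      -((y ^ 4 * f y : ℝ) : ℂ) * kernel (ξ * y ^ 2) := by
    intro y hy
    have hs : 0 < ξ * y ^ 2 := by positivity
    have e : ∀ t, G y t = (Ici (ξ * y ^ 2)).indicator
        (fun t => ((y ^ 4 * f y : ℝ) : ℂ) * kernelDeriv t) t := by
      intro t
      have : ξ * y ^ 2 ≤ t ↔ y ^ 2 ≤ t / ξ := by rw [le_div_iff₀ hξ, mul_comm]
      by_cases h : y ^ 2 ≤ t / ξ
      · simp only [hG]
        rw [indicator_of_mem (show (y, t) ∈ {p : ℝ × ℝ | p.1 ^ 2 ≤ p.2 / ξ} from h),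
          indicator_of_mem (show t ∈ Ici (ξ * y ^ 2) from this.mpr h)]
      · simp only [hG]
        rw [indicator_of_notMem (show (y, t) ∉ {p : ℝ × ℝ | p.1 ^ 2 ≤ p.2 / ξ} from h),
          indicator_of_notMem (show t ∉ Ici (ξ * y ^ 2) from fun h' => h (this.mp h'))]
    simp_rw [e]
    rw [setIntegral_indicator measurableSet_Ici,
      inter_eq_self_of_subset_right (Ici_subset_Ioi.mpr hs), integral_const_mul,
      integral_Ici_eq_integral_Ioi, (integral_kernelDeriv hs).2]
    ring
  have hR : ∀ t ∈ Ioi (0 : ℝ), ∫ y, G y t = kernelDeriv t * (truncFourth f (t / ξ) : ℂ) := by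
    intro t ht
    rw [hGt t, integral_indicator (measurableSet_sq_le _), integral_mul_const,
      integral_complex_ofReal, ← truncFourth_eq (div_nonneg (le_of_lt ht) hξ.le), mul_comm]
  rw [setIntegral_congr_fun measurableSet_Ioi hR] at hswap
  rw [← hswap, cfRem, ← integral_const_mul]
  refine integral_congr_ae ?_
  have hne : ∀ᵐ y : ℝ, y ≠ 0 := by
    simp [ae_iff, measure_singleton]
  filter_upwards [hne] with y hy
  have hs : 0 < ξ * y ^ 2 := by positivity
  rw [hL y hy, kernel]
  have h1 : Complex.I * ξ * (y : ℂ) ^ 2 = Complex.I * ((ξ * y ^ 2 : ℝ) : ℂ) := by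
    push_cast; ring
  have h2 : (ξ * y ^ 2) ^ (-2 : ℝ) = ((ξ * y ^ 2) ^ 2)⁻¹ := by
    rw [Real.rpow_neg hs.le]; norm_cast
  rw [h1, h2]
  have hξ' : (ξ : ℂ) ≠ 0 := by exact_mod_cast hξ.ne'
  have hy' : (y : ℂ) ≠ 0 := by exact_mod_cast hy
  push_cast
  field_simp

/-- Dividing by `ξ^α` leaves `ξ^{2-α} ν_f(t/ξ)` under the integral. This tends to `C t^{2-α}`
pointwise and is at most `A t^{2-α}` for every `ξ > 0`, so dominated convergence gives the limit. -/
theorem tendsto_cfRem (hfm : Measurable f) (hf0 : ∀ x, 0 ≤ f x)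
    (hint : Integrable fun y : ℝ => y ^ 2 * f y) {C : ℝ} (hC : C ≠ 0) (hα₁ : 1 < α) (hα₂ : α < 2)
    (hν : truncFourth f ~[atTop] fun x : ℝ => C * x ^ (2 - α)) :
    Tendsto (fun ξ : ℝ => cfRem f ξ / ((ξ ^ α : ℝ) : ℂ)) (𝓝[>] 0)
      (𝓝 ((C : ℂ) * (Complex.exp (Complex.I * (Real.pi * α / 2 : ℝ)) *
        ((Real.Gamma (3 - α) / (α * (α - 1)) : ℝ) : ℂ)))) := by
  obtain ⟨A, hA0, hA⟩ := exists_truncFourth_le_rpow hfm hf0 hint hα₁ hν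
  have hpow : ∀ ξ t : ℝ, 0 < ξ → 0 < t →
      ξ ^ (2 - α) * (t / ξ) ^ (2 - α) = t ^ (2 - α) := fun ξ t hξ ht => by
    rw [← Real.mul_rpow hξ.le (div_pos ht hξ).le, mul_div_cancel₀ _ hξ.ne']
  have hlim : Tendsto (fun ξ : ℝ => ∫ t in Ioi (0 : ℝ),
      kernelDeriv t * ((ξ ^ (2 - α) * truncFourth f (t / ξ) : ℝ) : ℂ)) (𝓝[>] 0)
      (𝓝 (∫ t in Ioi (0 : ℝ), kernelDeriv t * ((C * t ^ (2 - α) : ℝ) : ℂ))) := by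
    refine tendsto_integral_filter_of_dominated_convergence
      (fun t => ‖kernelDeriv t * ((t ^ (2 - α) : ℝ) : ℂ)‖ * A) ?_ ?_
      ((integrableOn_kernelDeriv_mul hα₁ hα₂).norm.mul_const A) ?_
    · filter_upwards [self_mem_nhdsWithin] with ξ hξ
      refine measurable_kernelDeriv.aestronglyMeasurable.mul ?_
      exact Complex.continuous_ofReal.comp_aestronglyMeasurable
        ((measurable_truncFourth_div hfm ξ hξ).const_mul _)
    · filter_upwards [self_mem_nhdsWithin] with ξ hξ
      filter_upwards [ae_restrict_mem measurableSet_Ioi] with t ht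
      have ht' : 0 < t := ht
      have hξ' : 0 < ξ := hξ
      rw [norm_mul, norm_mul, norm_ofReal_rpow ht, Complex.norm_real, Real.norm_of_nonneg
        (mul_nonneg (Real.rpow_nonneg hξ'.le _) (truncFourth_nonneg hf0 (div_pos ht' hξ').le)),
        mul_assoc]
      refine mul_le_mul_of_nonneg_left ?_ (norm_nonneg _)
      calc _ ≤ ξ ^ (2 - α) * (A * (t / ξ) ^ (2 - α)) :=
            mul_le_mul_of_nonneg_left (hA _ (div_pos ht' hξ')) (Real.rpow_nonneg hξ'.le _)
        _ = (ξ ^ (2 - α) * (t / ξ) ^ (2 - α)) * A := by ring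
        _ = _ := by rw [hpow ξ t hξ' ht']
    · filter_upwards [ae_restrict_mem measurableSet_Ioi] with t ht
      have ht' : 0 < t := ht
      refine Tendsto.const_mul _ ((Complex.continuous_ofReal.tendsto _).comp ?_)
      have hat : Tendsto (fun ξ : ℝ => t / ξ) (𝓝[>] 0) atTop :=
        (tendsto_inv_nhdsGT_zero.const_mul_atTop ht')
      have h1 : Tendsto (fun x => truncFourth f x / (C * x ^ (2 - α))) atTop (𝓝 1) := by
        refine (isEquivalent_iff_tendsto_one ?_).mp hν
        filter_upwards [eventually_gt_atTop 0] with x hx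
        exact mul_ne_zero hC (Real.rpow_pos_of_pos hx _).ne'
      have h2 := (h1.comp hat).const_mul (C * t ^ (2 - α))
      rw [mul_one] at h2
      refine h2.congr' ?_
      filter_upwards [self_mem_nhdsWithin] with ξ hξ
      have hξ' : 0 < ξ := hξ
      have h3 : (t / ξ) ^ (2 - α) ≠ 0 := (Real.rpow_pos_of_pos (div_pos ht' hξ') _).ne'
      simp only [Function.comp]
      rw [← hpow ξ t hξ' ht']
      field_simp
  have hval : ∫ t in Ioi (0 : ℝ), kernelDeriv t * ((C * t ^ (2 - α) : ℝ) : ℂ) =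
      -((C : ℂ) * (Complex.exp (Complex.I * (Real.pi * α / 2 : ℝ)) *
        ((Real.Gamma (3 - α) / (α * (α - 1)) : ℝ) : ℂ))) := by
    have : ∀ t : ℝ, kernelDeriv t * ((C * t ^ (2 - α) : ℝ) : ℂ) =
        (C : ℂ) * (kernelDeriv t * ((t ^ (2 - α) : ℝ) : ℂ)) := fun t => by push_cast; ring
    simp_rw [this, integral_const_mul, integral_kernelDeriv_mul hα₁ hα₂]
    ring
  rw [hval] at hlim
  have := hlim.neg
  rw [neg_neg] at this
  refine this.congr' ?_
  filter_upwards [self_mem_nhdsWithin] with ξ hξ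
  have hξ' : 0 < ξ := hξ
  rw [cfRem_eq hfm hf0 hint hα₁ hα₂ hν hξ']
  have e : ∀ t : ℝ, kernelDeriv t * ((ξ ^ (2 - α) * truncFourth f (t / ξ) : ℝ) : ℂ) =
      ((ξ ^ (2 - α) : ℝ) : ℂ) * (kernelDeriv t * (truncFourth f (t / ξ) : ℂ)) := fun t => by
    push_cast; ring
  simp_rw [e, integral_const_mul]
  have h4 : ((ξ ^ 2 : ℝ) : ℂ) = ((ξ ^ (2 - α) : ℝ) : ℂ) * ((ξ ^ α : ℝ) : ℂ) := by
    rw [← Complex.ofReal_mul, ← Real.rpow_add hξ', sub_add_cancel]; norm_cast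
  have h5 : ((ξ ^ α : ℝ) : ℂ) ≠ 0 := by exact_mod_cast (Real.rpow_pos_of_pos hξ' α).ne'
  rw [h4]
  field_simp

end

section

variable {α : ℝ} {f h : ℝ → ℝ}

/-! ### Densities of `V` and `V²` -/

/-- `h` is the density of the square of a variable with probability density `f`. -/
structure SquareDensity (f h : ℝ → ℝ) : Prop where
  measurable_f : Measurable f
  measurable_h : Measurable h
  nonneg_f : ∀ x, 0 ≤ f x
  nonneg_h : ∀ x, 0 ≤ h x
  lintegral_f : ∫⁻ x, ENNReal.ofReal (f x) = 1
  map_eq : ((volume : Measure ℝ).withDensity fun x => ENNReal.ofReal (f x)).map (fun x => x ^ 2) =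
    (volume : Measure ℝ).withDensity fun x => ENNReal.ofReal (h x)

theorem SquareDensity.of_isDensityOf {Ω : Type*} [MeasurableSpace Ω] {P : Measure Ω}
    [IsProbabilityMeasure P] {V : Ω → ℝ} (hf : IsDensityOf f V P)
    (hh : IsDensityOf h (fun ω => V ω ^ 2) P) : SquareDensity f h where
  measurable_f := hf.1
  measurable_h := hh.1
  nonneg_f := hf.2.1
  nonneg_h := hh.2.1
  lintegral_f := by
    have h1 := congrArg (fun μ : Measure ℝ => μ univ) hf.2.2.map_eq
    simp only [withDensity_apply _ MeasurableSet.univ, Measure.restrict_univ] at h1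
    rw [← h1, Measure.map_apply_of_aemeasurable hf.2.2.aemeasurable MeasurableSet.univ]
    simp
  map_eq := by
    rw [← hf.2.2.map_eq, ← hh.2.2.map_eq, AEMeasurable.map_map_of_aemeasurable (by fun_prop)
      hf.2.2.aemeasurable]
    rfl

namespace SquareDensity

theorem lintegral_mul (H : SquareDensity f h) {F : ℝ → ENNReal} (hF : Measurable F) :
    ∫⁻ x, ENNReal.ofReal (h x) * F x = ∫⁻ y, ENNReal.ofReal (f y) * F (y ^ 2) := by
  have hfm := H.measurable_f
  have hhm := H.measurable_h
  have h1 : ∫⁻ x, F x ∂((volume : Measure ℝ).withDensity fun x => ENNReal.ofReal (h x)) =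
      ∫⁻ x, ENNReal.ofReal (h x) * F x :=
    lintegral_withDensity_eq_lintegral_mul _ (by fun_prop) hF
  rw [← h1, ← H.map_eq, lintegral_map hF (by fun_prop)]
  exact lintegral_withDensity_eq_lintegral_mul _ (by fun_prop) (hF.comp (by fun_prop))

theorem integral_mul (H : SquareDensity f h) {F : ℝ → ℂ} (hF : Measurable F) :
    ∫ x, F x * (h x : ℂ) = ∫ y, F (y ^ 2) * (f y : ℂ) := by
  have hfm := H.measurable_f
  have hhm := H.measurable_h
  have key : ∀ (g : ℝ → ℝ), Measurable g → (∀ x, 0 ≤ g x) → ∀ F : ℝ → ℂ,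
      ∫ x, F x ∂((volume : Measure ℝ).withDensity fun x => ENNReal.ofReal (g x)) =
        ∫ x, F x * (g x : ℂ) := by
    intro g hg hg0 F
    rw [integral_withDensity_eq_integral_toReal_smul (by fun_prop) (by simp)]
    refine integral_congr_ae (Eventually.of_forall fun x => ?_)
    simp [ENNReal.toReal_ofReal (hg0 x), mul_comm]
  rw [← key h H.measurable_h H.nonneg_h, ← H.map_eq,
    integral_map (by fun_prop) hF.aestronglyMeasurable, key f H.measurable_f H.nonneg_f]

theorem integrable_f (H : SquareDensity f h) : Integrable f := by
  refine ⟨H.measurable_f.aestronglyMeasurable, ?_⟩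
  rw [hasFiniteIntegral_iff_ofReal (Eventually.of_forall H.nonneg_f), H.lintegral_f]
  exact ENNReal.one_lt_top

theorem lintegral_h (H : SquareDensity f h) : ∫⁻ x, ENNReal.ofReal (h x) = 1 := by
  have := H.lintegral_mul (F := fun _ => 1) measurable_const
  simpa [H.lintegral_f] using this

theorem integrable_h (H : SquareDensity f h) : Integrable h := by
  refine ⟨H.measurable_h.aestronglyMeasurable, ?_⟩
  rw [hasFiniteIntegral_iff_ofReal (Eventually.of_forall H.nonneg_h), H.lintegral_h]
  exact ENNReal.one_lt_top

theorem integral_f (H : SquareDensity f h) : ∫ x, f x = 1 := by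
  rw [integral_eq_lintegral_of_nonneg_ae (Eventually.of_forall H.nonneg_f)
    H.measurable_f.aestronglyMeasurable, H.lintegral_f, ENNReal.toReal_one]

theorem integral_h (H : SquareDensity f h) : ∫ x, h x = 1 := by
  rw [integral_eq_lintegral_of_nonneg_ae (Eventually.of_forall H.nonneg_h)
    H.measurable_h.aestronglyMeasurable, H.lintegral_h, ENNReal.toReal_one]

end SquareDensity

/-! ### The expansion of the characteristic function -/

/-- The Fourier transform `∫ exp (-iξx) g(x) dx`. -/
def cf (g : ℝ → ℝ) (ξ : ℝ) : ℂ := ∫ x : ℝ, Complex.exp (-(Complex.I * ξ * x)) * (g x : ℂ)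

theorem cf_centred (g : ℝ → ℝ) (E ξ : ℝ) :
    ∫ x : ℝ, Complex.exp (-(Complex.I * ξ * (x - E))) * (g x : ℂ) =
      Complex.exp (Complex.I * ξ * E) * cf g ξ := by
  rw [cf, ← integral_const_mul]
  refine integral_congr_ae (Eventually.of_forall fun x => ?_)
  simp only
  rw [← mul_assoc, ← Complex.exp_add]
  congr 2
  ring

theorem remainderFn_eq (g : ℝ → ℝ) (E σ α ξ : ℝ) :
    remainderFn g E σ α ξ =
      Complex.exp (Complex.I * ξ * E) * cf g ξ - 1 + stableExponent σ α 1 ξ := by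
  rw [remainderFn, cf_centred]

theorem norm_exp_I_mul (ξ E : ℝ) : ‖Complex.exp (Complex.I * ξ * E)‖ = 1 := by
  rw [mul_assoc, mul_comm, ← Complex.ofReal_mul, Complex.norm_exp_ofReal_mul_I]

theorem norm_exp_neg_I_mul (ξ x : ℝ) : ‖Complex.exp (-(Complex.I * ξ * x))‖ = 1 := by
  rw [Complex.norm_exp]; simp

theorem norm_cf_le {g : ℝ → ℝ} (hg0 : ∀ x, 0 ≤ g x) (ξ : ℝ) : ‖cf g ξ‖ ≤ ∫ x, g x := by
  refine (norm_integral_le_integral_norm _).trans (le_of_eq ?_)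
  refine integral_congr_ae (Eventually.of_forall fun x => ?_)
  simp only [norm_mul, norm_exp_neg_I_mul, one_mul, Complex.norm_real, Real.norm_of_nonneg (hg0 x)]

theorem stableExponent_neg (σ α ξ : ℝ) :
    stableExponent σ α 1 (-ξ) = (starRingEnd ℂ) (stableExponent σ α 1 ξ) := by
  unfold stableExponent
  simp only [abs_neg, Real.sign_neg, map_mul, map_add, map_one, Complex.conj_I,
    Complex.conj_ofReal]
  push_cast
  ring

theorem cf_neg (g : ℝ → ℝ) (ξ : ℝ) : cf g (-ξ) = (starRingEnd ℂ) (cf g ξ) := by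
  unfold cf
  rw [← integral_conj]
  congr 1
  funext x
  rw [map_mul, ← Complex.exp_conj]
  simp [Complex.conj_ofReal]

theorem norm_remainderFn_neg (g : ℝ → ℝ) (E σ α ξ : ℝ) :
    ‖remainderFn g E σ α (-ξ)‖ = ‖remainderFn g E σ α ξ‖ := by
  have : remainderFn g E σ α (-ξ) = (starRingEnd ℂ) (remainderFn g E σ α ξ) := by
    rw [remainderFn_eq, remainderFn_eq, cf_neg, stableExponent_neg]
    simp only [map_add, map_sub, map_mul, map_one]
    rw [← Complex.exp_conj]
    simp [Complex.conj_ofReal]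
  rw [this, Complex.norm_conj]

theorem norm_stableExponent_le {σ : ℝ} (hσ : 0 ≤ σ) (α ξ : ℝ) :
    ‖stableExponent σ α 1 ξ‖ ≤ σ * |ξ| ^ α * (1 + |Real.tan (Real.pi * α / 2)|) := by
  unfold stableExponent
  rw [norm_mul, Complex.norm_real, Real.norm_of_nonneg
    (mul_nonneg hσ (Real.rpow_nonneg (abs_nonneg _) _))]
  refine mul_le_mul_of_nonneg_left ?_ (mul_nonneg hσ (Real.rpow_nonneg (abs_nonneg _) _))
  refine (norm_add_le _ _).trans ?_
  rw [norm_one, norm_mul, Complex.norm_I, one_mul, Complex.norm_real, one_mul, norm_mul]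
  have : ‖Real.sign ξ‖ ≤ 1 := by
    rcases Real.sign_apply_eq ξ with h | h | h <;> simp [h]
  have h2 := norm_nonneg (Real.tan (Real.pi * α / 2))
  rw [← Real.norm_eq_abs]
  nlinarith

theorem cos_neg_of (hα₁ : 1 < α) (hα₂ : α < 2) : Real.cos (Real.pi * α / 2) < 0 := by
  apply Real.cos_neg_of_pi_div_two_lt_of_lt <;> nlinarith [Real.pi_pos]

theorem stableScale_pos {C : ℝ} (hC : 0 < C) (hα₁ : 1 < α) (hα₂ : α < 2) :
    0 < stableScale C α := by
  have h1 := cos_neg_of hα₁ hα₂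
  have h2 : 0 < Real.Gamma (3 - α) := Real.Gamma_pos_of_pos (by linarith)
  unfold stableScale
  have h3 : 0 < α * (α - 1) := mul_pos (by linarith) (by linarith)
  have h4 := abs_pos.mpr h1.ne
  positivity

/-- Since `cos(πα/2) < 0`, `|cos|(1 + i tan) = -(cos + i sin) = -e^{iπα/2}`: the scale `σ` is
exactly what matches the limit in `tendsto_cfRem`. -/
theorem stableExponent_scale (hα₁ : 1 < α) (hα₂ : α < 2) (C : ℝ) {ξ : ℝ} (hξ : 0 < ξ) :
    stableExponent (stableScale C α) α 1 ξ = -((ξ ^ α : ℝ) : ℂ) * ((C : ℂ) *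
      (Complex.exp (Complex.I * (Real.pi * α / 2 : ℝ)) *
        ((Real.Gamma (3 - α) / (α * (α - 1)) : ℝ) : ℂ))) := by
  have h1 := cos_neg_of hα₁ hα₂
  have h2 : (Real.cos (Real.pi * α / 2) : ℂ) ≠ 0 := by exact_mod_cast h1.ne
  unfold stableExponent stableScale
  rw [abs_of_neg h1, abs_of_pos hξ, Real.sign_of_pos hξ, Real.tan_eq_sin_div_cos,
    mul_comm Complex.I ((Real.pi * α / 2 : ℝ) : ℂ), Complex.exp_mul_I, ← Complex.ofReal_cos,
    ← Complex.ofReal_sin]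
  generalize Real.cos (Real.pi * α / 2) = c at h2 ⊢
  generalize Real.sin (Real.pi * α / 2) = s
  push_cast
  field_simp

theorem integrable_exp_mul {g : ℝ → ℝ} (hg : Integrable g) (ξ : ℝ) :
    Integrable fun x : ℝ => Complex.exp (-(Complex.I * ξ * x)) * (g x : ℂ) := by
  refine Integrable.mono' hg.norm ?_ (Eventually.of_forall fun x => ?_)
  · exact (Continuous.aestronglyMeasurable (by fun_prop)).mul hg.ofReal.aestronglyMeasurable
  · rw [norm_mul, norm_exp_neg_I_mul, one_mul, Complex.norm_real]

theorem SquareDensity.cf_eq (H : SquareDensity f h)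
    (hint : Integrable fun y : ℝ => y ^ 2 * f y) (ξ : ℝ) :
    cf h ξ = 1 - Complex.I * ξ * ((∫ y, y ^ 2 * f y : ℝ) : ℂ) + cfRem f ξ := by
  have hfi := H.integrable_f
  have h1 : cf h ξ = ∫ y : ℝ, Complex.exp (-(Complex.I * ξ * ((y ^ 2 : ℝ) : ℂ))) * (f y : ℂ) :=
    H.integral_mul (F := fun x : ℝ => Complex.exp (-(Complex.I * ξ * x))) (by fun_prop)
  have hE : Integrable fun y : ℝ => Complex.exp (-(Complex.I * ξ * (y : ℂ) ^ 2)) * (f y : ℂ) := by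
    refine Integrable.mono' hfi.norm ?_ (Eventually.of_forall fun y => ?_)
    · exact (Continuous.aestronglyMeasurable (by fun_prop)).mul hfi.ofReal.aestronglyMeasurable
    · have := norm_exp_neg_I_mul ξ (y ^ 2)
      push_cast at this
      rw [norm_mul, this, one_mul, Complex.norm_real]
  have hlin : Integrable fun y : ℝ => Complex.I * ξ * ((y ^ 2 * f y : ℝ) : ℂ) :=
    hint.ofReal.const_mul _
  have h2 : cfRem f ξ = cf h ξ - 1 + Complex.I * ξ * ((∫ y, y ^ 2 * f y : ℝ) : ℂ) := by
    rw [h1, ← integral_complex_ofReal, ← integral_const_mul]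
    have hone : (1 : ℂ) = ∫ y : ℝ, (f y : ℂ) := by
      rw [integral_complex_ofReal, H.integral_f, Complex.ofReal_one]
    rw [hone, cfRem]
    push_cast
    have hfc : Integrable fun y : ℝ => (f y : ℂ) := hfi.ofReal
    have hd : Integrable fun y : ℝ =>
        Complex.exp (-(Complex.I * ξ * (y : ℂ) ^ 2)) * (f y : ℂ) - (f y : ℂ) := hE.sub hfc
    push_cast at hlin
    rw [← integral_sub hE hfc, ← integral_add hd hlin]
    refine integral_congr_ae (Eventually.of_forall fun y => ?_)
    simp only [expRem]
    ring
  rw [h2]; ring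

/-- Centring multiplies `1 - iξE + cfRem` by `e^{iξE}`. This cancels the linear term up to `O(ξ²)`,
which is `o(ξ^α)` because `α < 2`, and changes `cfRem` only by a factor `1 + O(ξ)`. -/
theorem tendsto_remainderFn_nhdsGT (H : SquareDensity f h)
    (hint : Integrable fun y : ℝ => y ^ 2 * f y) {C : ℝ} (hC : 0 < C) (hα₁ : 1 < α) (hα₂ : α < 2)
    (hν : truncFourth f ~[atTop] fun x : ℝ => C * x ^ (2 - α)) :
    Tendsto (fun ξ : ℝ => ‖remainderFn h (∫ y, y ^ 2 * f y) (stableScale C α) α ξ‖ / |ξ| ^ α)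
      (𝓝[>] 0) (𝓝 0) := by
  set E := ∫ y, y ^ 2 * f y
  set κ : ℂ := (C : ℂ) * (Complex.exp (Complex.I * (Real.pi * α / 2 : ℝ)) *
        ((Real.Gamma (3 - α) / (α * (α - 1)) : ℝ) : ℂ))
  have hR : Tendsto (fun ξ : ℝ => cfRem f ξ / ((ξ ^ α : ℝ) : ℂ)) (𝓝[>] 0) (𝓝 κ) :=
    tendsto_cfRem H.measurable_f H.nonneg_f hint hC.ne' hα₁ hα₂ hν
  have hRS : Tendsto (fun ξ : ℝ => ‖cfRem f ξ / ((ξ ^ α : ℝ) : ℂ) - κ‖) (𝓝[>] 0) (𝓝 0) := by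
    simpa using (hR.sub_const κ).norm
  have hlin : Tendsto (fun ξ : ℝ => |E| * ξ) (𝓝[>] 0) (𝓝 0) := by
    simpa using tendsto_rpow_nhdsGT_zero one_pos |E|
  have h1 : Tendsto (fun ξ : ℝ => (2 + |E| * ξ) * (|E| ^ 2 * ξ ^ (2 - α))
      + |E| * ξ * ‖cfRem f ξ / ((ξ ^ α : ℝ) : ℂ)‖
      + ‖cfRem f ξ / ((ξ ^ α : ℝ) : ℂ) - κ‖) (𝓝[>] 0) (𝓝 0) := by
    have := (((hlin.const_add 2).mul (tendsto_rpow_nhdsGT_zero (a := 2 - α) (by linarith)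
      (|E| ^ 2))).add (hlin.mul hR.norm)).add hRS
    simpa using this
  refine squeeze_zero' (Eventually.of_forall fun ξ => by positivity) ?_ h1
  filter_upwards [self_mem_nhdsWithin] with ξ hξ
  have hξ' : 0 < ξ := hξ
  have hp : 0 < ξ ^ α := Real.rpow_pos_of_pos hξ' α
  have hpc : ((ξ ^ α : ℝ) : ℂ) ≠ 0 := by exact_mod_cast hp.ne'
  rw [abs_of_pos hξ', div_le_iff₀ hp]
  set w : ℂ := -(Complex.I * ξ * E) with hw
  have hwre : 0 ≤ w.re := by simp [hw]
  have hwn : ‖w‖ = |E| * ξ := by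
    rw [hw, norm_neg, norm_mul, norm_mul, Complex.norm_I, Complex.norm_real, Complex.norm_real,
      Real.norm_of_nonneg hξ'.le, Real.norm_eq_abs]
    ring
  set q := cfRem f ξ / ((ξ ^ α : ℝ) : ℂ) with hq
  have hcq : cfRem f ξ = q * ((ξ ^ α : ℝ) : ℂ) := by rw [hq]; field_simp
  -- Uses `e^{-w}(1 + w) = 1 - w² + expRem w (1 + w)` with `w = -iξE`, and splits `e^{-w} q - κ`
  -- into `-(1 - e^{-w}) q + (q - κ)`.
  have hdec : remainderFn h E (stableScale C α) α ξ =
      (expRem w * (1 + w) - w ^ 2) + -(1 - Complex.exp (-w)) * (q * ((ξ ^ α : ℝ) : ℂ))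
        + (q - κ) * ((ξ ^ α : ℝ) : ℂ) := by
    rw [remainderFn_eq, H.cf_eq hint, stableExponent_scale hα₁ hα₂ C hξ', hcq]
    have : Complex.I * ξ * E = -w := by rw [hw, neg_neg]
    change Complex.exp (Complex.I * ξ * E) * (1 - Complex.I * ξ * E + q * ((ξ ^ α : ℝ) : ℂ)) - 1
      + -((ξ ^ α : ℝ) : ℂ) * κ = _
    rw [this, expRem]
    ring
  have hsq : (|E| * ξ) ^ 2 = (|E| ^ 2 * ξ ^ (2 - α)) * ξ ^ α := by
    rw [mul_assoc, ← Real.rpow_add hξ', sub_add_cancel, mul_pow]; norm_cast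
  have b1 : ‖expRem w * (1 + w) - w ^ 2‖ ≤ (2 + |E| * ξ) * (|E| * ξ) ^ 2 := by
    calc _ ≤ ‖expRem w‖ * (1 + ‖w‖) + ‖w‖ ^ 2 := by
          refine (norm_sub_le _ _).trans ?_
          rw [norm_mul, norm_pow]
          gcongr
          exact (norm_add_le _ _).trans (by simp)
      _ ≤ ‖w‖ ^ 2 * (1 + ‖w‖) + ‖w‖ ^ 2 := by gcongr; exact norm_expRem_le_sq hwre
      _ = _ := by rw [hwn]; ring
  have b2 : ‖-(1 - Complex.exp (-w)) * (q * ((ξ ^ α : ℝ) : ℂ))‖ ≤ |E| * ξ * (‖q‖ * ξ ^ α) := by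
    rw [norm_mul, norm_neg, norm_mul, norm_ofReal_rpow hξ', ← hwn]
    gcongr
    exact norm_one_sub_exp_neg_le hwre
  have b3 : ‖(q - κ) * ((ξ ^ α : ℝ) : ℂ)‖ = ‖q - κ‖ * ξ ^ α := by
    rw [norm_mul, norm_ofReal_rpow hξ']
  rw [hdec]
  refine (norm_add₃_le).trans ?_
  rw [b3]
  rw [hsq] at b1
  linarith

theorem tendsto_remainderFn (H : SquareDensity f h)
    (hint : Integrable fun y : ℝ => y ^ 2 * f y) {C : ℝ} (hC : 0 < C) (hα₁ : 1 < α) (hα₂ : α < 2)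
    (hν : truncFourth f ~[atTop] fun x : ℝ => C * x ^ (2 - α)) :
    Tendsto (fun ξ : ℝ => ‖remainderFn h (∫ y, y ^ 2 * f y) (stableScale C α) α ξ‖ / |ξ| ^ α)
      (𝓝[≠] 0) (𝓝 0) := by
  have h1 := tendsto_remainderFn_nhdsGT H hint hC hα₁ hα₂ hν
  rw [← nhdsLT_sup_nhdsGT, tendsto_sup]
  refine ⟨?_, h1⟩
  have h2 : Tendsto (fun ξ : ℝ => -ξ) (𝓝[<] 0) (𝓝[>] 0) := by
    simpa using tendsto_neg_nhdsLT (a := (0 : ℝ))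
  refine (h1.comp h2).congr fun ξ => ?_
  simp only [Function.comp, norm_remainderFn_neg, abs_neg]

/-- Near the origin this is the limit. For `|ξ| ≥ δ` the transform has modulus at most `1` and the
stable exponent is itself a multiple of `|ξ|^α`. -/
theorem remainderFn_bounded {g : ℝ → ℝ} {E σ : ℝ} (hg0 : ∀ x, 0 ≤ g x) (hg1 : ∫ x, g x = 1)
    (hσ : 0 ≤ σ) (hα : 0 < α)
    (ht : Tendsto (fun ξ : ℝ => ‖remainderFn g E σ α ξ‖ / |ξ| ^ α) (𝓝[≠] 0) (𝓝 0)) :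
    ∃ M : ℝ, ∀ ξ : ℝ, ‖remainderFn g E σ α ξ‖ / |ξ| ^ α ≤ M := by
  have h1 : ∀ᶠ ξ in 𝓝[≠] (0 : ℝ), ‖remainderFn g E σ α ξ‖ / |ξ| ^ α < 1 :=
    ht.eventually (gt_mem_nhds one_pos)
  rw [eventually_nhdsWithin_iff, Metric.eventually_nhds_iff] at h1
  obtain ⟨δ, hδ, h1⟩ := h1
  have hδp : 0 < δ ^ α := Real.rpow_pos_of_pos hδ α
  set T := 1 + |Real.tan (Real.pi * α / 2)|
  have hT : 0 ≤ T := by positivity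
  refine ⟨1 + (2 / δ ^ α + σ * T), fun ξ => ?_⟩
  have hpos : 0 ≤ 2 / δ ^ α + σ * T := by positivity
  rcases eq_or_ne ξ 0 with rfl | hξ
  -- At `ξ = 0` the quotient is `0`, division by zero being zero.
  · rw [abs_zero, Real.zero_rpow hα.ne', div_zero]; linarith
  · rcases lt_or_ge |ξ| δ with hlt | hge
    · have := h1 (y := ξ) (by simpa using hlt) hξ
      linarith
    · have hp : δ ^ α ≤ |ξ| ^ α := Real.rpow_le_rpow hδ.le hge hα.le
      have hp0 : 0 < |ξ| ^ α := lt_of_lt_of_le hδp hp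
      have hb : ‖remainderFn g E σ α ξ‖ ≤ 2 + σ * |ξ| ^ α * T := by
        rw [remainderFn_eq]
        refine (norm_add_le _ _).trans (add_le_add ?_ (norm_stableExponent_le hσ α ξ))
        refine (norm_sub_le _ _).trans ?_
        rw [norm_mul, norm_exp_I_mul, one_mul, norm_one]
        have := norm_cf_le hg0 ξ
        linarith
      have h3 : 2 / |ξ| ^ α ≤ 2 / δ ^ α := by gcongr
      calc _ ≤ (2 + σ * |ξ| ^ α * T) / |ξ| ^ α := by gcongr
        _ = 2 / |ξ| ^ α + σ * T := by field_simp
        _ ≤ _ := by linarith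

end

section

variable {g h : ℝ → ℝ}

/-! ### The Fourier transform of an integrable function -/

theorem cf_eq_fourier (g : ℝ → ℝ) (ξ : ℝ) :
    cf g ξ = FourierTransform.fourier (fun x => (g x : ℂ)) (ξ / (2 * Real.pi)) := by
  rw [Real.fourier_real_eq_integral_exp_smul, cf]
  refine integral_congr_ae (Eventually.of_forall fun x => ?_)
  simp only [smul_eq_mul]
  congr 2
  have : (Real.pi : ℂ) ≠ 0 := by exact_mod_cast Real.pi_ne_zero
  push_cast
  field_simp

theorem continuous_cf (hg : Integrable g) : Continuous (cf g) := by
  refine continuous_of_dominated (bound := fun x => ‖g x‖)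
    (fun ξ => (integrable_exp_mul hg ξ).aestronglyMeasurable) (fun ξ => ?_) hg.norm ?_
  · filter_upwards with x
    rw [norm_mul, norm_exp_neg_I_mul, one_mul, Complex.norm_real]
  · filter_upwards with x
    fun_prop

theorem tendsto_cf_cocompact (g : ℝ → ℝ) : Tendsto (cf g) (cocompact ℝ) (𝓝 0) := by
  have h1 := Real.zero_at_infty_fourier (fun x => (g x : ℂ))
  have h2 : Tendsto (fun ξ : ℝ => ξ / (2 * Real.pi)) (cocompact ℝ) (cocompact ℝ) :=
    (Homeomorph.mulRight₀ (2 * Real.pi)⁻¹ (by positivity)).isClosedEmbedding.tendsto_cocompact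
  exact (h1.comp h2).congr fun ξ => (cf_eq_fourier g ξ).symm

/-- If the modulus were `1`, with phase `θ`, then `∫ (1 - cos(ξx + θ)) g = 0`. So `g` would vanish
almost everywhere off the countable set where the cosine is `1`, contradicting `∫ g = 1`. -/
theorem norm_cf_lt_one (hg : Integrable g) (hg0 : ∀ x, 0 ≤ g x) (hg1 : ∫ x, g x = 1)
    {ξ : ℝ} (hξ : ξ ≠ 0) : ‖cf g ξ‖ < 1 := by
  refine lt_of_le_of_ne ((norm_cf_le hg0 ξ).trans hg1.le) fun hone => ?_
  set θ := (cf g ξ).arg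
  have hcf : cf g ξ = Complex.exp (θ * Complex.I) := by
    have := Complex.norm_mul_exp_arg_mul_I (cf g ξ)
    rw [hone, Complex.ofReal_one, one_mul] at this
    exact this.symm
  have hI : Integrable fun x => Real.cos (ξ * x + θ) * g x := by
    refine Integrable.mono' hg.norm ((Continuous.aestronglyMeasurable (by fun_prop)).mul
      hg.aestronglyMeasurable) (Eventually.of_forall fun x => ?_)
    rw [norm_mul]
    exact mul_le_of_le_one_left (norm_nonneg _) (by simpa using Real.abs_cos_le_one _)
  have hzero : ∫ x, (1 - Real.cos (ξ * x + θ)) * g x = 0 := by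
    have e1 : Complex.exp (-(θ * Complex.I)) * cf g ξ = 1 := by
      rw [hcf, ← Complex.exp_add]; simp
    have e2 : ∫ x, Real.cos (ξ * x + θ) * g x = 1 := by
      rw [cf, ← integral_const_mul] at e1
      have hint : Integrable fun x : ℝ => Complex.exp (-(θ * Complex.I)) *
          (Complex.exp (-(Complex.I * ξ * x)) * (g x : ℂ)) :=
        (integrable_exp_mul hg ξ).const_mul _
      have e3 := congrArg Complex.re e1
      rw [← RCLike.re_eq_complex_re, ← integral_re hint] at e3
      simp only [RCLike.re_eq_complex_re, Complex.one_re] at e3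
      rw [← e3]
      refine integral_congr_ae (Eventually.of_forall fun x => ?_)
      simp only
      rw [← mul_assoc, ← Complex.exp_add]
      have : -(θ * Complex.I) + -(Complex.I * ξ * x) = ((-(ξ * x + θ) : ℝ) : ℂ) * Complex.I := by
        push_cast; ring
      rw [this, Complex.re_mul_ofReal, Complex.exp_ofReal_mul_I_re, Real.cos_neg]
    simp_rw [sub_mul, one_mul]
    rw [integral_sub hg hI, hg1, e2, sub_self]
  have hnn : ∀ x, 0 ≤ (1 - Real.cos (ξ * x + θ)) * g x := fun x =>
    mul_nonneg (by linarith [Real.cos_le_one (ξ * x + θ)]) (hg0 x)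
  have hint2 : Integrable fun x => (1 - Real.cos (ξ * x + θ)) * g x := by
    simp_rw [sub_mul, one_mul]; exact hg.sub hI
  have hae := (integral_eq_zero_iff_of_nonneg hnn hint2).mp hzero
  have hcount : (range fun n : ℤ => (n * (2 * Real.pi) - θ) / ξ).Countable := countable_range _
  have hae2 : ∀ᵐ x : ℝ, g x = 0 := by
    filter_upwards [hae, hcount.ae_notMem volume] with x hx hx2
    rcases mul_eq_zero.mp hx with h | h
    · exfalso
      have : Real.cos (ξ * x + θ) = 1 := by linarith
      obtain ⟨n, hn⟩ := (Real.cos_eq_one_iff _).mp this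
      exact hx2 ⟨n, by simp only [hn]; field_simp; ring⟩
    · exact h
  have : ∫ x, g x = 0 := by
    rw [integral_congr_ae hae2]; simp
  linarith

/-- Riemann–Lebesgue handles large `|ξ|`; on the remaining compact annulus the continuous modulus
attains its maximum, which is below `1`. -/
theorem exists_norm_cf_le (hg : Integrable g) (hg0 : ∀ x, 0 ≤ g x) (hg1 : ∫ x, g x = 1)
    {δ : ℝ} (hδ : 0 < δ) : ∃ κ, 0 < κ ∧ ∀ ξ, δ ≤ |ξ| → ‖cf g ξ‖ ≤ 1 - κ := by
  have h1 : ∀ᶠ ξ in cocompact ℝ, ‖cf g ξ‖ < 1 / 2 := by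
    have := (tendsto_cf_cocompact g).norm
    rw [norm_zero] at this
    exact this.eventually (gt_mem_nhds (by norm_num))
  rw [← Metric.cobounded_eq_cocompact, ← comap_norm_atTop, eventually_comap] at h1
  obtain ⟨R, hR⟩ := eventually_atTop.mp h1
  have hR' : ∀ ξ : ℝ, R ≤ |ξ| → ‖cf g ξ‖ < 1 / 2 := fun ξ hξ => hR |ξ| hξ ξ rfl
  set K : Set ℝ := {ξ | δ ≤ |ξ|} ∩ Metric.closedBall 0 (max R δ)
  have hK : IsCompact K := (isCompact_closedBall _ _).inter_left
    (isClosed_le continuous_const continuous_abs)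
  have hKne : K.Nonempty := ⟨δ, by simp [K, abs_of_pos hδ]⟩
  obtain ⟨ξ₀, hξ₀, hmax⟩ := hK.exists_isMaxOn hKne ((continuous_cf hg).norm.continuousOn)
  have hξ₀' : ξ₀ ≠ 0 := by
    rintro rfl
    have : δ ≤ |(0 : ℝ)| := hξ₀.1
    simp at this; linarith
  have hlt := norm_cf_lt_one hg hg0 hg1 hξ₀'
  refine ⟨min (1 / 2) (1 - ‖cf g ξ₀‖), lt_min (by norm_num) (by linarith), fun ξ hξ => ?_⟩
  by_cases h : |ξ| ≤ max R δ
  · have : ‖cf g ξ‖ ≤ ‖cf g ξ₀‖ := hmax ⟨hξ, by simpa using h⟩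
    linarith [min_le_right (1 / 2) (1 - ‖cf g ξ₀‖)]
  · have := hR' ξ ((le_max_left _ _).trans (not_le.mp h).le)
    linarith [min_le_left (1 / 2) (1 - ‖cf g ξ₀‖)]

/-! ### The `L²` bound for bounded densities -/

theorem integrable_uncurry_exp_mul (hg : Integrable g) {W : ℝ → ℂ} (hW : Integrable W) :
    Integrable (Function.uncurry fun ξ x : ℝ =>
      Complex.exp (-(Complex.I * ξ * x)) * (g x : ℂ) * W ξ) (volume.prod volume) := by
  have h1 : Integrable (fun p : ℝ × ℝ => W p.1 * (g p.2 : ℂ)) (volume.prod volume) :=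
    hW.mul_prod hg.ofReal
  refine Integrable.mono' h1.norm ?_ (Eventually.of_forall fun p => ?_)
  · have h2 : AEStronglyMeasurable (fun p : ℝ × ℝ => Complex.exp (-(Complex.I * p.1 * p.2)) *
        (W p.1 * (g p.2 : ℂ))) (volume.prod volume) :=
      (Continuous.aestronglyMeasurable (by fun_prop)).mul h1.aestronglyMeasurable
    refine h2.congr (Eventually.of_forall fun p => ?_)
    simp only [Function.uncurry]
    ring
  · simp only [Function.uncurry]
    rw [norm_mul, norm_mul, norm_exp_neg_I_mul, norm_mul, one_mul, mul_comm]

/-- The multiplication formula, by Fubini. It serves both for the `L²` bound and for pointwise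
Fourier inversion. -/
theorem integral_cf_mul (hg : Integrable g) {W : ℝ → ℂ} (hW : Integrable W) :
    ∫ ξ, cf g ξ * W ξ = ∫ x, (g x : ℂ) * ∫ ξ : ℝ, Complex.exp (-(Complex.I * ξ * x)) * W ξ := by
  have h := integral_integral_swap (integrable_uncurry_exp_mul hg hW)
  simp only [cf]
  simp_rw [← integral_mul_const]
  rw [h]
  refine integral_congr_ae (Eventually.of_forall fun x => ?_)
  simp only
  rw [← integral_const_mul]
  refine integral_congr_ae (Eventually.of_forall fun ξ => ?_)
  simp only
  ring

theorem integrable_cexp_neg_sq {c : ℝ} (hc : 0 < c) :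
    Integrable fun ξ : ℝ => Complex.exp (-(c : ℂ) * (ξ : ℂ) ^ 2) :=
  integrable_cexp_neg_mul_sq (by simpa using hc)

theorem norm_fourier_gaussian {c : ℝ} (hc : 0 < c) (x y : ℝ) :
    ‖∫ ξ : ℝ, Complex.exp (-(Complex.I * ξ * y)) *
      (Complex.exp (Complex.I * ξ * x) * Complex.exp (-(c : ℂ) * (ξ : ℂ) ^ 2))‖ =
      √(Real.pi / c) * Real.exp (-(1 / (4 * c)) * (y - x) ^ 2) := by
  have h := fourierIntegral_gaussian (b := (c : ℂ)) (by simpa using hc) ((x - y : ℝ) : ℂ)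
  have e : ∀ ξ : ℝ, Complex.exp (-(Complex.I * ξ * y)) *
      (Complex.exp (Complex.I * ξ * x) * Complex.exp (-(c : ℂ) * (ξ : ℂ) ^ 2)) =
      Complex.exp (Complex.I * ((x - y : ℝ) : ℂ) * ξ) * Complex.exp (-(c : ℂ) * (ξ : ℂ) ^ 2) := by
    intro ξ
    rw [← mul_assoc, ← Complex.exp_add]
    congr 2
    push_cast; ring
  simp_rw [e]
  rw [h, norm_mul, ← Complex.ofReal_div, show (1 / 2 : ℂ) = ((1 / 2 : ℝ) : ℂ) by push_cast; ring,
    ← Complex.ofReal_cpow (by positivity), Complex.norm_real, ← Real.sqrt_eq_rpow,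
    Real.norm_of_nonneg (Real.sqrt_nonneg _)]
  have e2 : -((x - y : ℝ) : ℂ) ^ 2 / (4 * (c : ℂ)) =
      ((-(1 / (4 * c)) * (y - x) ^ 2 : ℝ) : ℂ) := by push_cast; ring
  rw [e2, ← Complex.ofReal_exp, Complex.norm_real, Real.norm_of_nonneg (Real.exp_pos _).le]

theorem integral_gaussian_shift {c : ℝ} (hc : 0 < c) (x : ℝ) :
    Integrable (fun y : ℝ => √(Real.pi / c) * Real.exp (-(1 / (4 * c)) * (y - x) ^ 2)) ∧
    ∫ y : ℝ, √(Real.pi / c) * Real.exp (-(1 / (4 * c)) * (y - x) ^ 2) = 2 * Real.pi := by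
  have hi : Integrable fun y : ℝ => Real.exp (-(1 / (4 * c)) * y ^ 2) :=
    integrable_exp_neg_mul_sq (by positivity)
  refine ⟨(hi.comp_sub_right x).const_mul _, ?_⟩
  rw [integral_const_mul, integral_sub_right_eq_self
    (fun y : ℝ => Real.exp (-(1 / (4 * c)) * y ^ 2)) x, integral_gaussian,
    ← Real.sqrt_mul (by positivity)]
  have : Real.pi / c * (Real.pi / (1 / (4 * c))) = (2 * Real.pi) ^ 2 := by field_simp; ring
  rw [this, Real.sqrt_sq (by positivity)]

/-- Half of Plancherel with Gaussian damping. By the multiplication formula the left side is `∫ g`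
against the smoothing of `g` by a Gaussian kernel of total mass `2π`, and that smoothing is at most
`2πM`. The bound does not depend on `c`. -/
theorem integral_norm_cf_sq_gaussian_le (hg : Integrable g) (hg0 : ∀ x, 0 ≤ g x) {M : ℝ}
    (hgM : ∀ x, g x ≤ M) {c : ℝ} (hc : 0 < c) :
    Integrable (fun ξ : ℝ => ‖cf g ξ‖ ^ 2 * Real.exp (-c * ξ ^ 2)) ∧
    ∫ ξ : ℝ, ‖cf g ξ‖ ^ 2 * Real.exp (-c * ξ ^ 2) ≤ 2 * Real.pi * M * ∫ x, g x := by
  have hM : 0 ≤ M := (hg0 0).trans (hgM 0)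
  have hG := integrable_cexp_neg_sq hc
  have hcfm := (continuous_cf hg).aestronglyMeasurable (μ := volume)
  set W : ℝ → ℂ := fun ξ => (starRingEnd ℂ) (cf g ξ) * Complex.exp (-(c : ℂ) * (ξ : ℂ) ^ 2)
  have hW : Integrable W := by
    refine hG.bdd_mul (c := ∫ x, g x)
      (Complex.continuous_conj.comp_aestronglyMeasurable hcfm) (Eventually.of_forall fun ξ => ?_)
    rw [Complex.norm_conj]
    exact norm_cf_le hg0 ξ
  have hval : ∀ ξ : ℝ, cf g ξ * W ξ = ((‖cf g ξ‖ ^ 2 * Real.exp (-c * ξ ^ 2) : ℝ) : ℂ) := by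
    intro ξ
    simp only [W]
    rw [← mul_assoc, Complex.mul_conj, Complex.normSq_eq_norm_sq]
    push_cast
    ring
  have hreal : Integrable (fun ξ : ℝ => ‖cf g ξ‖ ^ 2 * Real.exp (-c * ξ ^ 2)) := by
    have h1 : Integrable fun ξ => cf g ξ * W ξ :=
      hW.bdd_mul (c := ∫ x, g x) hcfm (Eventually.of_forall fun ξ => norm_cf_le hg0 ξ)
    have h2 := h1.re
    refine h2.congr (Eventually.of_forall fun ξ => ?_)
    simp only [hval]
    exact Complex.ofReal_re _
  refine ⟨hreal, ?_⟩
  have hinner : ∀ x : ℝ, ‖∫ ξ : ℝ, Complex.exp (-(Complex.I * ξ * x)) * W ξ‖ ≤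
      2 * Real.pi * M := by
    intro x
    have hWx : Integrable fun ξ : ℝ => Complex.exp (Complex.I * ξ * x) *
        Complex.exp (-(c : ℂ) * (ξ : ℂ) ^ 2) :=
      hG.bdd_mul (c := 1) (Continuous.aestronglyMeasurable (by fun_prop))
        (Eventually.of_forall fun ξ => (norm_exp_I_mul ξ x).le)
    have e1 : ∫ ξ : ℝ, Complex.exp (-(Complex.I * ξ * x)) * W ξ = (starRingEnd ℂ)
        (∫ ξ : ℝ, cf g ξ * (Complex.exp (Complex.I * ξ * x) *
          Complex.exp (-(c : ℂ) * (ξ : ℂ) ^ 2))) := by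
      rw [← integral_conj]
      refine integral_congr_ae (Eventually.of_forall fun ξ => ?_)
      simp only [W, map_mul, ← Complex.exp_conj, map_neg, Complex.conj_I, Complex.conj_ofReal,
        map_pow]
      ring_nf
    rw [e1, Complex.norm_conj, integral_cf_mul hg hWx]
    obtain ⟨hi, hv⟩ := integral_gaussian_shift hc x
    calc _ ≤ ∫ y : ℝ, M * (√(Real.pi / c) * Real.exp (-(1 / (4 * c)) * (y - x) ^ 2)) := by
          refine norm_integral_le_of_norm_le (hi.const_mul M) (Eventually.of_forall fun y => ?_)
          rw [norm_mul, norm_fourier_gaussian hc, Complex.norm_real, Real.norm_of_nonneg (hg0 y)]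
          exact mul_le_mul_of_nonneg_right (hgM y) (by positivity)
      _ = _ := by rw [integral_const_mul, hv]; ring
  have hcomplex : ((∫ ξ : ℝ, ‖cf g ξ‖ ^ 2 * Real.exp (-c * ξ ^ 2) : ℝ) : ℂ) =
      ∫ x, (g x : ℂ) * ∫ ξ : ℝ, Complex.exp (-(Complex.I * ξ * x)) * W ξ := by
    rw [← integral_cf_mul hg hW, ← integral_complex_ofReal]
    exact integral_congr_ae (Eventually.of_forall fun ξ => (hval ξ).symm)
  refine (le_abs_self _).trans ?_
  rw [← Real.norm_eq_abs, ← Complex.norm_real, hcomplex, ← integral_const_mul]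
  refine norm_integral_le_of_norm_le (hg.const_mul _) (Eventually.of_forall fun x => ?_)
  rw [norm_mul, Complex.norm_real, Real.norm_of_nonneg (hg0 x), mul_comm]
  exact mul_le_mul_of_nonneg_right (hinner x) (hg0 x)

/-- Remove the damping along `c = 1/(n+1)` by Fatou's lemma. -/
theorem lintegral_norm_cf_sq_le (hg : Integrable g) (hg0 : ∀ x, 0 ≤ g x) {M : ℝ}
    (hgM : ∀ x, g x ≤ M) :
    ∫⁻ ξ, ENNReal.ofReal (‖cf g ξ‖ ^ 2) ≤ ENNReal.ofReal (2 * Real.pi * M * ∫ x, g x) := by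
  have hcont := continuous_cf hg
  set c : ℕ → ℝ := fun n => 1 / ((n : ℝ) + 1)
  have hc : ∀ n, 0 < c n := fun n => by positivity
  set F : ℕ → ℝ → ENNReal := fun n ξ => ENNReal.ofReal (‖cf g ξ‖ ^ 2 * Real.exp (-c n * ξ ^ 2))
  have hF : ∀ n, Measurable (F n) := fun n => by
    have := hcont.measurable
    fun_prop
  have hlim : ∀ ξ, liminf (fun n => F n ξ) atTop = ENNReal.ofReal (‖cf g ξ‖ ^ 2) := by
    intro ξ
    refine Tendsto.liminf_eq (ENNReal.tendsto_ofReal ?_)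
    have h1 : Tendsto c atTop (𝓝 0) := tendsto_one_div_add_atTop_nhds_zero_nat
    have h2 : Tendsto (fun n => ‖cf g ξ‖ ^ 2 * Real.exp (-c n * ξ ^ 2)) atTop
        (𝓝 (‖cf g ξ‖ ^ 2 * Real.exp (-0 * ξ ^ 2))) :=
      ((Real.continuous_exp.tendsto _).comp (h1.neg.mul_const _)).const_mul _
    simpa using h2
  calc _ = ∫⁻ ξ, liminf (fun n => F n ξ) atTop := by simp_rw [hlim]
    _ ≤ liminf (fun n => ∫⁻ ξ, F n ξ) atTop := lintegral_liminf_le hF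
    _ ≤ _ := by
      refine liminf_le_of_le ⟨0, by simp⟩ fun b hb => ?_
      obtain ⟨n, hn⟩ := hb.exists
      refine hn.trans ?_
      obtain ⟨hi, hle⟩ := integral_norm_cf_sq_gaussian_le hg hg0 hgM (hc n)
      rw [← ofReal_integral_eq_lintegral_ofReal hi
        (Eventually.of_forall fun ξ => by positivity)]
      exact ENNReal.ofReal_le_ofReal hle

end

section

variable {g h : ℝ → ℝ}

/-! ### Integrability of powers of the Fourier transform -/

theorem volume_norm_cf_gt_le_of_bdd (hg : Integrable g) (hg0 : ∀ x, 0 ≤ g x) {M : ℝ}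
    (hgM : ∀ x, g x ≤ M) {s : ℝ} (hs : 0 < s) :
    volume {ξ | s < ‖cf g ξ‖} ≤ ENNReal.ofReal (2 * Real.pi * M * (∫ x, g x) / s ^ 2) := by
  have hm : Measurable fun ξ => ENNReal.ofReal (‖cf g ξ‖ ^ 2) := by
    have := (continuous_cf hg).measurable
    fun_prop
  have hs2 : ENNReal.ofReal (s ^ 2) ≠ 0 := by
    rw [Ne, ENNReal.ofReal_eq_zero, not_le]; positivity
  rw [ENNReal.ofReal_div_of_pos (by positivity)]
  calc _ ≤ volume {ξ | ENNReal.ofReal (s ^ 2) ≤ ENNReal.ofReal (‖cf g ξ‖ ^ 2)} := by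
        refine measure_mono fun ξ hξ => ?_
        have hξ' : s < ‖cf g ξ‖ := hξ
        exact ENNReal.ofReal_le_ofReal (by gcongr)
    _ ≤ (∫⁻ ξ, ENNReal.ofReal (‖cf g ξ‖ ^ 2)) / ENNReal.ofReal (s ^ 2) :=
        meas_ge_le_lintegral_div hm.aemeasurable hs2 ENNReal.ofReal_ne_top
    _ ≤ _ := by gcongr; exact lintegral_norm_cf_sq_le hg hg0 hgM

theorem cf_add {g₁ g₂ : ℝ → ℝ} (h₁ : Integrable g₁) (h₂ : Integrable g₂) (ξ : ℝ) :
    cf (fun x => g₁ x + g₂ x) ξ = cf g₁ ξ + cf g₂ ξ := by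
  unfold cf
  rw [← integral_add (integrable_exp_mul h₁ ξ) (integrable_exp_mul h₂ ξ)]
  refine integral_congr_ae (Eventually.of_forall fun x => ?_)
  push_cast
  ring

/-- A weak-type substitute for Hausdorff–Young, covering all `p > 1`. Cut `h` at a height `lam` such
that the tall part has mass at most `t/2`. Then `‖ĥ‖ > t` forces the transform of the bounded part
above `t/2`, and Chebyshev with the `L²` bound gives `8π lam / t²`. -/
theorem volume_norm_cf_gt_le (hm : Measurable h) (hh : Integrable h) (hh0 : ∀ x, 0 ≤ h x)
    (hh1 : ∫ x, h x = 1) {p : ℝ} (hp : 1 < p) (hhp : Integrable fun x => h x ^ p) :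
    ∃ B : ℝ, 0 ≤ B ∧ ∀ t, 0 < t →
      volume {ξ | t < ‖cf h ξ‖} ≤ ENNReal.ofReal (B * t ^ (-(2 + 1 / (p - 1)))) := by
  set A := ∫ x, h x ^ p
  have hA : 0 ≤ A := integral_nonneg fun x => Real.rpow_nonneg (hh0 x) _
  have hp1 : 0 < p - 1 := by linarith
  refine ⟨8 * Real.pi * (2 * (A + 1)) ^ (1 / (p - 1)), by positivity, fun t ht => ?_⟩
  -- Chosen so that `lam^{-(p-1)} ∫ h^p ≤ t/2`; `A + 1` replaces `A` to keep the height positive.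
  set lam := (2 * (A + 1) / t) ^ (1 / (p - 1))
  have hlam : 0 < lam := Real.rpow_pos_of_pos (by positivity) _
  have hlamp : lam ^ (p - 1) = 2 * (A + 1) / t := by
    rw [← Real.rpow_mul (by positivity), one_div, inv_mul_cancel₀ hp1.ne', Real.rpow_one]
  set S := {x | h x ≤ lam}
  have hS : MeasurableSet S := measurableSet_le hm measurable_const
  set h₁ := S.indicator h
  set h₂ := Sᶜ.indicator h
  have hi₁ : Integrable h₁ := hh.indicator hS
  have hi₂ : Integrable h₂ := hh.indicator hS.compl
  have h₁0 : ∀ x, 0 ≤ h₁ x := fun x => indicator_nonneg (fun y _ => hh0 y) x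
  have h₂0 : ∀ x, 0 ≤ h₂ x := fun x => indicator_nonneg (fun y _ => hh0 y) x
  have hsum : (fun x => h₁ x + h₂ x) = h := by
    funext x
    exact congrFun (indicator_self_add_compl S h) x
  have hcf : ∀ ξ, cf h ξ = cf h₁ ξ + cf h₂ ξ := fun ξ => by
    rw [← cf_add hi₁ hi₂, hsum]
  have h₁le : ∀ x, h₁ x ≤ lam := fun x => by
    by_cases hx : x ∈ S
    · simp only [h₁, indicator_of_mem hx]; exact hx
    · simp only [h₁, indicator_of_notMem hx]; exact hlam.le
  have h₁int : ∫ x, h₁ x ≤ 1 := by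
    rw [← hh1]
    refine integral_mono hi₁ hh fun x => ?_
    exact indicator_le_self' (fun y _ => hh0 y) x
  have h₂int : ∫ x, h₂ x ≤ t / 2 := by
    have hpt : ∀ x, h₂ x ≤ (lam ^ (p - 1))⁻¹ * h x ^ p := by
      intro x
      by_cases hx : x ∈ Sᶜ
      · simp only [h₂, indicator_of_mem hx]
        have hx' : lam < h x := not_le.mp hx
        have hx0 : 0 < h x := hlam.trans hx'
        have e : h x ^ p = h x ^ (p - 1) * h x := by
          nth_rewrite 3 [← Real.rpow_one (h x)]
          rw [← Real.rpow_add hx0, sub_add_cancel]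
        rw [e, ← mul_assoc]
        have : 1 ≤ (lam ^ (p - 1))⁻¹ * h x ^ (p - 1) := by
          rw [← div_eq_inv_mul, one_le_div (Real.rpow_pos_of_pos hlam _)]
          exact Real.rpow_le_rpow hlam.le hx'.le hp1.le
        nlinarith
      · simp only [h₂, indicator_of_notMem hx]
        exact mul_nonneg (by positivity) (Real.rpow_nonneg (hh0 x) _)
    calc _ ≤ ∫ x, (lam ^ (p - 1))⁻¹ * h x ^ p := integral_mono hi₂ (hhp.const_mul _) hpt
      _ = t / (2 * (A + 1)) * A := by rw [integral_const_mul, hlamp, inv_div]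
      _ ≤ _ := by
        rw [div_mul_eq_mul_div, div_le_div_iff₀ (by positivity) two_pos]
        nlinarith
  have hsub : {ξ | t < ‖cf h ξ‖} ⊆ {ξ | t / 2 < ‖cf h₁ ξ‖} := by
    intro ξ hξ
    have hξ' : t < ‖cf h ξ‖ := hξ
    rw [hcf ξ] at hξ'
    have h3 := norm_add_le (cf h₁ ξ) (cf h₂ ξ)
    have h4 := (norm_cf_le h₂0 ξ).trans h₂int
    change t / 2 < ‖cf h₁ ξ‖
    linarith
  refine (measure_mono hsub).trans
    ((volume_norm_cf_gt_le_of_bdd hi₁ h₁0 h₁le (half_pos ht)).trans ?_)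
  refine ENNReal.ofReal_le_ofReal ?_
  have e1 : t ^ (-(2 + 1 / (p - 1))) = (t ^ 2)⁻¹ * (t ^ (1 / (p - 1)))⁻¹ := by
    rw [Real.rpow_neg ht.le, Real.rpow_add ht, mul_inv]; norm_cast
  have e2 : lam = (2 * (A + 1)) ^ (1 / (p - 1)) * (t ^ (1 / (p - 1)))⁻¹ := by
    simp only [lam]
    rw [Real.div_rpow (by positivity) ht.le, div_eq_mul_inv]
  calc _ ≤ 2 * Real.pi * lam * 1 / (t / 2) ^ 2 := by gcongr
    _ = _ := by
      rw [e1, e2]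
      field_simp
      ring

/-- Layer-cake formula. Level sets above `1` are empty, and below `1` the weak-type bound makes the
integrand `t^{k-1-q}`, integrable at `0` once `k > q`. -/
theorem exists_integrable_norm_cf_pow (hm : Measurable h) (hh : Integrable h)
    (hh0 : ∀ x, 0 ≤ h x) (hh1 : ∫ x, h x = 1) {p : ℝ} (hp : 1 < p)
    (hhp : Integrable fun x => h x ^ p) :
    ∃ k : ℕ, 1 ≤ k ∧ Integrable fun ξ => ‖cf h ξ‖ ^ k := by
  obtain ⟨B, hB, hvol⟩ := volume_norm_cf_gt_le hm hh hh0 hh1 hp hhp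
  set q := 2 + 1 / (p - 1)
  have hq : 0 < q := by
    have : 0 < p - 1 := by linarith
    positivity
  obtain ⟨k, hk⟩ := exists_nat_gt q
  have hk0 : (0 : ℝ) < k := hq.trans hk
  have hk1 : 1 ≤ k := by exact_mod_cast hk0
  refine ⟨k, hk1, ((continuous_cf hh).norm.pow k).aestronglyMeasurable, ?_⟩
  rw [hasFiniteIntegral_iff_ofReal (Eventually.of_forall fun ξ => by positivity)]
  have hlc := lintegral_rpow_eq_lintegral_meas_lt_mul volume
    (f := fun ξ => ‖cf h ξ‖) (Eventually.of_forall fun ξ => norm_nonneg _)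
    (continuous_cf hh).norm.measurable.aemeasurable hk0
  simp only [Real.rpow_natCast] at hlc
  rw [hlc]
  refine ENNReal.mul_lt_top ENNReal.ofReal_lt_top ?_
  have hI : IntegrableOn (fun t : ℝ => B * t ^ ((k : ℝ) - 1 - q)) (Ioc 0 1) := by
    refine Integrable.const_mul ?_ B
    change IntegrableOn _ _ _
    rw [← intervalIntegrable_iff_integrableOn_Ioc_of_le zero_le_one]
    exact intervalIntegral.intervalIntegrable_rpow' (by linarith)
  calc _ ≤ ∫⁻ t in Ioi (0 : ℝ), (Ioc (0 : ℝ) 1).indicator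
        (fun t => ENNReal.ofReal (B * t ^ ((k : ℝ) - 1 - q))) t := by
        refine setLIntegral_mono' measurableSet_Ioi fun t ht => ?_
        have ht' : 0 < t := ht
        by_cases h1 : t ≤ 1
        · rw [indicator_of_mem (show t ∈ Ioc (0 : ℝ) 1 from ⟨ht', h1⟩)]
          refine (mul_le_mul_left (hvol t ht') _).trans (le_of_eq ?_)
          rw [← ENNReal.ofReal_mul (by positivity), mul_assoc, ← Real.rpow_add ht']
          congr 3; ring
        · have he : {ξ | t < ‖cf h ξ‖} = ∅ := by
            ext ξ
            simp only [mem_ofPred_eq, mem_empty_iff_false, iff_false, not_lt]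
            exact ((norm_cf_le hh0 ξ).trans hh1.le).trans (not_le.mp h1).le
          rw [he, measure_empty, zero_mul]
          exact bot_le
    _ ≤ ∫⁻ t, (Ioc (0 : ℝ) 1).indicator
        (fun t => ENNReal.ofReal (B * t ^ ((k : ℝ) - 1 - q))) t := setLIntegral_le_lintegral _ _
    _ = ∫⁻ t in Ioc (0 : ℝ) 1, ENNReal.ofReal (B * t ^ ((k : ℝ) - 1 - q)) :=
        lintegral_indicator measurableSet_Ioc _
    _ < ⊤ := hI.lintegral_lt_top

theorem integrable_norm_cf_pow_of_le (hh : Integrable h)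
    (hh0 : ∀ x, 0 ≤ h x) (hh1 : ∫ x, h x = 1) {k n : ℕ} (hkn : k ≤ n)
    (hk : Integrable fun ξ => ‖cf h ξ‖ ^ k) : Integrable fun ξ => ‖cf h ξ‖ ^ n := by
  refine Integrable.mono' hk ((continuous_cf hh).norm.pow n).aestronglyMeasurable
    (Eventually.of_forall fun ξ => ?_)
  rw [Real.norm_of_nonneg (by positivity)]
  exact pow_le_pow_of_le_one (norm_nonneg _) ((norm_cf_le hh0 ξ).trans hh1.le) hkn

/-! ### Fourier inversion almost everywhere -/

open FourierTransform in
-- Inversion for an integrable function without continuity, hence only almost everywhere. Both sides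
-- are tested against smooth compactly supported functions, which lie in Schwartz space where
-- inversion holds, and the transforms are moved across by the multiplication formula.
theorem fourierInv_fourier_ae_eq {u : ℝ → ℂ} (hu : Integrable u) (hu' : Integrable (𝓕 u)) :
    u =ᵐ[volume] 𝓕⁻ (𝓕 u) := by
  have hflip : ∀ (a b : ℝ → ℂ), Integrable a → Integrable b →
      ∫ ξ, 𝓕 a ξ * b ξ = ∫ x, a x * 𝓕 b x := by
    intro a b ha hb
    have := VectorFourier.integral_fourierIntegral_smul_eq_flip (e := Real.fourierChar)
      (L := innerₗ ℝ) (μ := volume) (ν := volume) Real.continuous_fourierChar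
      continuous_inner ha hb
    simp only [smul_eq_mul, flip_innerₗ] at this
    exact this
  have hinvint : ∀ v : ℝ → ℂ, Integrable v → Continuous (𝓕⁻ v) := by
    intro v hv
    have h1 : Continuous (𝓕 v) :=
      VectorFourier.fourierIntegral_continuous Real.continuous_fourierChar continuous_inner hv
    have h2 : 𝓕⁻ v = fun x => 𝓕 v (-x) := by
      funext x; exact Real.fourierInv_eq_fourier_neg v x
    rw [h2]
    exact h1.comp continuous_neg
  refine ae_eq_of_integral_contDiff_smul_eq hu.locallyIntegrable
    (hinvint _ hu').locallyIntegrable fun φ hφ hφc => ?_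
  set φc : ℝ → ℂ := fun x => (φ x : ℂ)
  have hφc1 : ContDiff ℝ (⊤ : ℕ∞) φc := Complex.ofRealCLM.contDiff.comp hφ
  have hφc2 : HasCompactSupport φc := hφc.comp_left (g := fun x : ℝ => (x : ℂ)) (by simp)
  set Φ : SchwartzMap ℝ ℂ := hφc2.toSchwartzMap hφc1
  have hΦ : (Φ : ℝ → ℂ) = φc := by ext x; rfl
  have hinv : 𝓕 (𝓕⁻ φc) = φc := by
    have h1 : (𝓕 (𝓕⁻ Φ) : SchwartzMap ℝ ℂ) = Φ := by simp
    have h2 := congrArg (fun s : SchwartzMap ℝ ℂ => (s : ℝ → ℂ)) h1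
    simp only [SchwartzMap.fourier_coe, SchwartzMap.fourierInv_coe, hΦ] at h2
    exact h2
  have hψint : Integrable (𝓕⁻ φc) := by
    have h2 : ((𝓕⁻ Φ : SchwartzMap ℝ ℂ) : ℝ → ℂ) = 𝓕⁻ φc := by
      rw [SchwartzMap.fourierInv_coe, hΦ]
    rw [← h2]; exact (𝓕⁻ Φ).integrable
  have hφint : Integrable φc := by rw [← hΦ]; exact Φ.integrable
  have s1 : ∫ x, φ x • u x = ∫ x, u x * φc x :=
    integral_congr_ae (Eventually.of_forall fun x => by simp [φc, mul_comm])
  have s2 : ∫ x, φ x • 𝓕⁻ (𝓕 u) x = ∫ x, 𝓕⁻ (𝓕 u) x * φc x :=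
    integral_congr_ae (Eventually.of_forall fun x => by simp [φc, mul_comm])
  rw [s1, s2]
  have t1 : ∫ x, u x * φc x = ∫ ξ, 𝓕 u ξ * 𝓕⁻ φc ξ := by
    rw [hflip u (𝓕⁻ φc) hu hψint, hinv]
  rw [t1]
  have hneg : ∀ v : ℝ → ℂ, 𝓕⁻ v = fun x => 𝓕 v (-x) := fun v => by
    funext x; exact Real.fourierInv_eq_fourier_neg v x
  have t2 : ∫ x, 𝓕⁻ (𝓕 u) x * φc x = ∫ x, 𝓕 (𝓕 u) x * φc (-x) := by
    rw [hneg, ← integral_neg_eq_self]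
    simp
  have hφneg : Integrable fun x => φc (-x) := hφint.comp_neg
  rw [t2, hflip (𝓕 u) (fun x => φc (-x)) hu' hφneg]
  congr 1
  funext ξ
  congr 1
  rw [Real.fourierInv_eq_fourier_neg, Real.fourier_real_eq_integral_exp_smul, Real.fourier_real_eq_integral_exp_smul,
    ← integral_neg_eq_self]
  refine integral_congr_ae (Eventually.of_forall fun x => ?_)
  simp

end

section

variable {g h : ℝ → ℝ}

/-! ### Iterated convolutions -/

theorem convPow_succ_succ (h : ℝ → ℝ) (n : ℕ) (x : ℝ) :
    convPow h (n + 2) x = ∫ t, h t * convPow h (n + 1) (x - t) := rfl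

theorem integrable_convPow (hh : Integrable h) : ∀ n, Integrable (convPow h (n + 1))
  | 0 => hh
  | n + 1 => hh.integrable_convolution (ContinuousLinearMap.mul ℝ ℝ) (integrable_convPow hh n)

theorem convPow_nonneg (hh0 : ∀ x, 0 ≤ h x) : ∀ n x, 0 ≤ convPow h (n + 1) x
  | 0, x => hh0 x
  | n + 1, x => by
    rw [convPow_succ_succ]
    exact integral_nonneg fun t => mul_nonneg (hh0 t) (convPow_nonneg hh0 n (x - t))

open FourierTransform in
theorem cf_convolution {u v : ℝ → ℝ} (hu : Integrable u) (hv : Integrable v) (ξ : ℝ) :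
    cf (convolution u v (ContinuousLinearMap.mul ℝ ℝ) volume) ξ = cf u ξ * cf v ξ := by
  have hu' : Integrable fun x => (u x : ℂ) := hu.ofReal
  have hv' : Integrable fun x => (v x : ℂ) := hv.ofReal
  have key : (fun x => ((convolution u v (ContinuousLinearMap.mul ℝ ℝ) volume x : ℝ) : ℂ)) =
      convolution (fun x => (u x : ℂ)) (fun x => (v x : ℂ)) (ContinuousLinearMap.mul ℂ ℂ) volume := by
    funext x
    simp only [convolution, ContinuousLinearMap.mul_apply']
    rw [← integral_complex_ofReal]
    push_cast
    rfl
  rw [cf_eq_fourier, cf_eq_fourier, cf_eq_fourier, key, Real.fourier_mul_convolution_eq hu' hv']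

theorem cf_convPow (hh : Integrable h) (n : ℕ) (ξ : ℝ) :
    cf (convPow h (n + 1)) ξ = cf h ξ ^ (n + 1) := by
  induction n with
  | zero => rw [zero_add, pow_one]; rfl
  | succ n ih =>
    have := cf_convolution hh (integrable_convPow hh n) ξ
    rw [ih] at this
    rw [pow_succ']
    exact this

/-- The Fourier inversion integral of the `n`-th power of the Fourier transform of `h`. -/
def invCf (h : ℝ → ℝ) (n : ℕ) (x : ℝ) : ℂ :=
  (1 / (2 * Real.pi) : ℂ) * ∫ ξ : ℝ, cf h ξ ^ n * Complex.exp (Complex.I * ξ * x)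

theorem integrable_cf_pow (hh : Integrable h) {n : ℕ} (hn : Integrable fun ξ => ‖cf h ξ‖ ^ n) :
    Integrable fun ξ => cf h ξ ^ n := by
  refine Integrable.mono' hn ((continuous_cf hh).pow n).aestronglyMeasurable
    (Eventually.of_forall fun ξ => ?_)
  rw [norm_pow]

theorem integrable_cf_pow_mul (hh : Integrable h) {n : ℕ}
    (hn : Integrable fun ξ => ‖cf h ξ‖ ^ n) (x : ℝ) :
    Integrable fun ξ : ℝ => cf h ξ ^ n * Complex.exp (Complex.I * ξ * x) :=
  (integrable_cf_pow hh hn).mul_bdd (c := 1) (Continuous.aestronglyMeasurable (by fun_prop))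
    (Eventually.of_forall fun ξ => (norm_exp_I_mul ξ x).le)

open FourierTransform in
theorem convPow_ae_eq (hh : Integrable h) {n : ℕ} (hn : Integrable fun ξ => ‖cf h ξ‖ ^ (n + 1)) :
    ∀ᵐ x : ℝ, (convPow h (n + 1) x : ℂ) = invCf h (n + 1) x := by
  have hpi : (2 * Real.pi) ≠ 0 := by positivity
  set u : ℝ → ℂ := fun x => (convPow h (n + 1) x : ℂ)
  have hu : Integrable u := (integrable_convPow hh n).ofReal
  have hFu : 𝓕 u = fun w => cf h (2 * Real.pi * w) ^ (n + 1) := by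
    funext w
    have := cf_eq_fourier (convPow h (n + 1)) (2 * Real.pi * w)
    rw [mul_div_cancel_left₀ _ hpi, cf_convPow hh] at this
    exact this.symm
  have hFi : Integrable (𝓕 u) := by
    rw [hFu]
    exact (integrable_cf_pow hh hn).comp_mul_left' hpi
  filter_upwards [fourierInv_fourier_ae_eq hu hFi] with x hx
  change u x = _
  rw [hx, hFu, invCf, Real.fourierInv_eq_fourier_neg, Real.fourier_real_eq_integral_exp_smul]
  have e := Measure.integral_comp_mul_left
    (fun ξ : ℝ => cf h ξ ^ (n + 1) * Complex.exp (Complex.I * ξ * x)) (2 * Real.pi)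
  rw [abs_of_pos (by positivity)] at e
  have e2 : (1 / (2 * Real.pi) : ℂ) * ∫ ξ : ℝ, cf h ξ ^ (n + 1) * Complex.exp (Complex.I * ξ * x)
      = (2 * Real.pi)⁻¹ • ∫ ξ : ℝ, cf h ξ ^ (n + 1) * Complex.exp (Complex.I * ξ * x) := by
    rw [Complex.real_smul]; push_cast; rw [one_div]
  rw [e2, ← e]
  refine integral_congr_ae (Eventually.of_forall fun w => ?_)
  simp only [smul_eq_mul]
  rw [mul_comm]
  congr 2
  push_cast
  ring

theorem ae_comp_sub_left {p : ℝ → Prop} (hp : ∀ᵐ x : ℝ, p x) (x : ℝ) : ∀ᵐ t : ℝ, p (x - t) :=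
  (Measure.measurePreserving_sub_left volume x).quasiMeasurePreserving.ae hp

/-- One further convolution upgrades inversion from almost every point to every point: the
almost-everywhere formula for `n + 1` factors is inserted under an integral, and the multiplication
formula reassembles the power `n + 2`. -/
theorem convPow_eq_invCf (hh : Integrable h) {n : ℕ}
    (hn : Integrable fun ξ => ‖cf h ξ‖ ^ (n + 1)) (x : ℝ) :
    (convPow h (n + 2) x : ℂ) = invCf h (n + 2) x := by
  have hae := ae_comp_sub_left (convPow_ae_eq hh hn) x
  have hW := integrable_cf_pow_mul hh hn x
  have h1 := integral_cf_mul hh hW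
  have e1 : ∫ ξ : ℝ, cf h ξ * (cf h ξ ^ (n + 1) * Complex.exp (Complex.I * ξ * x)) =
      ∫ ξ : ℝ, cf h ξ ^ (n + 2) * Complex.exp (Complex.I * ξ * x) := by
    congr 1; funext ξ; ring
  rw [invCf, ← e1, h1, convPow_succ_succ, ← integral_complex_ofReal, ← integral_const_mul]
  refine integral_congr_ae ?_
  filter_upwards [hae] with t ht
  rw [Complex.ofReal_mul, ht, invCf]
  have e2 : ∫ ξ : ℝ, cf h ξ ^ (n + 1) * Complex.exp (Complex.I * ξ * ((x - t : ℝ) : ℂ)) =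
      ∫ ξ : ℝ, Complex.exp (-(Complex.I * ξ * t)) *
        (cf h ξ ^ (n + 1) * Complex.exp (Complex.I * ξ * x)) := by
    congr 1; funext ξ
    rw [mul_left_comm, ← Complex.exp_add]
    congr 2
    push_cast; ring
  rw [e2]
  ring

theorem norm_invCf_le (h : ℝ → ℝ) (n : ℕ) (x : ℝ) :
    ‖invCf h n x‖ ≤ 1 / (2 * Real.pi) * ∫ ξ, ‖cf h ξ‖ ^ n := by
  rw [invCf, norm_mul]
  have : ‖(1 / (2 * Real.pi) : ℂ)‖ = 1 / (2 * Real.pi) := by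
    have := Complex.norm_real (1 / (2 * Real.pi))
    push_cast at this
    rw [this, Real.norm_of_nonneg (by positivity)]
  rw [this]
  gcongr
  refine (norm_integral_le_integral_norm _).trans (le_of_eq ?_)
  congr 1; funext ξ
  rw [norm_mul, norm_exp_I_mul, mul_one, norm_pow]

/-- The iterated convolution with values in `[0, ∞]`; `lconvPow h n` has `n + 1` factors. -/
def lconvPow (h : ℝ → ℝ) : ℕ → ℝ → ENNReal
  | 0 => fun x => ENNReal.ofReal (h x)
  | n + 1 => fun x => ∫⁻ t, ENNReal.ofReal (h t) * lconvPow h n (x - t)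

theorem lconvPow_succ_eq (hh0 : ∀ x, 0 ≤ h x) {n : ℕ} {x : ℝ}
    (hae : ∀ᵐ x, lconvPow h n x = ENNReal.ofReal (convPow h (n + 1) x))
    (hi : Integrable fun t => h t * convPow h (n + 1) (x - t)) :
    lconvPow h (n + 1) x = ENNReal.ofReal (convPow h (n + 2) x) := by
  rw [convPow_succ_succ, ofReal_integral_eq_lintegral_ofReal hi (Eventually.of_forall fun t =>
    mul_nonneg (hh0 t) (convPow_nonneg hh0 n (x - t)))]
  refine lintegral_congr_ae ?_
  filter_upwards [ae_comp_sub_left hae x] with t ht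
  rw [ht, ENNReal.ofReal_mul (hh0 t)]

/-- Only almost everywhere: where the convolution integral diverges, `convPow` takes the value `0`
while `lconvPow` is infinite. -/
theorem lconvPow_ae_eq (hh : Integrable h) (hh0 : ∀ x, 0 ≤ h x) (n : ℕ) :
    ∀ᵐ x, lconvPow h n x = ENNReal.ofReal (convPow h (n + 1) x) := by
  induction n with
  | zero => exact Eventually.of_forall fun x => rfl
  | succ n ih =>
    have := hh.ae_convolution_exists (ContinuousLinearMap.mul ℝ ℝ) (integrable_convPow hh n)
    filter_upwards [this] with x hx
    exact lconvPow_succ_eq hh0 ih hx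

/-- When the `(n+1)`-st power of the transform is integrable, `convPow h (n + 1)` is almost
everywhere bounded, so the next convolution integral converges at every `x`. -/
theorem lconvPow_eq (hh : Integrable h) (hh0 : ∀ x, 0 ≤ h x) {n : ℕ}
    (hn : Integrable fun ξ => ‖cf h ξ‖ ^ (n + 1)) (x : ℝ) :
    lconvPow h (n + 1) x = ENNReal.ofReal (convPow h (n + 2) x) := by
  refine lconvPow_succ_eq hh0 (lconvPow_ae_eq hh hh0 n) ?_
  refine hh.mul_bdd (c := 1 / (2 * Real.pi) * ∫ ξ, ‖cf h ξ‖ ^ (n + 1)) ?_ ?_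
  · exact ((integrable_convPow hh n).comp_sub_left x).aestronglyMeasurable
  · filter_upwards [ae_comp_sub_left (convPow_ae_eq hh hn) x] with t ht
    rw [← Complex.norm_real, ht]
    exact norm_invCf_le h _ _

end

section

variable {α σ E : ℝ} {h : ℝ → ℝ}

/-! ### The stable exponent -/

theorem stableExponent_re (σ α ξ : ℝ) : (stableExponent σ α 1 ξ).re = σ * |ξ| ^ α := by
  unfold stableExponent
  rw [Complex.re_ofReal_mul, Complex.add_re, Complex.one_re, Complex.re_mul_ofReal, Complex.I_re,
    zero_mul, add_zero, mul_one]

theorem norm_stableExponent_sq_le (σ α ξ : ℝ) :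
    ‖stableExponent σ α 1 ξ‖ ^ 2 ≤
      (σ * |ξ| ^ α) ^ 2 * (1 + Real.tan (Real.pi * α / 2) ^ 2) := by
  unfold stableExponent
  rw [norm_mul, mul_pow, Complex.norm_real, Real.norm_eq_abs, sq_abs]
  refine mul_le_mul_of_nonneg_left ?_ (sq_nonneg _)
  rw [← Complex.normSq_eq_norm_sq, Complex.normSq_apply]
  have : Real.sign ξ ^ 2 ≤ 1 := by
    rcases Real.sign_apply_eq ξ with h | h | h <;> simp [h]
  simp only [Complex.add_re, Complex.one_re, Complex.mul_re, Complex.I_re, Complex.I_im,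
    Complex.ofReal_re, Complex.ofReal_im, Complex.add_im, Complex.one_im, Complex.mul_im]
  nlinarith [sq_nonneg (Real.tan (Real.pi * α / 2))]

theorem stableExponent_mul (σ α ξ : ℝ) {c : ℝ} (hc : 0 < c) :
    stableExponent σ α 1 (c * ξ) = ((c ^ α : ℝ) : ℂ) * stableExponent σ α 1 ξ := by
  unfold stableExponent
  rw [abs_mul, abs_of_pos hc, Real.mul_rpow hc.le (abs_nonneg _)]
  have : Real.sign (c * ξ) = Real.sign ξ := by
    rcases lt_trichotomy ξ 0 with h | h | h
    · rw [Real.sign_of_neg h, Real.sign_of_neg (mul_neg_of_pos_of_neg hc h)]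
    · rw [h, mul_zero]
    · rw [Real.sign_of_pos h, Real.sign_of_pos (mul_pos hc h)]
  rw [this]
  push_cast
  ring

theorem measurable_stableExponent (σ α : ℝ) : Measurable (stableExponent σ α 1) := by
  have h : Measurable Real.sign := by
    unfold Real.sign
    exact Measurable.ite measurableSet_Iio measurable_const
      (Measurable.ite measurableSet_Ioi measurable_const measurable_const)
  unfold stableExponent
  fun_prop

theorem integrable_rpow_mul_exp_abs {c s : ℝ} (hα : 0 < α) (hc : 0 < c) (hs : 0 ≤ s) :
    Integrable fun y : ℝ => |y| ^ s * Real.exp (-(c * |y| ^ α)) := by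
  set F : ℝ → ℝ := fun y => |y| ^ s * Real.exp (-(c * |y| ^ α))
  have h0 : IntegrableOn F (Ioi 0) := by
    refine (integrableOn_rpow_mul_exp_neg_mul_rpow (p := α) (s := s) (b := c) (by linarith)
      hα hc).congr_fun (fun y hy => ?_) measurableSet_Ioi
    simp only [F, abs_of_pos hy.out, neg_mul]
  have h1 : Integrable ((Ioi (0 : ℝ)).indicator F) := (integrable_indicator_iff measurableSet_Ioi).mpr h0
  refine (h1.add h1.comp_neg).congr ?_
  have hne : ∀ᵐ y : ℝ, y ≠ 0 := by simp [ae_iff, measure_singleton]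
  filter_upwards [hne] with y hy
  simp only [Pi.add_apply]
  rcases lt_or_gt_of_ne hy with h | h
  · rw [indicator_of_notMem (by simpa using h.le), indicator_of_mem (by simpa using h)]
    simp [F]
  · rw [indicator_of_mem (by simpa using h), indicator_of_notMem (by simpa using h.le)]
    simp [F]

theorem norm_exp_neg_mul_stableExponent (σ α ξ r : ℝ) :
    ‖Complex.exp (-((r : ℂ) * stableExponent σ α 1 ξ))‖ = Real.exp (-(r * (σ * |ξ| ^ α))) := by
  rw [Complex.norm_exp, Complex.neg_re, Complex.re_ofReal_mul, stableExponent_re]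

theorem integrable_exp_neg_stableExponent (hσ : 0 < σ) (hα : 0 < α) {r : ℝ} (hr : 0 < r) :
    Integrable fun ξ : ℝ => Complex.exp (-((r : ℂ) * stableExponent σ α 1 ξ)) := by
  have h1 := integrable_rpow_mul_exp_abs (s := 0) (c := r * σ) hα (by positivity) le_rfl
  refine Integrable.mono' h1 ?_ (Eventually.of_forall fun ξ => ?_)
  · have := measurable_stableExponent σ α
    exact Measurable.aestronglyMeasurable (by fun_prop)
  · rw [norm_exp_neg_mul_stableExponent, Real.rpow_zero, one_mul, mul_assoc]

/-! ### Reduction to the Fourier side -/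

/-- The centred Fourier transform `exp (iξE) ∫ exp (-iξx) h(x) dx`. -/
def centredCf (h : ℝ → ℝ) (E ξ : ℝ) : ℂ := Complex.exp (Complex.I * ξ * E) * cf h ξ

theorem norm_centredCf (h : ℝ → ℝ) (E ξ : ℝ) : ‖centredCf h E ξ‖ = ‖cf h ξ‖ := by
  rw [centredCf, norm_mul, norm_exp_I_mul, one_mul]

theorem centredCf_eq (h : ℝ → ℝ) (E σ α ξ : ℝ) :
    centredCf h E ξ = 1 - stableExponent σ α 1 ξ + remainderFn h E σ α ξ := by
  rw [remainderFn_eq, centredCf]; ring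

theorem continuous_centredCf (hh : Integrable h) (E : ℝ) : Continuous (centredCf h E) := by
  have := continuous_cf hh
  unfold centredCf
  fun_prop

theorem stableDensity_scaled (hα : 0 < α) {N : ℕ} (hN : 1 ≤ N) (y : ℝ) :
    ((stableDensity σ α 1 (y / (N : ℝ) ^ (1 / α)) / (N : ℝ) ^ (1 / α) : ℝ) : ℂ) =
      (1 / (2 * Real.pi) : ℂ) * ∫ ξ : ℝ, Complex.exp (-((N : ℝ) * stableExponent σ α 1 ξ)) *
        Complex.exp (Complex.I * ξ * y) := by
  have hN0 : (0 : ℝ) < N := by exact_mod_cast hN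
  set c := (N : ℝ) ^ (1 / α)
  have hc : 0 < c := Real.rpow_pos_of_pos hN0 _
  have hcα : c ^ α = N := by
    rw [← Real.rpow_mul hN0.le, one_div, inv_mul_cancel₀ hα.ne', Real.rpow_one]
  have hcc : (c : ℂ) ≠ 0 := by exact_mod_cast hc.ne'
  rw [Complex.ofReal_div, stableDensity_eq]
  have e := Measure.integral_comp_mul_left (fun ξ : ℝ => stableHat σ α 1 ξ *
    Complex.exp (Complex.I * ξ * ((y / c : ℝ) : ℂ))) c
  rw [abs_of_pos (inv_pos.mpr hc), Complex.real_smul] at e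
  have e2 : ∀ ξ : ℝ, stableHat σ α 1 (c * ξ) *
      Complex.exp (Complex.I * ((c * ξ : ℝ) : ℂ) * ((y / c : ℝ) : ℂ)) =
      Complex.exp (-((N : ℝ) * stableExponent σ α 1 ξ)) * Complex.exp (Complex.I * ξ * y) := by
    intro ξ
    rw [stableHat, stableExponent_mul _ _ _ hc, hcα]
    congr 2
    push_cast
    field_simp
  simp_rw [e2] at e
  rw [e, Complex.ofReal_inv]
  ring

/-- The translation by `NE` becomes the phase `e^{iξNE}`, absorbed in the centred transform. The
bound `k + 1 ≤ N` leaves the one spare factor that pointwise inversion requires; the constant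
`1/(2π)` is estimated by `1`. -/
theorem abs_convPow_sub_le (hh : Integrable h) (hh0 : ∀ x, 0 ≤ h x) (hh1 : ∫ x, h x = 1)
    (hσ : 0 < σ) (hα : 0 < α) {k : ℕ} (hk1 : 1 ≤ k) (hk : Integrable fun ξ => ‖cf h ξ‖ ^ k)
    {N : ℕ} (hN : k + 1 ≤ N) (x : ℝ) :
    |convPow h N x - stableDensity σ α 1 ((x - N * E) / (N : ℝ) ^ (1 / α)) / (N : ℝ) ^ (1 / α)| ≤
      ∫ ξ, ‖centredCf h E ξ ^ N - Complex.exp (-((N : ℝ) * stableExponent σ α 1 ξ))‖ := by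
  obtain ⟨n, rfl⟩ : ∃ n, N = n + 2 := ⟨N - 2, by omega⟩
  have hn1 : Integrable fun ξ => ‖cf h ξ‖ ^ (n + 1) :=
    integrable_norm_cf_pow_of_le hh hh0 hh1 (by omega) hk
  have hn2 : Integrable fun ξ => ‖cf h ξ‖ ^ (n + 2) :=
    integrable_norm_cf_pow_of_le hh hh0 hh1 (by omega) hk
  have hNpos : (0 : ℝ) < ((n + 2 : ℕ) : ℝ) := by positivity
  set N := n + 2
  set y := x - N * E
  have hint1 : Integrable fun ξ : ℝ => centredCf h E ξ ^ N * Complex.exp (Complex.I * ξ * y) := by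
    refine Integrable.mono' hn2 ?_ (Eventually.of_forall fun ξ => ?_)
    · have := continuous_centredCf hh E
      exact Continuous.aestronglyMeasurable (by fun_prop)
    · rw [norm_mul, norm_exp_I_mul, mul_one, norm_pow, norm_centredCf]
  have hint2 : Integrable fun ξ : ℝ => Complex.exp (-((N : ℝ) * stableExponent σ α 1 ξ)) *
      Complex.exp (Complex.I * ξ * y) :=
    (integrable_exp_neg_stableExponent hσ hα hNpos).mul_bdd (c := 1)
      (Continuous.aestronglyMeasurable (by fun_prop))
      (Eventually.of_forall fun ξ => (norm_exp_I_mul ξ y).le)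
  have e1 : (convPow h N x : ℂ) = (1 / (2 * Real.pi) : ℂ) *
      ∫ ξ : ℝ, centredCf h E ξ ^ N * Complex.exp (Complex.I * ξ * y) := by
    rw [convPow_eq_invCf hh hn1, invCf]
    congr 2
    funext ξ
    rw [centredCf, mul_pow, ← Complex.exp_nat_mul, mul_comm (Complex.exp _) (cf h ξ ^ N),
      mul_assoc (cf h ξ ^ N),
      ← Complex.exp_add]
    congr 2
    simp only [y]
    push_cast
    ring
  have e2 := stableDensity_scaled (σ := σ) hα (N := N) (by omega) y
  rw [← Real.norm_eq_abs, ← Complex.norm_real, Complex.ofReal_sub, e1, e2, ← mul_sub,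
    ← integral_sub hint1 hint2, norm_mul]
  have h2pi : ‖(1 / (2 * Real.pi) : ℂ)‖ ≤ 1 := by
    have := Complex.norm_real (1 / (2 * Real.pi))
    push_cast at this
    rw [this, Real.norm_of_nonneg (by positivity), div_le_one (by positivity)]
    linarith [Real.pi_gt_three]
  refine (mul_le_of_le_one_left (norm_nonneg _) h2pi).trans ?_
  refine (norm_integral_le_integral_norm _).trans (le_of_eq ?_)
  congr 1
  funext ξ
  rw [← sub_mul, norm_mul, norm_exp_I_mul, mul_one]

/-! ### Bounds on the characteristic function -/

theorem exp_neg_le_one_sub_half {v : ℝ} (h0 : 0 ≤ v) (h1 : v ≤ 1) : Real.exp (-v) ≤ 1 - v / 2 := by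
  have h2 : (1 - v / 2) * (1 + v) ≥ 1 := by nlinarith
  have h3 := Real.add_one_le_exp v
  rw [Real.exp_neg, inv_le_iff_one_le_mul₀ (Real.exp_pos v)]
  nlinarith

/-- With `u = σ|ξ|^α`, write `ψ = e^{-S} - expRem S + η`. Then `‖ψ‖ ≤ e^{-u} + u²T + u/4`, and `uT ≤
1/8` makes this at most `1 - u/2 ≤ e^{-u/2}`. The thresholds `σ/4` and `1/(8T)` are set for this
budget. -/
theorem exists_norm_centredCf_le (hσ : 0 < σ) (hα : 0 < α)
    (ht : Tendsto (fun ξ : ℝ => ‖remainderFn h E σ α ξ‖ / |ξ| ^ α) (𝓝[≠] 0) (𝓝 0))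
    (hh0 : ∀ x, 0 ≤ h x) (hh1 : ∫ x, h x = 1) :
    ∃ δ, 0 < δ ∧ δ ≤ 1 ∧ ∀ ξ, |ξ| ≤ δ → ‖cf h ξ‖ ≤ Real.exp (-(σ * |ξ| ^ α / 2)) := by
  set T := 1 + Real.tan (Real.pi * α / 2) ^ 2
  have hT : 1 ≤ T := by simp only [T]; nlinarith [sq_nonneg (Real.tan (Real.pi * α / 2))]
  have hev : ∀ᶠ ξ in 𝓝[≠] (0 : ℝ), ‖remainderFn h E σ α ξ‖ / |ξ| ^ α < σ / 4 :=
    ht.eventually (gt_mem_nhds (by positivity))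
  have hcont : Tendsto (fun ξ : ℝ => σ * |ξ| ^ α) (𝓝 0) (𝓝 0) := by
    have : ContinuousAt (fun ξ : ℝ => σ * |ξ| ^ α) 0 :=
      continuousAt_const.mul (continuous_abs.continuousAt.rpow_const (Or.inr hα.le))
    have h := this.tendsto
    simp only [abs_zero, Real.zero_rpow hα.ne', mul_zero] at h
    exact h
  have hev2 : ∀ᶠ ξ in 𝓝 (0 : ℝ), σ * |ξ| ^ α < 1 / (8 * T) :=
    hcont.eventually (gt_mem_nhds (by positivity))
  rw [eventually_nhdsWithin_iff] at hev
  obtain ⟨δ, hδ, hb⟩ := Metric.eventually_nhds_iff.mp (hev.and hev2)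
  refine ⟨min (δ / 2) 1, lt_min (half_pos hδ) one_pos, min_le_right _ _, fun ξ hξ => ?_⟩
  rcases eq_or_ne ξ 0 with rfl | hξ0
  · rw [abs_zero, Real.zero_rpow hα.ne', mul_zero, zero_div, neg_zero, Real.exp_zero, ← hh1]
    exact norm_cf_le hh0 0
  have hlt : dist ξ 0 < δ := by
    rw [Real.dist_eq, sub_zero]
    linarith [hξ.trans (min_le_left _ _)]
  obtain ⟨h1, h2⟩ := hb hlt
  have hp : 0 < |ξ| ^ α := Real.rpow_pos_of_pos (abs_pos.mpr hξ0) α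
  have h1' := h1 hξ0
  rw [div_lt_iff₀ hp] at h1'
  set u := σ * |ξ| ^ α with hu
  have hu0 : 0 < u := by positivity
  have huT : u * T ≤ 1 / 8 := by
    rw [lt_div_iff₀ (by positivity)] at h2
    nlinarith
  have hu1 : u ≤ 1 / 8 := by nlinarith
  set S := stableExponent σ α 1 ξ
  have hSre : S.re = u := stableExponent_re σ α ξ
  have hS2 : ‖S‖ ^ 2 ≤ u ^ 2 * T := norm_stableExponent_sq_le σ α ξ
  have hexpS : ‖Complex.exp (-S)‖ = Real.exp (-u) := by
    rw [Complex.norm_exp, Complex.neg_re, hSre]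
  have hrem := norm_expRem_le_sq (z := S) (by rw [hSre]; exact hu0.le)
  have hexp : Real.exp (-u) ≤ 1 - u + u ^ 2 := by
    have := Real.abs_exp_sub_one_sub_id_le (x := -u) (by rw [abs_neg, abs_of_pos hu0]; linarith)
    have := (le_abs_self _).trans this
    nlinarith
  rw [← norm_centredCf h E, centredCf_eq h E σ α]
  change ‖1 - S + _‖ ≤ _
  have hdec : (1 : ℂ) - S + remainderFn h E σ α ξ =
      Complex.exp (-S) - expRem S + remainderFn h E σ α ξ := by unfold expRem; ring
  rw [hdec]
  have h3 : ‖Complex.exp (-S) - expRem S + remainderFn h E σ α ξ‖ ≤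
      Real.exp (-u) + ‖S‖ ^ 2 + σ / 4 * |ξ| ^ α := by
    refine (norm_add_le _ _).trans (add_le_add ((norm_sub_le _ _).trans ?_) h1'.le)
    rw [hexpS]
    gcongr
  have h4 : σ / 4 * |ξ| ^ α = u / 4 := by rw [hu]; ring
  have h5 := Real.add_one_le_exp (-(u / 2))
  have h6 : u ^ 2 * T ≤ u / 8 := by nlinarith
  have h7 : u ^ 2 ≤ u / 8 := by nlinarith
  rw [h4] at h3
  linarith

/-- Near the origin the modulus is at most `e^{-σ b^α/2} ≤ 1 - σ b^α/4`, and `b^{2+τ} ≤ σ b^α/4` for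
small `b` because `α < 2`. Further out the uniform gap `κ` beats `b^{2+τ}`. No lower-order
correction is needed, which is why `φ_τ = 0` works later. -/
theorem eventually_norm_cf_le (hσ : 0 < σ) (hα : 0 < α) (hα₂ : α < 2)
    (ht : Tendsto (fun ξ : ℝ => ‖remainderFn h E σ α ξ‖ / |ξ| ^ α) (𝓝[≠] 0) (𝓝 0))
    (hh : Integrable h) (hh0 : ∀ x, 0 ≤ h x) (hh1 : ∫ x, h x = 1) {τ : ℝ} (hτ : 0 < τ) :
    ∀ᶠ b in 𝓝[>] (0 : ℝ), ∀ ξ, b ≤ |ξ| → ‖cf h ξ‖ ≤ 1 - b ^ (2 + τ) := by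
  obtain ⟨δ, hδ, hδ1, hnear⟩ := exists_norm_centredCf_le (E := E) hσ hα ht hh0 hh1
  obtain ⟨κ, hκ, hfar⟩ := exists_norm_cf_le hh hh0 hh1 hδ
  have t1 : ∀ᶠ b in 𝓝[>] (0 : ℝ), 1 * b ^ (2 + τ) < κ :=
    (tendsto_rpow_nhdsGT_zero (by linarith) 1).eventually (gt_mem_nhds hκ)
  have t2 : ∀ᶠ b in 𝓝[>] (0 : ℝ), 1 * b ^ (2 + τ - α) < σ / 4 :=
    (tendsto_rpow_nhdsGT_zero (by linarith) 1).eventually (gt_mem_nhds (by positivity))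
  have t3 : ∀ᶠ b in 𝓝[>] (0 : ℝ), σ / 2 * b ^ α < 1 :=
    (tendsto_rpow_nhdsGT_zero hα (σ / 2)).eventually (gt_mem_nhds one_pos)
  filter_upwards [t1, t2, t3, self_mem_nhdsWithin] with b h1 h2 h3 hb ξ hξ
  have hb0 : 0 < b := hb
  rw [one_mul] at h1 h2
  rcases le_total |ξ| δ with hle | hge
  · have hbα : b ^ α ≤ |ξ| ^ α := Real.rpow_le_rpow hb0.le hξ hα.le
    have hbp : 0 < b ^ α := Real.rpow_pos_of_pos hb0 _
    have e1 : b ^ (2 + τ) = b ^ (2 + τ - α) * b ^ α := by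
      rw [← Real.rpow_add hb0, sub_add_cancel]
    calc ‖cf h ξ‖ ≤ Real.exp (-(σ * |ξ| ^ α / 2)) := hnear ξ hle
      _ ≤ Real.exp (-(σ / 2 * b ^ α)) := by
        apply Real.exp_le_exp.mpr
        nlinarith
      _ ≤ 1 - (σ / 2 * b ^ α) / 2 := exp_neg_le_one_sub_half (by positivity) h3.le
      _ ≤ _ := by rw [e1]; nlinarith
  · linarith [hfar ξ hge]

theorem norm_pow_sub_pow_le' {a c : ℂ} {m : ℝ} (ha : ‖a‖ ≤ m) (hc : ‖c‖ ≤ m) (n : ℕ) :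
    ‖a ^ (n + 1) - c ^ (n + 1)‖ ≤ (n + 1) * ‖a - c‖ * m ^ n := by
  have hm : 0 ≤ m := (norm_nonneg a).trans ha
  induction n with
  | zero => simp
  | succ n ih =>
    have e : a ^ (n + 1 + 1) - c ^ (n + 1 + 1) =
        a * (a ^ (n + 1) - c ^ (n + 1)) + (a - c) * c ^ (n + 1) := by ring
    rw [e]
    calc _ ≤ ‖a‖ * ‖a ^ (n + 1) - c ^ (n + 1)‖ + ‖a - c‖ * ‖c‖ ^ (n + 1) := by
          refine (norm_add_le _ _).trans ?_
          rw [norm_mul, norm_mul, norm_pow]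
      _ ≤ m * ((n + 1) * ‖a - c‖ * m ^ n) + ‖a - c‖ * m ^ (n + 1) := by gcongr
      _ = _ := by push_cast; ring

end

section

variable {α σ E : ℝ} {h : ℝ → ℝ}

/-! ### The local limit theorem with explicit error -/

theorem omegaFn_nonneg (η : ℝ → ℂ) (α b : ℝ) : 0 ≤ omegaFn η α b :=
  Real.sSup_nonneg (by rintro _ ⟨ξ, -, rfl⟩; positivity)

theorem le_omegaFn {η : ℝ → ℂ} {α M : ℝ} (hM : ∀ ξ, ‖η ξ‖ / |ξ| ^ α ≤ M) {b ξ : ℝ}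
    (hξ : |ξ| ≤ b) : ‖η ξ‖ / |ξ| ^ α ≤ omegaFn η α b :=
  le_csSup ⟨M, by rintro _ ⟨ξ, -, rfl⟩; exact hM ξ⟩ ⟨ξ, abs_le.mp hξ, rfl⟩

theorem tendsto_omegaFn {η : ℝ → ℂ} {α : ℝ} (hα : 0 < α)
    (ht : Tendsto (fun ξ : ℝ => ‖η ξ‖ / |ξ| ^ α) (𝓝[≠] 0) (𝓝 0)) :
    Tendsto (omegaFn η α) (𝓝[>] 0) (𝓝 0) := by
  rw [Metric.tendsto_nhds]
  intro ε hε
  have h1 : ∀ᶠ ξ in 𝓝[≠] (0 : ℝ), ‖η ξ‖ / |ξ| ^ α < ε / 2 :=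
    ht.eventually (gt_mem_nhds (half_pos hε))
  rw [eventually_nhdsWithin_iff] at h1
  obtain ⟨δ, hδ, hb⟩ := Metric.eventually_nhds_iff.mp h1
  have h2 : ∀ᶠ b in 𝓝[>] (0 : ℝ), b < δ := nhdsWithin_le_nhds (Iio_mem_nhds hδ)
  filter_upwards [h2] with b hbδ
  rw [Real.dist_eq, sub_zero, abs_of_nonneg (omegaFn_nonneg η α b)]
  refine lt_of_le_of_lt (Real.sSup_le ?_ (half_pos hε).le) (half_lt_self hε)
  rintro _ ⟨ξ, hξ, rfl⟩
  rcases eq_or_ne ξ 0 with rfl | hne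
  · simp only [abs_zero, Real.zero_rpow hα.ne', div_zero]
    exact (half_pos hε).le
  · refine (hb (y := ξ) ?_ hne).le
    rw [Real.dist_eq, sub_zero]
    exact lt_of_le_of_lt (abs_le.mpr hξ) hbδ

/-- The common integrable profile of the near-field error. -/
def nearProfile (σ α y : ℝ) : ℝ := |y| ^ α * Real.exp (-(σ / 4 * |y| ^ α))

/-- The profile of the stable tail. -/
def tailProfile (σ α y : ℝ) : ℝ := Real.exp (-(σ / 2 * |y| ^ α))

theorem abs_scale_rpow (hα : 0 < α) {N : ℕ} (ξ : ℝ) :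
    |(N : ℝ) ^ (1 / α) * ξ| ^ α = N * |ξ| ^ α := by
  have hN0 : (0 : ℝ) ≤ N := Nat.cast_nonneg N
  rw [abs_mul, abs_of_nonneg (Real.rpow_nonneg hN0 _), Real.mul_rpow (Real.rpow_nonneg hN0 _)
    (abs_nonneg _), ← Real.rpow_mul hN0, one_div, inv_mul_cancel₀ hα.ne', Real.rpow_one]

/-- Telescoping gives `N ‖ψ - e^{-S}‖ m^{N-1}`. The difference is `η - expRem S`, of size `|ξ|^α`
times a small factor, and `N|ξ|^α = |y|^α` for `y = N^{1/α} ξ`. -/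
theorem norm_sub_le_of_near (hσ : 0 < σ) (hα : 0 < α) {M δ b : ℝ}
    (hM : ∀ ξ, ‖remainderFn h E σ α ξ‖ / |ξ| ^ α ≤ M)
    (hδ : ∀ ξ, |ξ| ≤ δ → ‖cf h ξ‖ ≤ Real.exp (-(σ * |ξ| ^ α / 2))) (hb : b ≤ δ)
    {N : ℕ} (hN : 2 ≤ N) {ξ : ℝ} (hξ : |ξ| ≤ b) (hξ0 : ξ ≠ 0) :
    ‖centredCf h E ξ ^ N - Complex.exp (-((N : ℝ) * stableExponent σ α 1 ξ))‖ ≤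
      (1 + σ) * (omegaFn (remainderFn h E σ α) α b +
        2 * σ * b ^ α * (1 + Real.tan (Real.pi * α / 2) ^ 2)) *
        nearProfile σ α ((N : ℝ) ^ (1 / α) * ξ) := by
  obtain ⟨n, rfl⟩ : ∃ n, N = n + 1 := ⟨N - 1, by omega⟩
  have hp : 0 < |ξ| ^ α := Real.rpow_pos_of_pos (abs_pos.mpr hξ0) α
  have hpb : |ξ| ^ α ≤ b ^ α := Real.rpow_le_rpow (abs_nonneg _) hξ hα.le
  have hbα : 0 ≤ b ^ α := hp.le.trans hpb
  set T := 1 + Real.tan (Real.pi * α / 2) ^ 2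
  have hT : 0 ≤ T := by positivity
  set w := omegaFn (remainderFn h E σ α) α b
  have hw : 0 ≤ w := omegaFn_nonneg _ _ _
  set S := stableExponent σ α 1 ξ
  set m := Real.exp (-(σ * |ξ| ^ α / 2))
  have hSre : S.re = σ * |ξ| ^ α := stableExponent_re σ α ξ
  have ha : ‖centredCf h E ξ‖ ≤ m := by
    rw [norm_centredCf]; exact hδ ξ (hξ.trans hb)
  have hc : ‖Complex.exp (-S)‖ ≤ m := by
    rw [Complex.norm_exp, Complex.neg_re, hSre]
    apply Real.exp_le_exp.mpr
    nlinarith [mul_pos hσ hp]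
  have hexp : Complex.exp (-(((n + 1 : ℕ) : ℝ) * S)) = Complex.exp (-S) ^ (n + 1) := by
    rw [← Complex.exp_nat_mul]
    congr 1
    push_cast; ring
  have hdiff : ‖centredCf h E ξ - Complex.exp (-S)‖ ≤ (1 + σ) * (w + 2 * σ * b ^ α * T) * |ξ| ^ α := by
    have e : centredCf h E ξ - Complex.exp (-S) = remainderFn h E σ α ξ - expRem S := by
      rw [centredCf_eq h E σ α, expRem]; ring
    rw [e]
    have h1 : ‖remainderFn h E σ α ξ‖ ≤ w * |ξ| ^ α := by
      have := le_omegaFn hM hξ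
      rwa [div_le_iff₀ hp] at this
    have h2 : ‖expRem S‖ ≤ (σ * |ξ| ^ α) ^ 2 * T :=
      (norm_expRem_le_sq (by rw [hSre]; positivity)).trans (norm_stableExponent_sq_le σ α ξ)
    have h3 : (σ * |ξ| ^ α) ^ 2 * T ≤ σ * (σ * b ^ α * T) * |ξ| ^ α := by
      have : (σ * |ξ| ^ α) ^ 2 * T = σ * (σ * |ξ| ^ α * T) * |ξ| ^ α := by ring
      rw [this]; gcongr
    refine (norm_sub_le _ _).trans ((add_le_add h1 (h2.trans h3)).trans ?_)
    have hB : 0 ≤ σ * b ^ α * T := by positivity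
    rw [← add_mul]
    refine mul_le_mul_of_nonneg_right ?_ hp.le
    nlinarith [mul_nonneg hσ.le hw, mul_nonneg hσ.le hB]
  rw [hexp, nearProfile, abs_scale_rpow hα]
  refine (norm_pow_sub_pow_le' ha hc n).trans ?_
  -- Here `n = N - 1 ≥ N/2` since `N ≥ 2`, which is how the rate `σ/2` becomes the `σ/4` of
  -- `nearProfile`.
  have hmn : m ^ n ≤ Real.exp (-(σ / 4 * (((n + 1 : ℕ) : ℝ) * |ξ| ^ α))) := by
    rw [← Real.exp_nat_mul]
    apply Real.exp_le_exp.mpr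
    have hn : (1 : ℝ) ≤ n := by exact_mod_cast (by omega : 1 ≤ n)
    push_cast
    nlinarith [mul_nonneg (mul_pos hσ hp).le (sub_nonneg.mpr hn)]
  calc _ ≤ (n + 1) * ((1 + σ) * (w + 2 * σ * b ^ α * T) * |ξ| ^ α) *
        Real.exp (-(σ / 4 * (((n + 1 : ℕ) : ℝ) * |ξ| ^ α))) := by gcongr
    _ = _ := by push_cast; ring

/-- Half of the stable exponent is spent on the small prefactor and half kept for integrability.
Likewise `k` of the `N` factors of `‖ψ‖` are kept integrable and the rest bounded by the gap. -/
theorem norm_sub_le_of_far (hσ : 0 < σ) (hα : 0 < α) {b β : ℝ} (hb : 0 < b)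
    (hfar : ∀ ξ, b ≤ |ξ| → ‖cf h ξ‖ ≤ 1 - β) {k N : ℕ} (hkN : k ≤ N)
    {ξ : ℝ} (hξ : b ≤ |ξ|) :
    ‖centredCf h E ξ ^ N - Complex.exp (-((N : ℝ) * stableExponent σ α 1 ξ))‖ ≤
      Real.exp (-(σ * N * b ^ α / 2)) * tailProfile σ α ((N : ℝ) ^ (1 / α) * ξ) +
        (1 - β) ^ (N - k) * ‖cf h ξ‖ ^ k := by
  have hpb : b ^ α ≤ |ξ| ^ α := Real.rpow_le_rpow hb.le hξ hα.le
  refine (norm_sub_le _ _).trans ?_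
  rw [add_comm]
  refine add_le_add ?_ ?_
  · rw [norm_exp_neg_mul_stableExponent, tailProfile, abs_scale_rpow hα, ← Real.exp_add]
    apply Real.exp_le_exp.mpr
    have := mul_le_mul_of_nonneg_left hpb (mul_nonneg hσ.le (Nat.cast_nonneg N))
    nlinarith
  · rw [norm_pow, norm_centredCf]
    calc ‖cf h ξ‖ ^ N = ‖cf h ξ‖ ^ (N - k) * ‖cf h ξ‖ ^ k := by
          rw [← pow_add, Nat.sub_add_cancel hkN]
      _ ≤ _ := by gcongr; exact hfar ξ hξ

theorem integral_comp_scale {F : ℝ → ℝ} (hF : Integrable F) {c : ℝ} (hc : 0 < c) :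
    Integrable (fun ξ => F (c * ξ)) ∧ ∫ ξ, F (c * ξ) = (∫ y, F y) / c := by
  refine ⟨hF.comp_mul_left' hc.ne', ?_⟩
  rw [Measure.integral_comp_mul_left, abs_of_pos (inv_pos.mpr hc), smul_eq_mul, inv_mul_eq_div]

theorem integral_norm_sub_le (hσ : 0 < σ) (hα : 0 < α) {M δ b β : ℝ}
    (hM : ∀ ξ, ‖remainderFn h E σ α ξ‖ / |ξ| ^ α ≤ M)
    (hδ : ∀ ξ, |ξ| ≤ δ → ‖cf h ξ‖ ≤ Real.exp (-(σ * |ξ| ^ α / 2))) (hb0 : 0 < b) (hb : b ≤ δ)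
    (hβ : β ≤ 1) (hfar : ∀ ξ, b ≤ |ξ| → ‖cf h ξ‖ ≤ 1 - β) {k N : ℕ}
    (hk : Integrable fun ξ => ‖cf h ξ‖ ^ k) (hkN : k ≤ N) (hN : 2 ≤ N) :
    ∫ ξ, ‖centredCf h E ξ ^ N - Complex.exp (-((N : ℝ) * stableExponent σ α 1 ξ))‖ ≤
      ((1 + σ) * (∫ y, nearProfile σ α y) * (omegaFn (remainderFn h E σ α) α b +
          2 * σ * b ^ α * (1 + Real.tan (Real.pi * α / 2) ^ 2))
        + (∫ y, tailProfile σ α y) * Real.exp (-(σ * N * b ^ α / 2))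
        + (∫ ξ, ‖cf h ξ‖ ^ k) * ((N : ℝ) ^ (1 / α) * (1 - β) ^ (N - k))) / (N : ℝ) ^ (1 / α) := by
  have hN0 : (0 : ℝ) < N := by exact_mod_cast (by omega : 0 < N)
  set c := (N : ℝ) ^ (1 / α)
  have hc : 0 < c := Real.rpow_pos_of_pos hN0 _
  set A := omegaFn (remainderFn h E σ α) α b +
          2 * σ * b ^ α * (1 + Real.tan (Real.pi * α / 2) ^ 2)
  have hA : 0 ≤ A := by
    have := omegaFn_nonneg (remainderFn h E σ α) α b
    positivity
  have hnear : Integrable (nearProfile σ α) :=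
    integrable_rpow_mul_exp_abs hα (by positivity) hα.le
  have htail : Integrable (tailProfile σ α) := by
    refine (integrable_rpow_mul_exp_abs (s := 0) (c := σ / 2) hα (by positivity) le_rfl).congr
      (Eventually.of_forall fun y => ?_)
    simp [tailProfile]
  obtain ⟨i1, v1⟩ := integral_comp_scale hnear hc
  obtain ⟨i2, v2⟩ := integral_comp_scale htail hc
  have hbound : ∀ᵐ ξ : ℝ, ‖centredCf h E ξ ^ N -
      Complex.exp (-((N : ℝ) * stableExponent σ α 1 ξ))‖ ≤
      ((1 + σ) * A * nearProfile σ α (c * ξ) +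
        Real.exp (-(σ * N * b ^ α / 2)) * tailProfile σ α (c * ξ)) +
        (1 - β) ^ (N - k) * ‖cf h ξ‖ ^ k := by
    have hne : ∀ᵐ y : ℝ, y ≠ 0 := by simp [ae_iff, measure_singleton]
    filter_upwards [hne] with ξ hξ0
    have n1 : 0 ≤ (1 + σ) * A * nearProfile σ α (c * ξ) := by
      unfold nearProfile; positivity
    have n2 : 0 ≤ Real.exp (-(σ * N * b ^ α / 2)) * tailProfile σ α (c * ξ) := by
      unfold tailProfile; positivity
    have n3 : 0 ≤ (1 - β) ^ (N - k) * ‖cf h ξ‖ ^ k := by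
      have : 0 ≤ 1 - β := by linarith
      positivity
    rcases le_total |ξ| b with hle | hge
    · have := norm_sub_le_of_near hσ hα hM hδ hb hN hle hξ0
      linarith
    · have := norm_sub_le_of_far (E := E) hσ hα hb0 hfar hkN hge
      linarith
  have j1 := i1.const_mul ((1 + σ) * A)
  have j2 := i2.const_mul (Real.exp (-(σ * N * b ^ α / 2)))
  have j3 := hk.const_mul ((1 - β) ^ (N - k))
  refine (integral_mono_of_nonneg (Eventually.of_forall fun ξ => norm_nonneg _)
    ((j1.add j2).add j3) hbound).trans (le_of_eq ?_)
  have j12 : Integrable fun ξ => (1 + σ) * A * nearProfile σ α (c * ξ) +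
      Real.exp (-(σ * N * b ^ α / 2)) * tailProfile σ α (c * ξ) := j1.add j2
  simp only [Pi.add_apply]
  rw [integral_add j12 j3, integral_add j1 j2, integral_const_mul, integral_const_mul, integral_const_mul, v1, v2]
  field_simp

/-- Shifting the exponent by a fixed amount costs `(1 - β_N)^{q-k}`, which tends to `1`. Hence the
offset `q` can be prescribed freely, whatever `k` is. -/
theorem eventually_pow_le_rpow (k : ℕ) (q : ℝ) {β : ℕ → ℝ} (hβ : Tendsto β atTop (𝓝 0)) :
    ∀ᶠ N : ℕ in atTop, (1 - β N) ^ (N - k) ≤ 2 * (1 - β N) ^ ((N : ℝ) - q) := by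
  have h1 : Tendsto (fun N => (1 - β N) ^ (q - k)) atTop (𝓝 1) := by
    have h2 : Tendsto (fun N => 1 - β N) atTop (𝓝 1) := by simpa using hβ.const_sub 1
    have := h2.rpow_const (p := q - k) (Or.inl one_ne_zero)
    simpa using this
  filter_upwards [h1.eventually (gt_mem_nhds (show (1 : ℝ) < 2 by norm_num)),
    hβ.eventually (gt_mem_nhds one_pos), eventually_ge_atTop k] with N h2 h3 h4
  have h5 : 0 < 1 - β N := by linarith
  have e : (1 - β N) ^ (N - k) = (1 - β N) ^ (q - k) * (1 - β N) ^ ((N : ℝ) - q) := by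
    rw [← Real.rpow_add h5, ← Real.rpow_natCast, Nat.cast_sub h4]
    congr 1; ring
  rw [e]
  have := Real.rpow_pos_of_pos h5 ((N : ℝ) - q)
  gcongr

theorem error_terms_le {a₁ a₂ a₃ x e w t z : ℝ} (h₁ : 0 ≤ a₁) (h₂ : 0 ≤ a₂) (h₃ : 0 ≤ a₃)
    (hx : 0 ≤ x) (he : 0 ≤ e) (hw : 0 ≤ w) (ht : 0 ≤ t) (hz : z ≤ a₃ * x) :
    a₁ * (w + t) + a₂ * e + z ≤ (1 + a₁ + a₂ + a₃) * (x + e + w + t) := by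
  have h : (1 + a₁ + a₂ + a₃) * (x + e + w + t) - (a₁ * (w + t) + a₂ * e + a₃ * x) =
      (x + e + w + t) + a₁ * (x + e) + a₂ * (x + w + t) + a₃ * (e + w + t) := by ring
  have : 0 ≤ (x + e + w + t) + a₁ * (x + e) + a₂ * (x + w + t) + a₃ * (e + w + t) := by
    positivity
  linarith

/-- The constant collects the integrals of the two profiles and of `‖ψ‖^k`, so it depends neither on
`τ` nor on the sequence `b`; only the threshold for `N` does. -/
theorem exists_localLimit_bound (hσ : 0 < σ) (hα : 0 < α) (hα₂ : α < 2) (hh : Integrable h)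
    (hh0 : ∀ x, 0 ≤ h x) (hh1 : ∫ x, h x = 1)
    (ht : Tendsto (fun ξ : ℝ => ‖remainderFn h E σ α ξ‖ / |ξ| ^ α) (𝓝[≠] 0) (𝓝 0))
    {k : ℕ} (hk1 : 1 ≤ k) (hk : Integrable fun ξ => ‖cf h ξ‖ ^ k) (q : ℝ) :
    ∃ C : ℝ, 0 < C ∧ ∀ τ : ℝ, 0 < τ → ∀ b : ℕ → ℝ, (∀ N, 0 < b N) → Tendsto b atTop (𝓝 0) →
      ∀ᶠ N : ℕ in atTop, ∀ x : ℝ,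
        |convPow h N x
          - stableDensity σ α 1 ((x - N * E) / (N : ℝ) ^ (1 / α)) / (N : ℝ) ^ (1 / α)|
          ≤ errorBound C σ α τ q (fun _ => 0) (remainderFn h E σ α) N (b N) /
            (N : ℝ) ^ (1 / α) := by
  obtain ⟨M, hM⟩ := remainderFn_bounded hh0 hh1 hσ.le hα ht
  obtain ⟨δ, hδ0, -, hδ⟩ := exists_norm_centredCf_le hσ hα ht hh0 hh1
  set I₁ := ∫ y, nearProfile σ α y
  set I₂ := ∫ y, tailProfile σ α y
  set I₃ := ∫ ξ, ‖cf h ξ‖ ^ k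
  have hI₁ : 0 ≤ I₁ := integral_nonneg fun y => by unfold nearProfile; positivity
  have hI₂ : 0 ≤ I₂ := integral_nonneg fun y => by unfold tailProfile; positivity
  have hI₃ : 0 ≤ I₃ := integral_nonneg fun y => by positivity
  have hC1 : 0 ≤ (1 + σ) * I₁ := by positivity
  refine ⟨1 + (1 + σ) * I₁ + I₂ + 2 * I₃, by positivity, fun τ hτ b hb0 hb => ?_⟩
  have hbw : Tendsto b atTop (𝓝[>] 0) :=
    tendsto_nhdsWithin_iff.mpr ⟨hb, Eventually.of_forall hb0⟩
  have hβ : Tendsto (fun N => b N ^ (2 + τ)) atTop (𝓝 0) := by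
    have := (tendsto_rpow_nhdsGT_zero (a := 2 + τ) (by linarith) 1).comp hbw
    simpa [Function.comp_def] using this
  filter_upwards [hbw.eventually (eventually_norm_cf_le hσ hα hα₂ ht hh hh0 hh1 hτ),
    hb.eventually (gt_mem_nhds hδ0), hβ.eventually (gt_mem_nhds one_pos),
    eventually_pow_le_rpow k q hβ, eventually_ge_atTop (k + 2)] with N hfar hbδ hβ1 hpow hN x
  refine (abs_convPow_sub_le hh hh0 hh1 hσ hα hk1 hk (by omega) x).trans ?_
  refine (integral_norm_sub_le hσ hα hM hδ (hb0 N) hbδ.le hβ1.le hfar hk (by omega)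
    (by omega)).trans ?_
  have hN0 : (0 : ℝ) < N := by exact_mod_cast (by omega : 0 < N)
  have hc : 0 < (N : ℝ) ^ (1 / α) := Real.rpow_pos_of_pos hN0 _
  have hw := omegaFn_nonneg (remainderFn h E σ α) α (b N)
  have hbp : 0 < b N ^ α := Real.rpow_pos_of_pos (hb0 N) _
  have hT : 0 ≤ 2 * σ * b N ^ α * (1 + Real.tan (Real.pi * α / 2) ^ 2) := by positivity
  have hX : 0 ≤ (1 - b N ^ (2 + τ)) ^ ((N : ℝ) - q) := Real.rpow_nonneg (by linarith) _
  unfold errorBound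
  gcongr
  simp only [add_zero]
  have s3 : I₃ * ((N : ℝ) ^ (1 / α) * (1 - b N ^ (2 + τ)) ^ (N - k)) ≤
      2 * I₃ * ((N : ℝ) ^ (1 / α) * (1 - b N ^ (2 + τ)) ^ ((N : ℝ) - q)) := by
    calc _ ≤ I₃ * ((N : ℝ) ^ (1 / α) * (2 * (1 - b N ^ (2 + τ)) ^ ((N : ℝ) - q))) := by gcongr
      _ = _ := by ring
  exact error_terms_le hC1 hI₂ (by positivity) (mul_nonneg hc.le hX) (Real.exp_pos _).le hw hT s3

/-- Only the first term needs the logarithm: once `N ≥ 2q` and `N b^{2+τ} ≥ 2(1/α + 1) log N`, it is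
at most `N^{1/α} e^{-(1/α + 1) log N} = 1/N`. The stable tail vanishes because `b^α ≥ b^{2+τ}` for
`b < 1`. -/
theorem tendsto_errorBound (hσ : 0 < σ) (hα : 0 < α) (hα₂ : α < 2) {η : ℝ → ℂ}
    (ht : Tendsto (fun ξ : ℝ => ‖η ξ‖ / |ξ| ^ α) (𝓝[≠] 0) (𝓝 0)) (C q : ℝ) {τ : ℝ} (hτ : 0 < τ)
    {b : ℕ → ℝ} (hb0 : ∀ N, 0 < b N) (hb : Tendsto b atTop (𝓝 0))
    (hlog : Tendsto (fun N : ℕ => (N : ℝ) * b N ^ (2 + τ) / Real.log N) atTop atTop) :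
    Tendsto (fun N : ℕ => errorBound C σ α τ q (fun _ => 0) η N (b N)) atTop (𝓝 0) := by
  have hbw : Tendsto b atTop (𝓝[>] 0) :=
    tendsto_nhdsWithin_iff.mpr ⟨hb, Eventually.of_forall hb0⟩
  have hβ : Tendsto (fun N => b N ^ (2 + τ)) atTop (𝓝 0) := by
    have := (tendsto_rpow_nhdsGT_zero (a := 2 + τ) (by linarith) 1).comp hbw
    simpa [Function.comp_def] using this
  have hbα : Tendsto (fun N => 2 * σ * b N ^ α * (1 + Real.tan (Real.pi * α / 2) ^ 2)) atTop
      (𝓝 0) := by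
    have := ((tendsto_rpow_nhdsGT_zero hα (2 * σ)).comp hbw).mul_const
      (1 + Real.tan (Real.pi * α / 2) ^ 2)
    simpa [Function.comp_def] using this
  have hω : Tendsto (fun N => omegaFn η α (b N)) atTop (𝓝 0) := (tendsto_omegaFn hα ht).comp hbw
  have hlogN : Tendsto (fun N : ℕ => Real.log N) atTop atTop :=
    Real.tendsto_log_atTop.comp tendsto_natCast_atTop_atTop
  have hprod : Tendsto (fun N : ℕ => (N : ℝ) * b N ^ (2 + τ)) atTop atTop := by
    refine tendsto_atTop_mono' atTop ?_ hlogN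
    filter_upwards [hlog.eventually_ge_atTop 1, hlogN.eventually_gt_atTop 0] with N h1 h2
    rwa [le_div_iff₀ h2, one_mul] at h1
  have hexp : Tendsto (fun N : ℕ => Real.exp (-(σ * N * b N ^ α / 2))) atTop (𝓝 0) := by
    refine Real.tendsto_exp_neg_atTop_nhds_zero.comp ?_
    refine tendsto_atTop_mono' atTop ?_ (hprod.const_mul_atTop (half_pos hσ))
    filter_upwards [hb.eventually (gt_mem_nhds one_pos)] with N h1
    have : b N ^ (2 + τ) ≤ b N ^ α :=
      Real.rpow_le_rpow_of_exponent_ge (hb0 N) h1.le (by linarith)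
    have hN0 : (0 : ℝ) ≤ N := Nat.cast_nonneg N
    calc σ / 2 * ((N : ℝ) * b N ^ (2 + τ)) ≤ σ / 2 * ((N : ℝ) * b N ^ α) := by gcongr
      _ = _ := by ring
  have hmain : Tendsto (fun N : ℕ => (N : ℝ) ^ (1 / α) *
      (1 - b N ^ (2 + τ) + 0) ^ ((N : ℝ) - q)) atTop (𝓝 0) := by
    have hinv : Tendsto (fun N : ℕ => ((N : ℝ))⁻¹) atTop (𝓝 0) :=
      tendsto_inv_atTop_zero.comp tendsto_natCast_atTop_atTop
    refine squeeze_zero' ?_ ?_ hinv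
    · filter_upwards [hβ.eventually (gt_mem_nhds one_pos)] with N h1
      exact mul_nonneg (Real.rpow_nonneg (Nat.cast_nonneg N) _)
        (Real.rpow_nonneg (by linarith) _)
    · have hNat : Tendsto (fun N : ℕ => (N : ℝ)) atTop atTop := tendsto_natCast_atTop_atTop
      filter_upwards [hβ.eventually (gt_mem_nhds one_pos), hNat.eventually_ge_atTop (2 * q),
        hNat.eventually_ge_atTop 1, hlogN.eventually_gt_atTop 0,
        hlog.eventually_ge_atTop (2 * (1 / α + 1))] with N h1 h2 h3 h4 h5
      rw [le_div_iff₀ h4] at h5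
      have hN0 : (0 : ℝ) < N := by linarith
      have hp : 0 < b N ^ (2 + τ) := Real.rpow_pos_of_pos (hb0 N) _
      set β := b N ^ (2 + τ)
      have h6 : (1 - β + 0) ^ ((N : ℝ) - q) ≤ Real.exp (-β * ((N : ℝ) - q)) := by
        rw [Real.exp_mul]
        refine Real.rpow_le_rpow (by linarith) ?_ (by linarith)
        have := Real.add_one_le_exp (-β)
        linarith
      have h7 : Real.exp (-β * ((N : ℝ) - q)) ≤ Real.exp (-((1 / α + 1) * Real.log N)) := by
        apply Real.exp_le_exp.mpr
        nlinarith
      have e1 : (N : ℝ) ^ (1 / α) = Real.exp (Real.log N * (1 / α)) :=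
        Real.rpow_def_of_pos hN0 _
      calc _ ≤ (N : ℝ) ^ (1 / α) * Real.exp (-((1 / α + 1) * Real.log N)) := by
            gcongr
            exact h6.trans h7
        _ = Real.exp (-Real.log N) := by
            rw [e1, ← Real.exp_add]; congr 1; ring
        _ = _ := by rw [Real.exp_neg, Real.exp_log hN0]
  have := ((((hmain.add hexp).add hω).add hbα).const_mul C)
  simpa [errorBound] using this

end

section

variable {f h : ℝ → ℝ}

/-! ### Integrability of a power of `h` -/

theorem image_sq_Ioi : (fun t : ℝ => t ^ 2) '' Ioi 0 = Ioi 0 := by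
  ext u
  constructor
  · rintro ⟨t, ht, rfl⟩
    exact pow_pos (mem_Ioi.mp ht) 2
  · intro hu
    exact ⟨√u, Real.sqrt_pos.mpr hu, Real.sq_sqrt (le_of_lt hu)⟩

theorem lintegral_Ioi_eq_comp_sq (g : ℝ → ENNReal) :
    ∫⁻ u in Ioi (0 : ℝ), g u = ∫⁻ t in Ioi (0 : ℝ), ENNReal.ofReal (2 * t) * g (t ^ 2) := by
  have key := lintegral_image_eq_lintegral_abs_deriv_mul (s := Ioi (0 : ℝ)) measurableSet_Ioi
    (f := fun t : ℝ => t ^ 2) (f' := fun t => 2 * t)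
    (fun x _ => by simpa using (hasDerivAt_pow 2 x).hasDerivWithinAt)
    (fun x hx y hy hxy => (pow_left_inj₀ (le_of_lt hx) (le_of_lt hy) two_ne_zero).mp hxy) g
  rw [image_sq_Ioi] at key
  rw [key]
  refine setLIntegral_congr_fun measurableSet_Ioi fun t ht => ?_
  rw [abs_of_pos (mul_pos two_pos (mem_Ioi.mp ht))]

theorem lintegral_eq_lintegral_Ioi_add {φ : ℝ → ENNReal} (hφ : Measurable φ) :
    ∫⁻ y, φ y = ∫⁻ t in Ioi (0 : ℝ), (φ t + φ (-t)) := by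
  rw [lintegral_add_left hφ, ← lintegral_add_compl φ (measurableSet_Ioi (a := (0 : ℝ))), compl_Ioi]
  congr 1
  have := (Measure.measurePreserving_neg (volume : Measure ℝ)).setLIntegral_comp_preimage_emb
    (MeasurableEquiv.neg ℝ).measurableEmbedding φ (Iic 0)
  rw [← this, setLIntegral_congr (Ioi_ae_eq_Ici (a := (0 : ℝ)))]
  simp

namespace SquareDensity

theorem ae_eq (H : SquareDensity f h) {G : ℝ → ENNReal} (hG : Measurable G)
    (hGF : ∀ F : ℝ → ENNReal, Measurable F →
      ∫⁻ u, G u * F u = ∫⁻ y, ENNReal.ofReal (f y) * F (y ^ 2)) :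
    (fun u => ENNReal.ofReal (h u)) =ᵐ[volume] G := by
  have hm := H.measurable_h
  refine ae_eq_of_forall_setLIntegral_eq_of_sigmaFinite (by fun_prop) hG fun s hs _ => ?_
  have hF : Measurable (s.indicator (fun _ => (1 : ENNReal))) := measurable_const.indicator hs
  have h1 := (H.lintegral_mul hF).trans (hGF _ hF).symm
  rw [← lintegral_indicator hs, ← lintegral_indicator hs]
  convert h1 using 2 with x x <;>
  · ext x
    by_cases hx : x ∈ s <;> simp [hx]

end SquareDensity

/-- The density `(f(√u) + f(-√u)) / (2√u)` of the square. -/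
def squareDensity (f : ℝ → ℝ) (u : ℝ) : ℝ :=
  (Ioi (0 : ℝ)).indicator (fun u => (f √u + f (-√u)) / (2 * √u)) u

theorem measurable_squareDensity (hf : Measurable f) : Measurable (squareDensity f) := by
  unfold squareDensity
  exact Measurable.indicator (by fun_prop) measurableSet_Ioi

namespace SquareDensity

theorem ae_eq_squareDensity (H : SquareDensity f h) :
    (fun u => ENNReal.ofReal (h u)) =ᵐ[volume] fun u => ENNReal.ofReal (squareDensity f u) := by
  have hm := H.measurable_f
  have hsm := measurable_squareDensity hm
  refine H.ae_eq (by fun_prop) fun F hF => ?_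
  have h1 : ∫⁻ u, ENNReal.ofReal (squareDensity f u) * F u =
      ∫⁻ u in Ioi (0 : ℝ), ENNReal.ofReal (squareDensity f u) * F u := by
    rw [← lintegral_indicator measurableSet_Ioi]
    congr 1
    ext u
    by_cases hu : u ∈ Ioi (0 : ℝ) <;> simp [hu, squareDensity]
  rw [h1, lintegral_Ioi_eq_comp_sq,
    lintegral_eq_lintegral_Ioi_add (φ := fun y => ENNReal.ofReal (f y) * F (y ^ 2)) (by fun_prop)]
  refine setLIntegral_congr_fun measurableSet_Ioi fun t ht => ?_
  have ht0 : 0 < t := ht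
  rw [← mul_assoc, ← ENNReal.ofReal_mul (by positivity), neg_sq, ← add_mul,
    ← ENNReal.ofReal_add (H.nonneg_f _) (H.nonneg_f _)]
  congr 2
  rw [squareDensity, indicator_of_mem (mem_Ioi.mpr (by positivity)), Real.sqrt_sq ht0.le]
  field_simp

end SquareDensity

/-- The exponent `s = (p-1)/(2p+1)` is tuned so that Young's inequality with exponents `(2p+1)/3`
and `(2p+1)/(2p-2)` turns the product into `a^p` and `t^{-1/2}`, the latter integrable at `0`. For
`t ≥ 1` the power of `t` is at most `1`. -/
theorem rpow_mul_rpow_le {p a t : ℝ} (hp : 1 < p) (ha : 0 ≤ a) (ht : 0 < t) :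
    a ^ (1 + (p - 1) / (2 * p + 1)) * t ^ (-((p - 1) / (2 * p + 1))) ≤
      a + a ^ p + (Ioo (0 : ℝ) 1).indicator (fun t => t ^ (-(1 / 2) : ℝ)) t := by
  set s := (p - 1) / (2 * p + 1) with hs
  have hs0 : 0 < s := div_pos (by linarith) (by linarith)
  have hsp : 1 + s < p := by
    rw [hs, ← lt_sub_iff_add_lt', div_lt_iff₀ (by linarith)]; nlinarith
  have hap : 0 ≤ a ^ p := Real.rpow_nonneg ha _
  by_cases ht1 : t < 1
  · rw [indicator_of_mem (show t ∈ Ioo (0 : ℝ) 1 from ⟨ht, ht1⟩)]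
    have hconj : ((2 * p + 1) / 3).HolderConjugate ((2 * p + 1) / (2 * p - 2)) := by
      rw [Real.holderConjugate_iff]
      refine ⟨by rw [lt_div_iff₀ (by norm_num)]; linarith, ?_⟩
      have : 2 * p - 2 ≠ 0 := by linarith
      have : 2 * p + 1 ≠ 0 := by linarith
      field_simp
      ring
    have hy := Real.young_inequality_of_nonneg (a := a ^ (1 + s)) (b := t ^ (-s))
      (Real.rpow_nonneg ha _) (Real.rpow_nonneg ht.le _) hconj
    rw [← Real.rpow_mul ha, ← Real.rpow_mul ht.le] at hy
    have e1 : (1 + s) * ((2 * p + 1) / 3) = p := by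
      rw [hs]; have : 2 * p + 1 ≠ 0 := by linarith
      field_simp; ring
    have e2 : -s * ((2 * p + 1) / (2 * p - 2)) = -(1 / 2) := by
      rw [hs]; have : 2 * p + 1 ≠ 0 := by linarith
      have : p - 1 ≠ 0 := by linarith
      rw [show 2 * p - 2 = 2 * (p - 1) by ring]
      field_simp
    rw [e1, e2] at hy
    have h1 : a ^ p / ((2 * p + 1) / 3) ≤ a ^ p := div_le_self hap hconj.lt.le
    have h2 : t ^ (-(1 / 2) : ℝ) / ((2 * p + 1) / (2 * p - 2)) ≤ t ^ (-(1 / 2) : ℝ) :=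
      div_le_self (Real.rpow_nonneg ht.le _) hconj.symm.lt.le
    linarith
  · rw [indicator_of_notMem (by simp [ht1])]
    have h1 : t ^ (-s) ≤ 1 := Real.rpow_le_one_of_one_le_of_nonpos (not_lt.mp ht1) (by linarith)
    have h2 : a ^ (1 + s) ≤ a + a ^ p := by
      by_cases ha1 : a ≤ 1
      · have : a ^ (1 + s) ≤ a ^ (1 : ℝ) := by
          rcases ha.eq_or_lt with rfl | ha'
          · rw [Real.zero_rpow (by linarith), Real.zero_rpow (by norm_num)]
          · exact Real.rpow_le_rpow_of_exponent_ge ha' ha1 (by linarith)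
        rw [Real.rpow_one] at this
        linarith
      · have : a ^ (1 + s) ≤ a ^ p :=
          Real.rpow_le_rpow_of_exponent_le (not_le.mp ha1).le hsp.le
        linarith
    have h3 := mul_le_mul_of_nonneg_left h1 (Real.rpow_nonneg ha (1 + s))
    linarith

theorem integrable_indicator_abs_rpow :
    Integrable fun y : ℝ => (Ioo (0 : ℝ) 1).indicator (fun t => t ^ (-(1 / 2) : ℝ)) |y| := by
  have h1 : IntegrableOn (fun t : ℝ => t ^ (-(1 / 2) : ℝ)) (Ioo 0 1) :=
    (intervalIntegral.integrableOn_Ioo_rpow_iff one_pos).mpr (by norm_num)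
  have h2 := (integrable_indicator_iff measurableSet_Ioo).mpr h1
  refine (h2.add h2.comp_neg).congr (Eventually.of_forall fun y => ?_)
  rcases lt_trichotomy y 0 with hy | rfl | hy
  · simp [abs_of_neg hy, hy.le, indicator_of_notMem]
  · simp
  · simp [abs_of_pos hy, hy.le, indicator_of_notMem]

/-- Reduces to a finite exponent: for `p = ∞` the square works, as `f²` is `f` times an essentially
bounded function. -/
theorem exists_integrable_rpow_of_memLp {p : ENNReal} (hp : 1 < p) (hf0 : ∀ x, 0 ≤ f x)
    (hf : Integrable f) (hfp : MemLp f p volume) :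
    ∃ r : ℝ, 1 < r ∧ Integrable fun x => f x ^ r := by
  by_cases hpt : p = ⊤
  · refine ⟨2, one_lt_two, ?_⟩
    subst hpt
    have h1 := hf.bdd_mul hf.aestronglyMeasurable (c := (eLpNormEssSup f volume).toReal) (by
      have h2 : eLpNormEssSup f volume ≠ ⊤ := by
        rw [← eLpNorm_exponent_top]; exact hfp.2.ne
      filter_upwards [ae_le_eLpNormEssSup (f := f) (μ := volume)] with x hx
      rw [← toReal_enorm]
      exact ENNReal.toReal_mono h2 hx)
    refine h1.congr (Eventually.of_forall fun x => ?_)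
    simp [sq]
  · refine ⟨p.toReal, ?_, ?_⟩
    · rw [← ENNReal.toReal_one]
      exact (ENNReal.toReal_lt_toReal ENNReal.one_ne_top hpt).mpr hp
    · have := hfp.integrable_norm_rpow (zero_lt_one.trans hp).ne' hpt
      simpa only [Real.norm_of_nonneg (hf0 _)] using this

/-- Write `h^{1+s} = h · h^s` and pull the measure `h du` back to `f dy`. Only the power `s` of the
explicit density then meets the singular factor `1/|y|`, and the previous Young-type bound gives an
integrable majorant. -/
theorem SquareDensity.exists_integrable_rpow (H : SquareDensity f h) {r : ℝ} (hr : 1 < r)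
    (hfr : Integrable fun x => f x ^ r) :
    ∃ p : ℝ, 1 < p ∧ Integrable fun x => h x ^ p := by
  set s := (r - 1) / (2 * r + 1) with hs
  have hs0 : 0 < s := div_pos (by linarith) (by linarith)
  refine ⟨1 + s, by linarith, ?_⟩
  have hm := H.measurable_f
  have hhm := H.measurable_h
  have hsm := measurable_squareDensity hm
  have hfi := H.integrable_f
  have hdom : Integrable fun y : ℝ => (f y + f (-y)) + 2 ^ (r - 1) * (f y ^ r + f (-y) ^ r) +
      (Ioo (0 : ℝ) 1).indicator (fun t => t ^ (-(1 / 2) : ℝ)) |y| :=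
    ((hfi.add hfi.comp_neg).add ((hfr.add hfr.comp_neg).const_mul _)).add
      integrable_indicator_abs_rpow
  refine ⟨(hhm.pow_const _).aestronglyMeasurable, ?_⟩
  rw [hasFiniteIntegral_iff_ofReal (Eventually.of_forall fun x => Real.rpow_nonneg (H.nonneg_h x) _)]
  have h1 : ∫⁻ x, ENNReal.ofReal (h x ^ (1 + s)) =
      ∫⁻ x, ENNReal.ofReal (h x) * ENNReal.ofReal (squareDensity f x ^ s) := by
    refine lintegral_congr_ae ?_
    filter_upwards [H.ae_eq_squareDensity] with x hx
    have h0 : 0 ≤ squareDensity f x :=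
      indicator_nonneg (fun u _ => div_nonneg (add_nonneg (H.nonneg_f _) (H.nonneg_f _))
        (by positivity)) x
    rw [ENNReal.ofReal_eq_ofReal_iff (H.nonneg_h x) h0] at hx
    rw [← ENNReal.ofReal_mul (H.nonneg_h x), ← hx, Real.rpow_one_add' (H.nonneg_h x) (by linarith)]
  rw [h1, H.lintegral_mul (by fun_prop)]
  refine lt_of_le_of_lt (lintegral_mono_ae (g := fun y => ENNReal.ofReal _) ?_)
    hdom.lintegral_lt_top
  have hne : ∀ᵐ y : ℝ, y ≠ 0 := by simp [ae_iff]
  filter_upwards [hne] with y hy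
  have hy0 : 0 < |y| := abs_pos.mpr hy
  rw [← ENNReal.ofReal_mul (H.nonneg_f y)]
  refine ENNReal.ofReal_le_ofReal ?_
  set a := f y + f (-y) with ha
  have ha0 : 0 ≤ a := add_nonneg (H.nonneg_f _) (H.nonneg_f _)
  have hfa : f y ≤ a := le_add_of_nonneg_right (H.nonneg_f _)
  have h2 : squareDensity f (y ^ 2) = a / (2 * |y|) := by
    rw [squareDensity, indicator_of_mem (mem_Ioi.mpr (by positivity)), Real.sqrt_sq_eq_abs]
    congr 1
    rcases abs_choice y with h | h <;> rw [h, ha]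
    rw [neg_neg, add_comm]
  have h3 : (a / (2 * |y|)) ^ s ≤ a ^ s * |y| ^ (-s) := by
    rw [Real.rpow_neg hy0.le, ← div_eq_mul_inv, ← Real.div_rpow ha0 hy0.le]
    exact Real.rpow_le_rpow (by positivity)
      (div_le_div_of_nonneg_left ha0 hy0 (by linarith)) hs0.le
  have h4 : a ^ r ≤ 2 ^ (r - 1) * (f y ^ r + f (-y) ^ r) := by
    exact_mod_cast NNReal.rpow_add_le_mul_rpow_add_rpow ⟨f y, H.nonneg_f _⟩
      ⟨f (-y), H.nonneg_f _⟩ hr.le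
  calc f y * squareDensity f (y ^ 2) ^ s ≤ a * (a ^ s * |y| ^ (-s)) := by
        rw [h2]; exact mul_le_mul hfa h3 (by positivity) ha0
    _ = a ^ (1 + s) * |y| ^ (-s) := by
        rw [Real.rpow_one_add' ha0 (by linarith), mul_assoc]
    _ ≤ a + a ^ r + _ := rpow_mul_rpow_le hr ha0 hy0
    _ ≤ _ := by linarith

theorem memLp_ofReal_iff (hm : Measurable h) (hh0 : ∀ x, 0 ≤ h x) {p : ℝ} (hp : 1 < p) :
    MemLp h (ENNReal.ofReal p) volume ↔ Integrable fun x => h x ^ p := by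
  have h0 : ENNReal.ofReal p ≠ 0 := by simp; linarith
  rw [← integrable_norm_rpow_iff hm.aestronglyMeasurable h0 ENNReal.ofReal_ne_top,
    ENNReal.toReal_ofReal (by linarith)]
  simp only [Real.norm_of_nonneg (hh0 _)]

end

section

/-! ### Integration over spheres -/

theorem lintegral_eq_mul_lintegral_comp_mul {g : ℝ → ENNReal} (hg : Measurable g) {c : ℝ}
    (hc : 0 < c) : ∫⁻ s, g s = ENNReal.ofReal c * ∫⁻ t, g (c * t) := by
  conv_lhs => rw [← Real.smul_map_volume_mul_left hc.ne']
  rw [lintegral_smul_measure, lintegral_map hg (by fun_prop), abs_of_pos hc, smul_eq_mul]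

/-- The integral of `F` over the sphere of radius `√u` in `ℝⁿ` with respect to the measure
`dx / d(|x|²)`. -/
def sphereSlice (n : ℕ) (F : EuclideanSpace ℝ (Fin n) → ENNReal) (u : ℝ) : ENNReal :=
  ENNReal.ofReal (u ^ (((n : ℝ) - 2) / 2) / 2) *
    ∫⁻ x : Metric.sphere (0 : EuclideanSpace ℝ (Fin n)) 1, F (√u • (x : EuclideanSpace ℝ (Fin n)))
      ∂(volume : Measure (EuclideanSpace ℝ (Fin n))).toSphere

theorem measurable_sphereSlice {X : Type*} [MeasurableSpace X] {n : ℕ}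
    {F : X → EuclideanSpace ℝ (Fin n) → ENNReal} (hF : Measurable (Function.uncurry F))
    {v : X → ℝ} (hv : Measurable v) : Measurable fun t => sphereSlice n (F t) (v t) := by
  unfold sphereSlice
  refine Measurable.mul (by fun_prop) ?_
  refine Measurable.lintegral_prod_right'
    (f := fun p : X × Metric.sphere (0 : EuclideanSpace ℝ (Fin n)) 1 =>
      F p.1 (√(v p.1) • (p.2 : EuclideanSpace ℝ (Fin n)))) ?_
  exact hF.comp (by fun_prop : Measurable fun p : X × Metric.sphere (0 : EuclideanSpace ℝ (Fin n)) 1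
    => (p.1, √(v p.1) • (p.2 : EuclideanSpace ℝ (Fin n))))

/-- Polar coordinates with `u = r²`: `r^n dr` becomes `u^{(n-1)/2} du / 2`, the weight built into
`sphereSlice (n + 1)`. -/
theorem lintegral_eq_lintegral_sphereSlice {n : ℕ} {F : EuclideanSpace ℝ (Fin (n + 1)) → ENNReal}
    (hF : Measurable F) : ∫⁻ x, F x = ∫⁻ u in Ioi (0 : ℝ), sphereSlice (n + 1) F u := by
  set μ : Measure (EuclideanSpace ℝ (Fin (n + 1))) := volume with hμ
  have hmp := μ.measurePreserving_homeomorphUnitSphereProd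
  have h1 : ∫⁻ x, F x ∂μ = ∫⁻ x : ({(0)}ᶜ : Set (EuclideanSpace ℝ (Fin (n + 1)))), F x
      ∂(μ.comap (↑)) := by
    rw [lintegral_subtype_comap (measurableSet_singleton _).compl, restrict_compl_singleton]
  have h2 : ∫⁻ x : ({(0)}ᶜ : Set (EuclideanSpace ℝ (Fin (n + 1)))), F x ∂(μ.comap (↑)) =
      ∫⁻ p : Metric.sphere (0 : EuclideanSpace ℝ (Fin (n + 1))) 1 × Ioi (0 : ℝ),
        F ((p.2 : ℝ) • (p.1 : EuclideanSpace ℝ (Fin (n + 1))))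
        ∂(μ.toSphere.prod (.volumeIoiPow (Module.finrank ℝ (EuclideanSpace ℝ (Fin (n + 1))) - 1))) := by
    rw [← hmp.lintegral_comp_emb (Homeomorph.measurableEmbedding _)]
    refine lintegral_congr fun x => ?_
    rw [← homeomorphUnitSphereProd_symm_apply_coe, Homeomorph.symm_apply_apply]
  have h3 : Measurable fun r : Ioi (0 : ℝ) =>
      ∫⁻ x : Metric.sphere (0 : EuclideanSpace ℝ (Fin (n + 1))) 1,
        F ((r : ℝ) • (x : EuclideanSpace ℝ (Fin (n + 1)))) ∂μ.toSphere :=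
    Measurable.lintegral_prod_left' (f := fun p : Metric.sphere
      (0 : EuclideanSpace ℝ (Fin (n + 1))) 1 × Ioi (0 : ℝ) =>
        F ((p.2 : ℝ) • (p.1 : EuclideanSpace ℝ (Fin (n + 1))))) (by fun_prop)
  rw [h1, h2, lintegral_prod_symm' _ (by fun_prop), Measure.volumeIoiPow,
    lintegral_withDensity_eq_lintegral_mul _ (by fun_prop) h3]
  simp only [finrank_euclideanSpace, Fintype.card_fin, Nat.add_sub_cancel, Pi.mul_apply]
  rw [lintegral_subtype_comap (measurableSet_Ioi (a := (0 : ℝ))) (f := fun r : ℝ => ENNReal.ofReal (r ^ n) *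
    ∫⁻ x : Metric.sphere (0 : EuclideanSpace ℝ (Fin (n + 1))) 1,
      F (r • (x : EuclideanSpace ℝ (Fin (n + 1)))) ∂μ.toSphere),
    lintegral_Ioi_eq_comp_sq (sphereSlice (n + 1) F)]
  refine setLIntegral_congr_fun measurableSet_Ioi fun r hr => ?_
  have hr0 : 0 < r := hr
  simp only [sphereSlice]
  rw [← mul_assoc, ← ENNReal.ofReal_mul (by positivity), Real.sqrt_sq hr0.le]
  congr 2
  rw [← Real.rpow_natCast r 2, ← Real.rpow_mul hr0.le]
  have e : ((2 : ℕ) : ℝ) * ((((n + 1 : ℕ) : ℝ) - 2) / 2) = (n : ℝ) - 1 := by push_cast; ring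
  rw [e, Real.rpow_sub_one hr0.ne', Real.rpow_natCast]
  field_simp

/-- Prepending a coordinate to a vector of `ℝⁿ`. -/
def consVec {n : ℕ} (t : ℝ) (y : EuclideanSpace ℝ (Fin n)) : EuclideanSpace ℝ (Fin (n + 1)) :=
  WithLp.toLp 2 (Fin.cons t y.ofLp)

theorem consVec_zero {n : ℕ} (t : ℝ) (y : EuclideanSpace ℝ (Fin n)) : consVec t y 0 = t := rfl

theorem consVec_succ {n : ℕ} (t : ℝ) (y : EuclideanSpace ℝ (Fin n)) (i : Fin n) :
    consVec t y i.succ = y i := rfl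

theorem norm_sq_consVec {n : ℕ} (t : ℝ) (y : EuclideanSpace ℝ (Fin n)) :
    ‖consVec t y‖ ^ 2 = t ^ 2 + ‖y‖ ^ 2 := by
  rw [EuclideanSpace.norm_sq_eq, EuclideanSpace.norm_sq_eq, Fin.sum_univ_succ]
  simp [consVec_zero, consVec_succ]

theorem smul_consVec {n : ℕ} (c t : ℝ) (y : EuclideanSpace ℝ (Fin n)) :
    c • consVec t y = consVec (c * t) (c • y) := by
  ext i
  refine Fin.cases ?_ (fun j => ?_) i <;> simp [consVec_zero, consVec_succ]

theorem measurable_consVec {n : ℕ} :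
    Measurable fun p : ℝ × EuclideanSpace ℝ (Fin n) => consVec p.1 p.2 := by
  refine (WithLp.measurable_toLp 2 _).comp (measurable_pi_iff.mpr fun i => ?_)
  refine Fin.cases ?_ (fun j => ?_) i
  · simpa using measurable_fst
  · simp only [Fin.cons_succ]
    fun_prop

theorem lintegral_consVec {n : ℕ} {F : EuclideanSpace ℝ (Fin (n + 1)) → ENNReal}
    (hF : Measurable F) : ∫⁻ x, F x = ∫⁻ t : ℝ, ∫⁻ y, F (consVec t y) := by
  have h1 := (PiLp.volume_preserving_toLp (Fin (n + 1))).lintegral_comp hF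
  have h2 := ((volume_preserving_piFinSuccAbove (fun _ : Fin (n + 1) => ℝ) 0).symm _).lintegral_comp
    (hF.comp (WithLp.measurable_toLp 2 _))
  rw [← h1]
  refine h2.symm.trans ?_
  rw [Measure.volume_eq_prod, lintegral_prod _ (by fun_prop)]
  refine lintegral_congr fun t => ?_
  have h3 := (PiLp.volume_preserving_toLp (Fin n)).lintegral_comp
    (f := fun y => F (consVec t y)) (hF.comp (measurable_consVec.comp measurable_prodMk_left))
  rw [← h3]
  refine lintegral_congr fun y => ?_
  simp [consVec, MeasurableEquiv.piFinSuccAbove, Function.comp]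
  rfl

end

section

variable {f h : ℝ → ℝ}

/-! ### Slicing a sphere along its first coordinate -/

theorem sphereSlice_congr {n : ℕ} {F G : EuclideanSpace ℝ (Fin n) → ENNReal} {u : ℝ} (hu : 0 ≤ u)
    (hFG : ∀ x, ‖x‖ ^ 2 = u → F x = G x) : sphereSlice n F u = sphereSlice n G u := by
  unfold sphereSlice
  congr 1
  refine lintegral_congr fun x => hFG _ ?_
  rw [norm_smul, norm_eq_of_mem_sphere, mul_one, Real.norm_of_nonneg (Real.sqrt_nonneg u),
    Real.sq_sqrt hu]

theorem sphereSlice_mul_const {n : ℕ} {F : EuclideanSpace ℝ (Fin n) → ENNReal} (hF : Measurable F)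
    (c : ENNReal) (u : ℝ) : sphereSlice n (fun x => F x * c) u = sphereSlice n F u * c := by
  unfold sphereSlice
  rw [lintegral_mul_const _ (by fun_prop), mul_assoc]

theorem sphereSlice_mul_norm_sq {n : ℕ} {F : EuclideanSpace ℝ (Fin n) → ENNReal}
    (hF : Measurable F) (k : ℝ → ENNReal) {u : ℝ} (hu : 0 ≤ u) :
    sphereSlice n (fun x => F x * k (‖x‖ ^ 2)) u = sphereSlice n F u * k u := by
  rw [← sphereSlice_mul_const hF]
  exact sphereSlice_congr hu fun x hx => by rw [hx]

/-- The integral of `F` over the sphere of radius `√u`, sliced along the first coordinate. -/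
def slicedSphere (n : ℕ) (F : EuclideanSpace ℝ (Fin (n + 1)) → ENNReal) (u : ℝ) : ENNReal :=
  ∫⁻ t : ℝ, (Ioi (0 : ℝ)).indicator (sphereSlice n fun y => F (consVec t y)) (u - t ^ 2)

theorem measurable_indicator_sphereSlice {n : ℕ} {F : EuclideanSpace ℝ (Fin (n + 1)) → ENNReal}
    (hF : Measurable F) : Measurable fun p : ℝ × ℝ =>
      (Ioi (0 : ℝ)).indicator (sphereSlice n fun y => F (consVec p.2 y)) (p.1 - p.2 ^ 2) := by
  have h1 : Measurable fun p : ℝ × ℝ =>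
      sphereSlice n (fun y => F (consVec p.2 y)) (p.1 - p.2 ^ 2) := by
    refine measurable_sphereSlice (F := fun (p : ℝ × ℝ) y => F (consVec p.2 y)) ?_ (by fun_prop)
    exact hF.comp (measurable_consVec.comp
      (by fun_prop : Measurable fun q : (ℝ × ℝ) × EuclideanSpace ℝ (Fin n) => (q.1.2, q.2)))
  exact h1.indicator (s := {p : ℝ × ℝ | p.1 - p.2 ^ 2 ∈ Ioi (0 : ℝ)})
    ((by fun_prop : Measurable fun p : ℝ × ℝ => p.1 - p.2 ^ 2) measurableSet_Ioi)

theorem lintegral_sphereSlice_mul_eq {n : ℕ} {F : EuclideanSpace ℝ (Fin (n + 1)) → ENNReal}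
    (hF : Measurable F) {k : ℝ → ENNReal} (hk : Measurable k) :
    ∫⁻ u in Ioi (0 : ℝ), sphereSlice (n + 1) F u * k u = ∫⁻ x, F x * k (‖x‖ ^ 2) := by
  rw [lintegral_eq_lintegral_sphereSlice (by fun_prop)]
  exact setLIntegral_congr_fun measurableSet_Ioi fun u hu =>
    (sphereSlice_mul_norm_sq hF k (le_of_lt hu)).symm

/-- The weak form of the slicing identity, tested against functions of `|x|²`: polar coordinates in
the whole space on one side, in the last `n + 1` coordinates on the other. -/
theorem lintegral_sphereSlice_mul {n : ℕ} {F : EuclideanSpace ℝ (Fin (n + 2)) → ENNReal}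
    (hF : Measurable F) {k : ℝ → ENNReal} (hk : Measurable k) :
    ∫⁻ u in Ioi (0 : ℝ), sphereSlice (n + 2) F u * k u =
      ∫⁻ u, slicedSphere (n + 1) F u * k u := by
  have hm := measurable_indicator_sphereSlice hF
  have hc : ∀ t : ℝ, Measurable fun y => F (consVec t y) := fun t =>
    hF.comp (measurable_consVec.comp measurable_prodMk_left)
  rw [lintegral_sphereSlice_mul_eq hF hk, lintegral_consVec (by fun_prop)]
  have h1 : ∀ t : ℝ, ∫⁻ y, F (consVec t y) * k (‖consVec t y‖ ^ 2) =
      ∫⁻ u, (Ioi (0 : ℝ)).indicator (sphereSlice (n + 1) fun y => F (consVec t y)) (u - t ^ 2) *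
        k u := by
    intro t
    have h2 := lintegral_sphereSlice_mul_eq (hc t) (k := fun v => k (t ^ 2 + v)) (by fun_prop)
    simp only [norm_sq_consVec]
    rw [← h2, ← lintegral_indicator measurableSet_Ioi, ← lintegral_sub_right_eq_self _ (t ^ 2)]
    refine lintegral_congr fun u => ?_
    by_cases hu : u - t ^ 2 ∈ Ioi (0 : ℝ)
    · rw [indicator_of_mem hu, indicator_of_mem hu, add_sub_cancel]
    · rw [indicator_of_notMem hu, indicator_of_notMem hu, zero_mul]
  simp only [h1]
  rw [lintegral_lintegral_swap (Measurable.aemeasurable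
    (by simp only [Function.uncurry_def]
        exact (hm.comp measurable_swap).mul (hk.comp measurable_snd)))]
  refine lintegral_congr fun u => ?_
  rw [slicedSphere, lintegral_mul_const]
  exact hm.comp measurable_prodMk_left

theorem sphereSlice_of_homogeneous {n : ℕ} {F : EuclideanSpace ℝ (Fin n) → ENNReal}
    (hF0 : ∀ c : ℝ, 0 < c → ∀ x, F (c • x) = F x) {u : ℝ} (hu : 0 < u) :
    sphereSlice n F u = ENNReal.ofReal (u ^ (((n : ℝ) - 2) / 2)) * sphereSlice n F 1 := by
  unfold sphereSlice
  simp only [hF0 _ (Real.sqrt_pos.mpr hu), Real.sqrt_one, one_smul, Real.one_rpow]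
  rw [← mul_assoc, ← ENNReal.ofReal_mul (by positivity)]
  congr 2
  ring

theorem slicedSphere_of_homogeneous {n : ℕ} {F : EuclideanSpace ℝ (Fin (n + 1)) → ENNReal}
    (hF : Measurable F) (hF0 : ∀ c : ℝ, 0 < c → ∀ x, F (c • x) = F x) {u : ℝ} (hu : 0 < u) :
    slicedSphere n F u =
      ENNReal.ofReal (u ^ ((((n + 1 : ℕ) : ℝ) - 2) / 2)) * slicedSphere n F 1 := by
  have hm := measurable_indicator_sphereSlice hF
  have hm' : ∀ v : ℝ, Measurable fun t : ℝ =>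
      (Ioi (0 : ℝ)).indicator (sphereSlice n fun y => F (consVec t y)) (v - t ^ 2) :=
    fun v => hm.comp measurable_prodMk_left
  have hs : 0 < √u := Real.sqrt_pos.mpr hu
  unfold slicedSphere
  rw [lintegral_eq_mul_lintegral_comp_mul (hm' u) hs]
  have h1 : ∀ t : ℝ, (Ioi (0 : ℝ)).indicator (sphereSlice n fun y => F (consVec (√u * t) y))
      (u - (√u * t) ^ 2) = ENNReal.ofReal (u ^ (((n : ℝ) - 2) / 2)) *
        (Ioi (0 : ℝ)).indicator (sphereSlice n fun y => F (consVec t y)) (1 - t ^ 2) := by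
    intro t
    have e : u - (√u * t) ^ 2 = u * (1 - t ^ 2) := by
      rw [mul_pow, Real.sq_sqrt hu.le]; ring
    rw [e]
    by_cases ht : 0 < 1 - t ^ 2
    · rw [indicator_of_mem (mem_Ioi.mpr ht), indicator_of_mem (mem_Ioi.mpr (mul_pos hu ht))]
      unfold sphereSlice
      rw [← mul_assoc, ← ENNReal.ofReal_mul (by positivity), Real.mul_rpow hu.le ht.le,
        Real.sqrt_mul hu.le, mul_div_assoc]
      congr 1
      refine lintegral_congr fun x => ?_
      beta_reduce
      rw [mul_smul, ← smul_consVec, hF0 _ hs]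
    · rw [indicator_of_notMem (show 1 - t ^ 2 ∉ Ioi (0 : ℝ) from ht), indicator_of_notMem, mul_zero]
      rwa [mem_Ioi, mul_pos_iff_of_pos_left hu]
  simp only [h1]
  rw [lintegral_const_mul _ (hm' 1), ← mul_assoc,
    ← ENNReal.ofReal_mul hs.le]
  congr 2
  rw [Real.sqrt_eq_rpow, ← Real.rpow_add hu]
  congr 1
  push_cast
  ring

/-- For degree-zero homogeneous `F` both sides are the same power of `u` times their value at `u =
1`. Testing the weak identity against the indicator of `(0, 1)` and cancelling a finite nonzero
integral gives equality at `1`, hence at every `u`. -/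
theorem sphereSlice_eq_slicedSphere_of_homogeneous {n : ℕ}
    {F : EuclideanSpace ℝ (Fin (n + 2)) → ENNReal} (hF : Measurable F)
    (hF0 : ∀ c : ℝ, 0 < c → ∀ x, F (c • x) = F x) {u : ℝ} (hu : 0 < u) :
    sphereSlice (n + 2) F u = slicedSphere (n + 1) F u := by
  suffices h1 : sphereSlice (n + 2) F 1 = slicedSphere (n + 1) F 1 by
    rw [sphereSlice_of_homogeneous hF0 hu, slicedSphere_of_homogeneous hF hF0 hu, h1]
  have key := lintegral_sphereSlice_mul hF (k := (Ioo (0 : ℝ) 1).indicator 1)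
    (measurable_one.indicator measurableSet_Ioo)
  set w : ℝ → ENNReal := fun u => ENNReal.ofReal (u ^ ((((n + 2 : ℕ) : ℝ) - 2) / 2)) with hw
  have hwm : Measurable w := by fun_prop
  have hL : ∫⁻ u in Ioi (0 : ℝ), sphereSlice (n + 2) F u * (Ioo (0 : ℝ) 1).indicator 1 u =
      (∫⁻ u in Ioo (0 : ℝ) 1, w u) * sphereSlice (n + 2) F 1 := by
    rw [← lintegral_mul_const _ hwm, ← lintegral_indicator measurableSet_Ioi,
      ← lintegral_indicator measurableSet_Ioo]
    refine lintegral_congr fun u => ?_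
    by_cases hu : u ∈ Ioo (0 : ℝ) 1
    · rw [indicator_of_mem hu, indicator_of_mem (mem_Ioi.mpr hu.1), indicator_of_mem hu,
        sphereSlice_of_homogeneous hF0 hu.1, Pi.one_apply, mul_one]
    · rw [indicator_of_notMem hu]
      by_cases hu0 : u ∈ Ioi (0 : ℝ)
      · rw [indicator_of_mem hu0, indicator_of_notMem hu, mul_zero]
      · rw [indicator_of_notMem hu0]
  have hR : ∫⁻ u, slicedSphere (n + 1) F u * (Ioo (0 : ℝ) 1).indicator 1 u =
      (∫⁻ u in Ioo (0 : ℝ) 1, w u) * slicedSphere (n + 1) F 1 := by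
    rw [← lintegral_mul_const _ hwm, ← lintegral_indicator measurableSet_Ioo]
    refine lintegral_congr fun u => ?_
    by_cases hu : u ∈ Ioo (0 : ℝ) 1
    · rw [indicator_of_mem hu, indicator_of_mem hu,
        slicedSphere_of_homogeneous hF hF0 hu.1, Pi.one_apply, mul_one]
    · rw [indicator_of_notMem hu, indicator_of_notMem hu, mul_zero]
  rw [hL, hR] at key
  refine (ENNReal.mul_right_inj ?_ ?_).mp key
  · refine (setLIntegral_pos_iff hwm |>.mpr ?_).ne'
    have : Function.support w ∩ Ioo (0 : ℝ) 1 = Ioo 0 1 := by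
      refine inter_eq_right.mpr fun u hu => ?_
      have := hu.1
      simp only [hw, Function.mem_support, ne_eq, ENNReal.ofReal_eq_zero, not_le]
      positivity
    rw [this]
    simp
  · refine (lt_of_le_of_lt (setLIntegral_mono (g := fun _ => 1) measurable_const fun u hu => ?_)
      (?_ : _ < ⊤)).ne
    · refine ENNReal.ofReal_le_one.mpr (Real.rpow_le_one hu.1.le hu.2.le ?_)
      push_cast
      have : (0 : ℝ) ≤ n := n.cast_nonneg
      linarith
    · simp

/-- Both sides see only the values of `F` on the sphere of radius `√u`, so `F` may be replaced by
its degree-zero homogeneous extension from that sphere. This gives the identity at each `u`, not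
just almost everywhere. -/
theorem sphereSlice_eq_slicedSphere {n : ℕ} {F : EuclideanSpace ℝ (Fin (n + 2)) → ENNReal}
    (hF : Measurable F) {u : ℝ} (hu : 0 < u) :
    sphereSlice (n + 2) F u = slicedSphere (n + 1) F u := by
  set G : EuclideanSpace ℝ (Fin (n + 2)) → ENNReal := fun x => F (√u • ‖x‖⁻¹ • x) with hG
  have hGm : Measurable G := by fun_prop
  have hG0 : ∀ c : ℝ, 0 < c → ∀ x, G (c • x) = G x := by
    intro c hc x
    simp only [hG, norm_smul, Real.norm_of_nonneg hc.le, mul_inv, smul_smul]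
    congr 2
    field_simp
  have hFG : ∀ x, ‖x‖ ^ 2 = u → F x = G x := by
    intro x hx
    have h1 : ‖x‖ ≠ 0 := by rintro h0; simp [h0] at hx; linarith
    simp only [hG, ← hx, Real.sqrt_sq (norm_nonneg x), smul_smul, mul_inv_cancel₀ h1, one_smul]
  rw [sphereSlice_congr hu.le hFG, sphereSlice_eq_slicedSphere_of_homogeneous hGm hG0 hu]
  unfold slicedSphere
  refine lintegral_congr fun t => ?_
  by_cases ht : u - t ^ 2 ∈ Ioi (0 : ℝ)
  · rw [indicator_of_mem ht, indicator_of_mem ht]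
    refine sphereSlice_congr (le_of_lt ht) fun y hy => (hFG _ ?_).symm
    rw [norm_sq_consVec, hy]
    ring
  · rw [indicator_of_notMem ht, indicator_of_notMem ht]

/-! ### The integral of a product over spheres -/

/-- The density of `V₁² + ⋯ + Vₙ²`, expressed as an integral over a sphere. -/
def sphereProd (f : ℝ → ℝ) (n : ℕ) (u : ℝ) : ENNReal :=
  (Ioi (0 : ℝ)).indicator (sphereSlice n fun x => ∏ i, ENNReal.ofReal (f (x i))) u

theorem measurable_prod_ofReal (hf : Measurable f) (n : ℕ) :
    Measurable fun x : EuclideanSpace ℝ (Fin n) => ∏ i, ENNReal.ofReal (f (x i)) := by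
  fun_prop

theorem measurable_sphereProd (hf : Measurable f) (n : ℕ) : Measurable (sphereProd f n) := by
  refine Measurable.indicator ?_ measurableSet_Ioi
  exact measurable_sphereSlice (F := fun (_ : ℝ) x => ∏ i, ENNReal.ofReal (f (x i)))
    ((measurable_prod_ofReal hf n).comp measurable_snd) measurable_id

theorem prod_consVec {n : ℕ} (t : ℝ) (y : EuclideanSpace ℝ (Fin n)) :
    ∏ i, ENNReal.ofReal (f (consVec t y i)) =
      (∏ i, ENNReal.ofReal (f (y i))) * ENNReal.ofReal (f t) := by
  rw [Fin.prod_univ_succ, mul_comm]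
  rfl

namespace SquareDensity

/-- Slicing at first coordinate `t` leaves a sphere with squared radius `u - t²` and a factor
`f(t)`; the substitution `s = t²` carries `f(t) dt` to `h(s) ds`. -/
theorem sphereProd_succ (H : SquareDensity f h) (n : ℕ) (u : ℝ) :
    sphereProd f (n + 2) u = ∫⁻ s, ENNReal.ofReal (h s) * sphereProd f (n + 1) (u - s) := by
  have hm := measurable_prod_ofReal H.measurable_f (n + 1)
  rw [H.lintegral_mul (F := fun s => sphereProd f (n + 1) (u - s))
    ((measurable_sphereProd H.measurable_f _).comp (by fun_prop))]
  have h1 : ∀ t : ℝ, ENNReal.ofReal (f t) * sphereProd f (n + 1) (u - t ^ 2) =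
      (Ioi (0 : ℝ)).indicator (sphereSlice (n + 1) fun y =>
        ∏ i, ENNReal.ofReal (f (consVec t y i))) (u - t ^ 2) := by
    intro t
    by_cases ht : u - t ^ 2 ∈ Ioi (0 : ℝ)
    · rw [sphereProd, indicator_of_mem ht, indicator_of_mem ht]
      simp only [prod_consVec]
      rw [sphereSlice_mul_const hm, mul_comm]
    · rw [sphereProd, indicator_of_notMem ht, indicator_of_notMem ht, mul_zero]
  simp only [h1]
  by_cases hu : 0 < u
  · rw [sphereProd, indicator_of_mem (mem_Ioi.mpr hu),
      sphereSlice_eq_slicedSphere (measurable_prod_ofReal H.measurable_f _) hu, slicedSphere]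
  · rw [sphereProd, indicator_of_notMem (by simpa using hu), eq_comm, lintegral_eq_zero_iff']
    · refine Eventually.of_forall fun t => ?_
      refine indicator_of_notMem ?_ _
      simp only [mem_Ioi, not_lt]
      nlinarith [sq_nonneg t]
    · exact ((measurable_indicator_sphereSlice
        (measurable_prod_ofReal H.measurable_f _)).comp measurable_prodMk_left).aemeasurable

/-- In dimension one the remaining space `ℝ⁰` carries a Dirac mass, so the slices reduce to an
integral over `t` with `u = t²`. -/
theorem ae_eq_sphereProd_one (H : SquareDensity f h) :
    (fun u => ENNReal.ofReal (h u)) =ᵐ[volume] sphereProd f 1 := by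
  have hfm := H.measurable_f
  have hm := measurable_prod_ofReal H.measurable_f 1
  refine H.ae_eq (measurable_sphereProd H.measurable_f 1) fun k hk => ?_
  have h1 : ∫⁻ u, sphereProd f 1 u * k u = ∫⁻ u in Ioi (0 : ℝ),
      sphereSlice (0 + 1) (fun x => ∏ i, ENNReal.ofReal (f (x i))) u * k u := by
    rw [← lintegral_indicator measurableSet_Ioi]
    refine lintegral_congr fun u => ?_
    by_cases hu : u ∈ Ioi (0 : ℝ) <;> simp [sphereProd, hu]
  rw [h1, lintegral_sphereSlice_mul_eq hm hk, lintegral_consVec (by fun_prop)]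
  refine lintegral_congr fun t => ?_
  simp [volume_euclideanSpace_eq_dirac, norm_sq_consVec, consVec_zero]

/-- Both sides satisfy the same recursion. The starting point holds only almost everywhere, since
`h` is fixed only up to null sets, but one convolution already makes the identity hold everywhere.
-/
theorem lconvPow_eq_sphereProd (H : SquareDensity f h) :
    ∀ (n : ℕ) (u : ℝ), lconvPow h (n + 1) u = sphereProd f (n + 2) u
  | 0, u => by
    rw [H.sphereProd_succ, lconvPow]
    refine lintegral_congr_ae ?_
    filter_upwards [ae_comp_sub_left H.ae_eq_sphereProd_one u] with t ht
    rw [← ht, lconvPow]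
  | n + 1, u => by
    rw [H.sphereProd_succ, lconvPow]
    simp only [H.lconvPow_eq_sphereProd n]

end SquareDensity

/-- Valid even when the integral over the sphere is infinite: the Bochner integral and `toReal` then
both give `0`. -/
theorem normalisation_eq (hfm : Measurable f) (hf0 : ∀ x, 0 ≤ f x) (n : ℕ) {r : ℝ} (hr : 0 < r) :
    normalisation (n + 1) f √r =
      2 / (sphereArea (n + 1) * r ^ ((((n + 1 : ℕ) : ℝ) - 2) / 2)) *
        (sphereProd f (n + 1) r).toReal := by
  have hm := measurable_prod_ofReal hfm (n + 1)
  have hr' : 0 < r ^ ((((n + 1 : ℕ) : ℝ) - 2) / 2) := Real.rpow_pos_of_pos hr _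
  rw [normalisation, integral_eq_lintegral_of_nonneg_ae
    (Eventually.of_forall fun x => Finset.prod_nonneg fun i _ => hf0 _)
    (Measurable.aestronglyMeasurable (by fun_prop))]
  simp only [ENNReal.ofReal_prod_of_nonneg fun i _ => hf0 _]
  rw [uniformSphere, lintegral_map hm (by fun_prop), lintegral_smul_measure, smul_eq_mul,
    ENNReal.toReal_mul, ENNReal.toReal_inv, sphereProd, indicator_of_mem (mem_Ioi.mpr hr),
    sphereSlice, ENNReal.toReal_mul, ENNReal.toReal_ofReal (by positivity), sphereArea]
  field_simp

end

section

variable {f h : ℝ → ℝ} {E σ α : ℝ}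

/-! ### A sequence of cut-offs, and the normalisation function -/

/-- With `b_N = N^{-1/6}` and `τ = 1`, `N b_N³ = N^{1/2}`, which outgrows the logarithm. The maximum
with `1` keeps `b_0` positive. -/
theorem exists_cutoff : ∃ b : ℕ → ℝ, (∀ N, 0 < b N) ∧ Tendsto b atTop (𝓝 0) ∧
    Tendsto (fun N : ℕ => (N : ℝ) * b N ^ (2 + 1 : ℝ) / Real.log N) atTop atTop := by
  refine ⟨fun N => (max 1 (N : ℝ)) ^ (-(1 / 6) : ℝ), fun N => by positivity, ?_, ?_⟩
  · refine (tendsto_rpow_neg_atTop (by norm_num : (0 : ℝ) < 1 / 6)).comp ?_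
    exact tendsto_atTop_mono (fun N => le_max_right _ _) tendsto_natCast_atTop_atTop
  · have h1 : Tendsto (fun x : ℝ => x ^ (1 / 2 : ℝ) / Real.log x) atTop atTop := by
      have h2 := (isLittleO_log_rpow_atTop (by norm_num : (0 : ℝ) < 1 / 2)).tendsto_div_nhds_zero
      have h3 : Tendsto (fun x : ℝ => Real.log x / x ^ (1 / 2 : ℝ)) atTop (𝓝[>] 0) := by
        refine tendsto_nhdsWithin_iff.mpr ⟨h2, ?_⟩
        filter_upwards [eventually_gt_atTop 1] with x hx
        have := Real.log_pos hx
        exact div_pos this (by positivity)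
      refine h3.inv_tendsto_nhdsGT_zero.congr fun x => ?_
      simp
    refine (h1.comp tendsto_natCast_atTop_atTop).congr' ?_
    filter_upwards [eventually_ge_atTop 1] with N hN
    have hN1 : (1 : ℝ) ≤ N := by exact_mod_cast hN
    have hN0 : (0 : ℝ) < N := by linarith
    simp only [Function.comp_apply]
    rw [max_eq_right hN1, ← Real.rpow_mul hN0.le]
    congr 1
    nth_rewrite 2 [← Real.rpow_one (N : ℝ)]
    rw [← Real.rpow_add hN0]
    norm_num

namespace SquareDensity

theorem eventually_toReal_sphereProd (H : SquareDensity f h) {k : ℕ}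
    (hk : Integrable fun ξ => ‖cf h ξ‖ ^ k) :
    ∀ᶠ N : ℕ in atTop, ∀ r, (sphereProd f N r).toReal = convPow h N r := by
  filter_upwards [eventually_ge_atTop (k + 2)] with N hN r
  obtain ⟨n, rfl⟩ : ∃ n, N = n + 2 := ⟨N - 2, by omega⟩
  rw [← H.lconvPow_eq_sphereProd, lconvPow_eq H.integrable_h H.nonneg_h
    (integrable_norm_cf_pow_of_le H.integrable_h H.nonneg_h H.integral_h (by omega) hk),
    ENNReal.toReal_ofReal (convPow_nonneg H.nonneg_h (n + 1) r)]

theorem exists_normalisation_eq (H : SquareDensity f h) {k : ℕ}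
    (hk : Integrable fun ξ => ‖cf h ξ‖ ^ k) {ε : ℕ → ℝ} (hε : Tendsto ε atTop (𝓝 0))
    (hconv : ∀ᶠ N : ℕ in atTop, ∀ x : ℝ,
      |convPow h N x
        - stableDensity σ α 1 ((x - N * E) / (N : ℝ) ^ (1 / α)) / (N : ℝ) ^ (1 / α)|
        ≤ ε N / (N : ℝ) ^ (1 / α)) :
    ∃ lam : ℕ → ℝ → ℝ,
      (∀ N : ℕ, 1 ≤ N → ∀ r : ℝ, 0 < r →
        normalisation N f (√r) =
          2 / (sphereArea N * r ^ (((N : ℝ) - 2) / 2)) * (1 / (N : ℝ) ^ (1 / α)) *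
            (stableDensity σ α 1 ((r - N * E) / (N : ℝ) ^ (1 / α)) + lam N r)) ∧
      TendstoUniformly lam (fun _ => 0) atTop := by
  -- The error is defined by the identity it must satisfy, so the formula holds for every `N ≥ 1`;
  -- only its uniform smallness uses large `N`.
  refine ⟨fun N r => (N : ℝ) ^ (1 / α) * (sphereProd f N r).toReal -
    stableDensity σ α 1 ((r - N * E) / (N : ℝ) ^ (1 / α)), fun N hN r hr => ?_, ?_⟩
  · have hN0 : 0 < (N : ℝ) ^ (1 / α) := Real.rpow_pos_of_pos (by exact_mod_cast hN) _
    obtain ⟨n, rfl⟩ : ∃ n, N = n + 1 := ⟨N - 1, by omega⟩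
    rw [normalisation_eq H.measurable_f H.nonneg_f n hr, add_sub_cancel, mul_assoc,
      ← mul_assoc (1 / _), one_div_mul_cancel hN0.ne', one_mul]
  · rw [Metric.tendstoUniformly_iff]
    intro δ hδ
    filter_upwards [hconv, H.eventually_toReal_sphereProd hk, hε.eventually (gt_mem_nhds hδ),
      eventually_ge_atTop 1] with N h1 h2 h3 hN r
    have hN0 : 0 < (N : ℝ) ^ (1 / α) := Real.rpow_pos_of_pos (by exact_mod_cast hN) _
    rw [dist_comm, Real.dist_eq, sub_zero, h2]
    refine lt_of_le_of_lt ?_ h3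
    have h4 := mul_le_mul_of_nonneg_left (h1 r) hN0.le
    rw [mul_div_cancel₀ _ hN0.ne', ← abs_of_pos hN0, ← abs_mul, abs_of_pos hN0, mul_sub,
      mul_div_cancel₀ _ hN0.ne'] at h4
    exact h4

end SquareDensity

end

end StableLocalLimit

open StableLocalLimit

/-! ### Assembly of the theorem -/

theorem mainTheorem3 {Ω : Type*} [MeasurableSpace Ω] (P : Measure Ω) [IsProbabilityMeasure P]
    (V : Ω → ℝ) (f h : ℝ → ℝ)
    (hf : IsDensityOf f V P) (hh : IsDensityOf h (fun ω => V ω ^ 2) P)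
    (p : ENNReal) (hp : 1 < p) (hfp : MemLp f p volume)
    (E : ℝ) (hint : Integrable (fun x : ℝ => x ^ 2 * f x) volume)
    (hE : ∫ x : ℝ, x ^ 2 * f x = E)
    (C_S α : ℝ) (hC : 0 < C_S) (hα₁ : 1 < α) (hα₂ : α < 2)
    (hν : truncFourth f ~[atTop] fun x : ℝ => C_S * x ^ (2 - α))
    (σ : ℝ) (hσ : σ = stableScale C_S α) :
    -- the local limit theorem for the iterated convolutions of `h`
    (∃ ε : ℕ → ℝ, Tendsto ε atTop (𝓝 0) ∧
      ∀ᶠ N : ℕ in atTop, ∀ x : ℝ,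
        |convPow h N x
          - stableDensity σ α 1 ((x - N * E) / (N : ℝ) ^ (1 / α)) / (N : ℝ) ^ (1 / α)|
          ≤ ε N / (N : ℝ) ^ (1 / α)) ∧
    -- the remainder `η` of the centred Fourier transform of `h` is bounded by a multiple of
    -- `|ξ|^α`, and is `o(|ξ|^α)` at the origin
    (∃ M : ℝ, ∀ ξ : ℝ, ‖remainderFn h E σ α ξ‖ / |ξ| ^ α ≤ M) ∧
    Tendsto (fun ξ : ℝ => ‖remainderFn h E σ α ξ‖ / |ξ| ^ α) (𝓝[≠] 0) (𝓝 0) ∧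
    -- the explicit form of the error
    (∃ p' : ℝ, 1 < p' ∧ MemLp h (ENNReal.ofReal p') volume) ∧
    (∀ p' : ℝ, 1 < p' → MemLp h (ENNReal.ofReal p') volume →
      ∃ C : ℝ, 0 < C ∧ ∀ τ : ℝ, 0 < τ →
        ∃ φ : ℝ → ℝ, Tendsto (fun b : ℝ => φ b / |b| ^ (2 + τ)) (𝓝[≠] 0) (𝓝 0) ∧
          ∀ b : ℕ → ℝ, (∀ N, 0 < b N) → Tendsto b atTop (𝓝 0) →
            (∀ᶠ N : ℕ in atTop, ∀ x : ℝ,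
              |convPow h N x
                - stableDensity σ α 1 ((x - N * E) / (N : ℝ) ^ (1 / α)) / (N : ℝ) ^ (1 / α)|
                ≤ errorBound C σ α τ (Real.conjExponent (min 2 p')) φ
                    (remainderFn h E σ α) N (b N) / (N : ℝ) ^ (1 / α)) ∧
            (Tendsto (fun N : ℕ => (N : ℝ) * b N ^ (2 + τ) / Real.log N) atTop atTop →
              Tendsto (fun N : ℕ => errorBound C σ α τ (Real.conjExponent (min 2 p')) φ
                    (remainderFn h E σ α) N (b N)) atTop (𝓝 0))) ∧
    -- the asymptotics of the normalisation function
    (∃ lam : ℕ → ℝ → ℝ,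
      (∀ N : ℕ, 1 ≤ N → ∀ r : ℝ, 0 < r →
        normalisation N f (√r) =
          2 / (sphereArea N * r ^ (((N : ℝ) - 2) / 2)) * (1 / (N : ℝ) ^ (1 / α)) *
            (stableDensity σ α 1 ((r - N * E) / (N : ℝ) ^ (1 / α)) + lam N r)) ∧
      TendstoUniformly lam (fun _ => 0) atTop) := by

  subst hE hσ
  have H := SquareDensity.of_isDensityOf hf hh
  have hα : 0 < α := by linarith
  have hσ := stableScale_pos hC hα₁ hα₂
  have ht := tendsto_remainderFn H hint hC hα₁ hα₂ hν
  obtain ⟨r, hr, hfr⟩ := exists_integrable_rpow_of_memLp hp H.nonneg_f H.integrable_f hfp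
  obtain ⟨p₁, hp₁, hhp₁⟩ := H.exists_integrable_rpow hr hfr
  obtain ⟨k, hk1, hk⟩ := exists_integrable_norm_cf_pow H.measurable_h H.integrable_h H.nonneg_h
    H.integral_h hp₁ hhp₁
  obtain ⟨b, hb0, hb, hlog⟩ := exists_cutoff
  obtain ⟨ε, hε, hconv⟩ : ∃ ε : ℕ → ℝ, Tendsto ε atTop (𝓝 0) ∧
      ∀ᶠ N : ℕ in atTop, ∀ x : ℝ,
        |convPow h N x - stableDensity (stableScale C_S α) α 1
            ((x - N * ∫ x, x ^ 2 * f x) / (N : ℝ) ^ (1 / α)) / (N : ℝ) ^ (1 / α)|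
          ≤ ε N / (N : ℝ) ^ (1 / α) := by
    -- For the qualitative statement any parameters do; `τ = 1` matches the cut-off and the exponent
    -- offset is `0`.
    obtain ⟨C, -, hbound⟩ := exists_localLimit_bound hσ hα hα₂ H.integrable_h H.nonneg_h
      H.integral_h ht hk1 hk 0
    exact ⟨_, tendsto_errorBound hσ hα hα₂ ht C 0 one_pos hb0 hb hlog, hbound 1 one_pos b hb0 hb⟩
  refine ⟨⟨ε, hε, hconv⟩, remainderFn_bounded H.nonneg_h H.integral_h hσ.le hα ht, ht,
    ⟨p₁, hp₁, (memLp_ofReal_iff H.measurable_h H.nonneg_h hp₁).mpr hhp₁⟩, fun p' _ _ => ?_,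
    H.exists_normalisation_eq hk hε hconv⟩
  obtain ⟨C, hC0, hbound⟩ := exists_localLimit_bound hσ hα hα₂ H.integrable_h H.nonneg_h
    H.integral_h ht hk1 hk (Real.conjExponent (min 2 p'))
  -- The witness for `φ_τ` is zero, by the gap estimate `eventually_norm_cf_le`.
  exact ⟨C, hC0, fun τ hτ => ⟨fun _ => 0, by simp, fun b hb0 hb =>
    ⟨hbound τ hτ b hb0 hb, tendsto_errorBound hσ hα hα₂ ht C _ hτ hb0 hb⟩⟩⟩

end
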